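/- Let $F$ be a nonarchimedean local field with ring of integers $\mathcal O$, finite residue field $k$ of odd characteristic, $q=\#k$, normalized valuation $v$ and absolute value $|a|=q^{-v(a)}$. (For the completion $F=F_x$ of a function field at a place $x$ this is the local situation at $x$.) Let $F'/F$ be a ramified quadratic field extension and let $\eta\colon F^\times\to\{\pm1\}$ be the corresponding quadratic character, with kernel $\mathrm{Nm}(F'^\times)$. Let $\psi\colon F\to\mathbb C^\times$ be a unitary additive character that is unramified (its conductor is $\mathcal O$). Put $\epsilon(\eta,\tfrac12,\psi)=q^{-1/2}\sum_{u\in k^\times}\eta(a'u)\psi(a'u)$, where $a'\in F^\times$ is any element with $v(a')=-1$ and $u$ is lifted to $\mathcal O^\times$. Let $G=\mathrm{PGL}_2$, fix a Haar measure on $G(F)$, and let $d^\times a$ be the Haar measure on $F^\times$ with $\mathrm{vol}(\mathcal O^\times)=1$. Test functions. Let $\overline\eta\colon k\to\{0,\pm1\}$ be the nontrivial quadratic character of $k^\times$ extended by zero. Let $\widetilde h^\square$ and $\widetilde f^\square$ be the functions on $\mathrm{GL}_2(F)$ supported on $\{M=(a_{ij})\in\mathrm{Mat}_2(\mathcal O):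 v(\det M)=1\}$ and given there by $$\widetilde h^\square(M)=c(M)\prod_{i,j}(1+\overline\eta(\overline a_{ij})),\qquad c(M)=\tfrac12\text{ if all }a_{ij}\in\mathcal O^\times,\quad c(M)=1\text{ otherwise},$$ $$\widetilde f^\square(M)=\begin{cases}\overline\eta(\overline a_{11}\overline a_{12}),&a_{11},a_{12}\in\mathcal O^\times,\\ \overline\eta(\overline a_{21}\overline a_{22}),&a_{21},a_{22}\in\mathcal O^\times,\\ 0&\text{otherwise}\end{cases}$$ (the first two cases agree where they overlap). Let $h^\square$, $f^\square$ be the functions on $G(F)$ obtained from $\widetilde h^\square$, $\widetilde f^\square$ by integration along the fibres of $\mathrm{GL}_2(F)\to G(F)$, where $\mathcal O^\times$-orbits have volume $1$. Local spherical characters. Let $\pi$ be an irreducible admissible unitary generic representation of $G(F)$ that is unramified, with Satake parameter $\mathrm{diag}(\alpha,\alpha^{-1})$, and let $\mathcal W_\psi(\pi)$ be its Whittaker model, consisting of functions with $W\left(\begin{smallmatrix}1&x\\0&1\end{smallmatrix}g\right)=\psi(x)W(g)$. For $W$ in $\mathcal W_\psi(\pi)$, or the complex conjugate of such a function, and $\chi\in\{1,\eta\}$,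 let $$\lambda^\natural(W,\chi,s)=\frac1{L(\pi\otimes\chi,s+\frac12)}\int_{F^\times}W\begin{pmatrix}a&\\&1\end{pmatrix}\chi(a)|a|^s\,d^\times a$$ (by analytic continuation from $\mathrm{Re}(s)\gg0$), and let $$\theta^\natural(W,W')=\frac1{L(\pi\times\widetilde\pi,1)}\int_{F^\times}W\begin{pmatrix}a&\\&1\end{pmatrix}\overline{W'\begin{pmatrix}a&\\&1\end{pmatrix}}\,d^\times a,$$ where $L(\pi,s)=((1-\alpha q^{-s})(1-\alpha^{-1}q^{-s}))^{-1}$, $L(\pi\otimes\eta,s)=1$ and $L(\pi\times\widetilde\pi,s)=((1-q^{-s})^2(1-\alpha^2q^{-s})(1-\alpha^{-2}q^{-s}))^{-1}$. For a locally constant, compactly supported function $f$ on $G(F)$, with $\pi(f)=\int_{G(F)}f(g)\pi(g)\,dg$, and $s_1,s_2\in\mathbb C$, put $$\mathbb J_\pi(f,s_1,s_2)=\sum_{\{W_i\}}\frac{\lambda^\natural(\pi(f)W_i,1,s_1+s_2)\,\lambda^\natural(\overline{W_i},\eta,s_1-s_2)}{\theta^\natural(W_i,W_i)},$$ the sum running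 over any orthogonal basis $\{W_i\}$ of $\mathcal W_\psi(\pi)$ with respect to $\theta^\natural$. Proposition. For all $s_1,s_2\in\mathbb C$, $$\mathbb J_\pi(h^\square,s_1,s_2)=\mathbb J_\pi(f^\square,s_1,s_2)=\mathrm{vol}(G(\mathcal O))\,\zeta(2)\cdot\eta(-1)\,\overline{\epsilon(\eta,\tfrac12,\psi)}\cdot q^{\,s_1-s_2+\frac12},\qquad \zeta(2)=(1-q^{-2})^{-1}.$$ (Note that $\eta(-1)\overline{\epsilon(\eta,\frac12,\psi)}=\epsilon(\eta,\frac12,\psi)$.) -/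

import Mathlib

open MeasureTheory ValuativeRel
open scoped MatrixGroups

/-- The quotient topology on `PGL₂(F)`. -/
instance pglTopologicalSpace (F : Type*) [Field F] [TopologicalSpace F] :
    TopologicalSpace PGL(2, F) :=
  inferInstanceAs (TopologicalSpace (GL (Fin 2) F ⧸ Subgroup.center (GL (Fin 2) F)))

/-- The Borel σ-algebra of `PGL₂(F)`. -/
instance pglMeasurableSpace (F : Type*) [Field F] [TopologicalSpace F] :
    MeasurableSpace PGL(2, F) := borel _

noncomputable section

namespace LocalSpherical

/-! ### The local field -/

section Field

variable (F : Type*) [Field F] [ValuativeRel F] [TopologicalSpace F] [IsNonarchimedeanLocalField F]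

/-- `q`, the number of elements of the residue field. -/
def q : ℕ := Nat.card 𝓀[F]

variable {F}

/-- The normalized valuation `F → ℤ` (with the junk value `0` at `0`): the value group is
uniquely isomorphic to `ℤᵐ⁰` as an ordered group with zero, and a uniformizer has valuation `1`. -/
def ord (a : F) : ℤ :=
  -WithZero.log (IsNonarchimedeanLocalField.valueGroupWithZeroIsoInt F (valuation F a))

/-- The normalized absolute value `|a| = q ^ (-ord a)` on `Fˣ`. -/
def absF (a : Fˣ) : ℝ := (q F : ℝ) ^ (-ord (a : F))

/-- Reduction of integral elements to the residue field (junk value `0` elsewhere). -/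
def red (a : F) : 𝓀[F] := by
  classical
  exact if h : a ∈ 𝒪[F] then IsLocalRing.residue 𝒪[F] ⟨a, h⟩ else 0

variable (F) in
/-- A lift of the residue class `u` to `𝒪`. -/
def lift (u : 𝓀[F]) : 𝒪[F] := Function.surjInv IsLocalRing.residue_surjective u

variable (F) in
/-- The lift of a nonzero residue class to `Fˣ`. -/
def liftUnit (u : 𝓀[F]ˣ) : Fˣ :=
  Units.mk0 (lift F (u : 𝓀[F]) : F) (by
    intro h
    have h1 : IsLocalRing.residue 𝒪[F] (lift F (u : 𝓀[F])) = u :=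
      Function.surjInv_eq IsLocalRing.residue_surjective _
    have h2 : lift F (u : 𝓀[F]) = 0 := Subtype.ext h
    rw [h2, map_zero] at h1
    exact u.ne_zero h1.symm)

/-- The additive character `ψ` is unramified: its conductor is `𝒪`, i.e. `a𝒪 ⊆ ker ψ` holds
exactly when `a ∈ 𝒪`. -/
def IsUnramifiedAddChar (ψ : AddChar F Circle) : Prop :=
  ∀ a : F, (∀ x ∈ 𝒪[F], ψ (a * x) = 1) ↔ a ∈ 𝒪[F]

/-- A (quasi-)character of `Fˣ` is unramified if it is trivial on `𝒪ˣ`. -/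
def IsUnramifiedChar (χ : Fˣ → ℂ) : Prop := ∀ a : Fˣ, ord (a : F) = 0 → χ a = 1

/-- The field extension `L / F` is ramified: its ring of integers is ramified over `𝒪`. -/
def IsRamifiedExtension (F : Type*) [Field F] [ValuativeRel F] [TopologicalSpace F]
    [IsNonarchimedeanLocalField F] (L : Type*) [Field L] [Algebra F L] : Prop :=
  ¬ Algebra.FormallyUnramified 𝒪[F] (integralClosure 𝒪[F] L)

/-- The character `η` of `Fˣ` attached to a quadratic extension `L / F` by local class field
theory: it is `1` on norms from `L` and `-1` on the other elements. -/
def eta (F : Type*) [Field F] (L : Type*) [Field L] [Algebra F L] (a : Fˣ) : ℂ := by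
  classical
  exact if ∃ y : L, Algebra.norm F y = (a : F) then 1 else -1

/-- The nontrivial character `η̄ : 𝓀ˣ → {±1}` (the residue characteristic being odd),
extended by zero to `𝓀`. -/
def etaBar (u : 𝓀[F]) : ℂ := by
  classical
  exact if u = 0 then 0 else if IsSquare u then 1 else -1

/-- The `ε`-factor `ε(η, 1/2, ψ) = q ^ (-1/2) ∑_{u ∈ 𝓀ˣ} η(a' u) ψ(a' u)` of a ramified
quadratic character `η` (odd residue characteristic, `ψ` unramified); here `a'` is any element
of valuation `-1`. -/
def epsilonFactor (η : Fˣ → ℂ) (ψ : AddChar F Circle) (a' : Fˣ) : ℂ :=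
  (((q F : ℝ) ^ (-(1 / 2) : ℝ) : ℝ) : ℂ) *
    ∑ᶠ u : 𝓀[F]ˣ, η (a' * liftUnit F u) * (ψ ((a' * liftUnit F u : Fˣ) : F) : ℂ)

/-! ### The groups `GL₂(F)` and `PGL₂(F)` -/

/-- The matrix `(a b; 0 d)`. -/
def tri (a : Fˣ) (b : F) (d : Fˣ) : GL (Fin 2) F :=
  Matrix.GeneralLinearGroup.mkOfDetNeZero !![(a : F), b; 0, (d : F)] (by simp)

/-- The image of `diag(a, 1)` in `PGL₂(F)`. -/
def torus (a : Fˣ) : PGL(2, F) := Matrix.ProjGenLinGroup.mk (tri a 0 1)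

/-- The image of the unipotent matrix `(1 x; 0 1)` in `PGL₂(F)`. -/
def unip (x : F) : PGL(2, F) := Matrix.ProjGenLinGroup.mk (tri 1 x 1)

variable (F) in
/-- The maximal compact subgroup `PGL₂(𝒪)` of `PGL₂(F)`. -/
def maxCompact : Subgroup PGL(2, F) :=
  (Matrix.ProjGenLinGroup.map (n := Fin 2) (algebraMap 𝒪[F] F)).range

/-! ### The test functions -/

/-- Integration along the fibres of `GL₂(F) → PGL₂(F)`, with respect to the measure on the
fibres (torsors under `Fˣ`) coming from the Haar measure `ν` on `Fˣ`. -/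
def pushforward [MeasurableSpace F] (ν : Measure Fˣ) (φ : GL (Fin 2) F → ℂ) (g : PGL(2, F)) : ℂ :=
  ∫ z : Fˣ, φ (Matrix.GeneralLinearGroup.scalar (Fin 2) z *
    Function.surjInv Matrix.ProjGenLinGroup.mk_surjective g) ∂ν

/-- The set of matrices with entries in `𝒪` whose determinant has valuation `1`. -/
def IsInMatDetOne (g : GL (Fin 2) F) : Prop :=
  (∀ i j, g i j ∈ 𝒪[F]) ∧ ord (g : Matrix (Fin 2) (Fin 2) F).det = 1

/-- The function `h̃^□` on `GL₂(F)`. -/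
def hSquareTilde (g : GL (Fin 2) F) : ℂ := by
  classical
  exact if IsInMatDetOne g then
    (if ∀ i j, red (g i j) ≠ 0 then
      (1 / 2) * ∏ i, ∏ j, (1 + etaBar (red (g i j)))
    else ∏ i, ∏ j, (1 + etaBar (red (g i j))))
  else 0

/-- The function `f̃^□` on `GL₂(F)`. -/
def fSquareTilde (g : GL (Fin 2) F) : ℂ := by
  classical
  exact if IsInMatDetOne g then
    (if red (g 0 0) ≠ 0 ∧ red (g 0 1) ≠ 0 then etaBar (red (g 0 0) * red (g 0 1))
    else if red (g 1 0) ≠ 0 ∧ red (g 1 1) ≠ 0 then etaBar (red (g 1 0) * red (g 1 1))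
    else 0)
  else 0

variable [MeasurableSpace F]

/-- The test function `h^□` on `PGL₂(F)`. -/
def hSquare (ν : Measure Fˣ) : PGL(2, F) → ℂ := pushforward ν hSquareTilde

/-- The test function `f^□` on `PGL₂(F)`. -/
def fSquare (ν : Measure Fˣ) : PGL(2, F) → ℂ := pushforward ν fSquareTilde

end Field

/-! ### Representations of `PGL₂(F)` -/

section Rep

variable {F : Type*} [Field F] [ValuativeRel F] [TopologicalSpace F] [IsNonarchimedeanLocalField F]
  {V : Type*} [AddCommGroup V] [Module ℂ V]

/-- The subspace of vectors fixed by a subgroup. -/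
def fixedVectors (π : Representation ℂ PGL(2, F) V) (U : Subgroup PGL(2, F)) : Submodule ℂ V where
  carrier := {v | ∀ g ∈ U, π g v = v}
  add_mem' := fun {v w} hv hw g hg => by rw [map_add, hv g hg, hw g hg]
  zero_mem' := fun g _ => map_zero (π g)
  smul_mem' := fun c v hv g hg => by rw [map_smul, hv g hg]

/-- Irreducible admissible (complex) representations. -/
structure IsIrreducibleAdmissible (π : Representation ℂ PGL(2, F) V) : Prop where
  smooth : ∀ v : V, IsOpen {g : PGL(2, F) | π g v = v}
  admissible : ∀ U : Subgroup PGL(2, F), IsOpen (U : Set PGL(2, F)) →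
    FiniteDimensional ℂ (fixedVectors π U)
  irreducible : π.IsIrreducible

/-- Unitarizable representations: there is an invariant positive definite Hermitian form. -/
def IsUnitary (π : Representation ℂ PGL(2, F) V) : Prop :=
  ∃ c : InnerProductSpace.Core ℂ V, ∀ (g : PGL(2, F)) (v w : V),
    c.inner (π g v) (π g w) = c.inner v w

/-- Unramified representations: there is a nonzero vector fixed by `PGL₂(𝒪)`. -/
def IsUnramified (π : Representation ℂ PGL(2, F) V) : Prop :=
  ∃ v ∈ fixedVectors π (maxCompact F), v ≠ 0

/-- The Hecke operator of the double coset of `diag(ϖ, 1)`, acting on vectors fixed by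
`K = PGL₂(𝒪)`, through the left cosets
`K diag(ϖ, 1) K = ⋃_{u ∈ 𝓀} (ϖ u; 0 1) K ∪ diag(1, ϖ) K`. -/
def heckeT (π : Representation ℂ PGL(2, F) V) (ϖ : Fˣ) (v : V) : V :=
  (∑ᶠ u : 𝓀[F], π (Matrix.ProjGenLinGroup.mk (tri ϖ (lift F u : F) 1)) v) +
    π (Matrix.ProjGenLinGroup.mk (tri 1 0 ϖ)) v

/-- `α` is a Satake parameter of the unramified representation `π`, i.e. the conjugacy class of
`diag(α, α⁻¹)` in `SL₂(ℂ)` is the Satake parameter: the Hecke operator of `diag(ϖ, 1)` acts on a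
spherical vector by `q ^ (1/2) (α + α⁻¹)`. -/
def IsSatakeParameter (π : Representation ℂ PGL(2, F) V) (α : ℂ) : Prop :=
  α ≠ 0 ∧ ∃ v ∈ fixedVectors π (maxCompact F), v ≠ 0 ∧ ∀ ϖ : Fˣ, ord (ϖ : F) = 1 →
    heckeT π ϖ v = ((Real.sqrt (q F) : ℂ) * (α + α⁻¹)) • v

/-- A Satake parameter of `π` (defined up to `α ↔ α⁻¹`). -/
def satake (π : Representation ℂ PGL(2, F) V) : ℂ := Classical.epsilon (IsSatakeParameter π)

/-- A uniformizer of `F`. -/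
def uniformizer (F : Type*) [Field F] [ValuativeRel F] [TopologicalSpace F]
    [IsNonarchimedeanLocalField F] : Fˣ :=
  Classical.epsilon fun ϖ : Fˣ => ord (ϖ : F) = 1

/-- The local `L`-factor `L(π ⊗ χ, s)` for an unramified representation `π`: it is
`((1 - α χ(ϖ) q⁻ˢ) (1 - α⁻¹ χ(ϖ) q⁻ˢ))⁻¹` if `χ` is unramified and `1` if `χ` is ramified. -/
def lFactor (π : Representation ℂ PGL(2, F) V) (χ : Fˣ → ℂ) (s : ℂ) : ℂ := by
  classical
  exact if IsUnramifiedChar χ then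
    ((1 - satake π * χ (uniformizer F) * (q F : ℂ) ^ (-s)) *
      (1 - (satake π)⁻¹ * χ (uniformizer F) * (q F : ℂ) ^ (-s)))⁻¹
  else 1

/-- The local Rankin-Selberg `L`-factor `L(π × π̃, s)` for an unramified representation `π`. -/
def lFactorRankinSelberg (π : Representation ℂ PGL(2, F) V) (s : ℂ) : ℂ :=
  ((1 - (q F : ℂ) ^ (-s)) ^ 2 * (1 - satake π ^ 2 * (q F : ℂ) ^ (-s)) *
    (1 - (satake π)⁻¹ ^ 2 * (q F : ℂ) ^ (-s)))⁻¹

/-- `𝒲` is the Whittaker model of `π` with respect to `ψ`: a space of functions `W` with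
`W((1 x; 0 1) g) = ψ(x) W(g)`, stable under right translation and isomorphic to `π`. -/
structure IsWhittakerModel (π : Representation ℂ PGL(2, F) V) (ψ : AddChar F Circle)
    (𝒲 : Submodule ℂ (PGL(2, F) → ℂ)) : Prop where
  whittaker : ∀ W ∈ 𝒲, ∀ (x : F) (g : PGL(2, F)), W (unip x * g) = (ψ x : ℂ) * W g
  iso : ∃ e : V ≃ₗ[ℂ] 𝒲, ∀ (g : PGL(2, F)) (v : V) (h : PGL(2, F)),
    (e (π g v) : PGL(2, F) → ℂ) h = (e v : PGL(2, F) → ℂ) (h * g)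

/-- The action `π(f) W = ∫ f(g) π(g) W dg` of a function `f` on functions on `PGL₂(F)`, through
right translation. -/
def heckeAction (μ : Measure PGL(2, F)) (f W : PGL(2, F) → ℂ) : PGL(2, F) → ℂ :=
  fun h => ∫ g, f g * W (h * g) ∂μ

variable [MeasurableSpace F]

/-- `Λ` is the function `s ↦ λ♮(W, χ, s)`: the entire function that is equal to
`L(π ⊗ χ, s + 1/2)⁻¹ ∫ W(diag(a, 1)) χ(a) |a|ˢ d×a` for `re s` large, where the integral is
absolutely convergent. -/
def IsLambdaNat (ν : Measure Fˣ) (π : Representation ℂ PGL(2, F) V) (W : PGL(2, F) → ℂ)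
    (χ : Fˣ → ℂ) (Λ : ℂ → ℂ) : Prop :=
  Differentiable ℂ Λ ∧ ∃ σ : ℝ, ∀ s : ℂ, σ < s.re →
    Integrable (fun a : Fˣ => W (torus a) * χ a * (absF a : ℂ) ^ s) ν ∧
    Λ s = (lFactor π χ (s + 1 / 2))⁻¹ * ∫ a : Fˣ, W (torus a) * χ a * (absF a : ℂ) ^ s ∂ν

/-- The normalized linear functional `λ♮(W, χ, s)`. -/
def lambdaNat (ν : Measure Fˣ) (π : Representation ℂ PGL(2, F) V) (W : PGL(2, F) → ℂ)
    (χ : Fˣ → ℂ) (s : ℂ) : ℂ :=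
  Classical.epsilon (IsLambdaNat ν π W χ) s

/-- The normalized inner product `θ♮(W, W')`. -/
def thetaNat (ν : Measure Fˣ) (π : Representation ℂ PGL(2, F) V) (W W' : PGL(2, F) → ℂ) : ℂ :=
  (lFactorRankinSelberg π 1)⁻¹ * ∫ a : Fˣ, W (torus a) * starRingEnd ℂ (W' (torus a)) ∂ν

/-- A basis of the Whittaker model that is orthogonal with respect to `θ♮`. -/
def IsOrthogonalBasis (ν : Measure Fˣ) (π : Representation ℂ PGL(2, F) V)
    {𝒲 : Submodule ℂ (PGL(2, F) → ℂ)} {ι : Type*} (b : Module.Basis ι ℂ 𝒲) : Prop :=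
  Pairwise fun i j => thetaNat ν π (b i : PGL(2, F) → ℂ) (b j : PGL(2, F) → ℂ) = 0

/-- The local spherical character `𝕁_π(f, s₁, s₂)`, computed with the basis `b`. Only finitely many
terms are nonzero when `b` is orthogonal and `f` is locally constant with compact support. -/
def sphericalCharacter (μ : Measure PGL(2, F)) (ν : Measure Fˣ)
    (π : Representation ℂ PGL(2, F) V) (η : Fˣ → ℂ)
    {𝒲 : Submodule ℂ (PGL(2, F) → ℂ)} {ι : Type*} (b : Module.Basis ι ℂ 𝒲)
    (f : PGL(2, F) → ℂ) (s₁ s₂ : ℂ) : ℂ :=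
  ∑ᶠ i, lambdaNat ν π (heckeAction μ f (b i : PGL(2, F) → ℂ)) (fun _ => 1) (s₁ + s₂) *
      lambdaNat ν π (fun g => starRingEnd ℂ ((b i : PGL(2, F) → ℂ) g)) η (s₁ - s₂) /
    thetaNat ν π (b i : PGL(2, F) → ℂ) (b i : PGL(2, F) → ℂ)

end Rep

end LocalSpherical

end

/-! Write `K` for `PGL₂(𝒪)` and `v` for the spherical vector whose Whittaker function `W` satisfies
`W(1) = 1`. Both test functions live on the double coset `K diag(ϖ, 1) K` (`detOneSet`). Its
integral representatives with determinant of valuation one reduce to rank-one matrices `(x i * y j)`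
over the residue field.

The function `f^□` depends only on `y`, so it is left `K`-invariant and `π(f^□)` maps everything
into the line of `v`. Invariance of `θ♮` gives `π(f^□) w = vol(K) θ♮(w, X) / θ♮(v, v) • v`, where
`X` is the sum of `η̄(u) π(c_u⁻¹) v` over the cosets `K c_u` (`testInt_eq_smul`). Since `λ♮(v, 1, s)
= 1`, the sum over an orthogonal basis is the expansion of `X`, and the spherical character equals
`vol(K) / θ♮(v, v)` times `λ♮(X̄, η, s₁ - s₂)` (`sphericalCharacter_eq`). The Rankin-Selberg
computation gives `θ♮(v, v) = 1 - q⁻²`. On the torus, `X(a)` is the sum of `η̄(u) ψ(-a u)` times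
`W(a ϖ)`. It vanishes for `ord a ≥ 0` because `η̄` sums to zero, and for `ord a < -1` because `W`
does. The shell `ord a = -1` yields a Gauss sum times `q ^ (s₁ - s₂)` (`lambdaNat_conj_sum`).

For `h^□`, integration over unit scalars keeps the even part of the product, which is `(1 + η̄(x₀
x₁)) (1 + η̄(y₀ y₁))`. Hence `h^□` is the indicator of the double coset, plus `f^□`, plus a term odd
under unit torus elements (`hSquare_eq`). The odd term is killed by `λ♮(·, 1, s)`. The indicator
acts through the Hecke operator, which only adds a multiple of `v` to `X`, and `λ♮(v̄, η, s) = 0`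
because `η` is ramified. So both characters agree.

The supporting facts are these. Spherical vectors form a line (`fixedVectors_eq_span`). Unitarity
and genericity give `|α|, |α⁻¹| < √q`, hence all convergence (`satake_bound`). The form `θ♮`,
visibly invariant only under the Borel subgroup, is proportional to the unitary form, because a
Borel-invariant hermitian form is determined by its value at `v` (`IsBorelForm.eq_zero`). Finally,
`η` restricted to units is `η̄` (`eta_norm_facts`). -/

set_option linter.unusedSectionVars false

namespace LocalSpherical

/-! ### Valuation, reduction and valuation shells of the local field -/

section FieldLemmas

variable {F : Type*} [Field F] [ValuativeRel F] [TopologicalSpace F] [IsNonarchimedeanLocalField F]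

local notation "viso" => IsNonarchimedeanLocalField.valueGroupWithZeroIsoInt F

lemma viso_ne_zero {a : F} (ha : a ≠ 0) : viso (valuation F a) ≠ 0 := by
  simpa using ha

lemma ord_mul {a b : F} (ha : a ≠ 0) (hb : b ≠ 0) : ord (a * b) = ord a + ord b := by
  unfold ord
  rw [map_mul, map_mul, WithZero.log_mul (viso_ne_zero ha) (viso_ne_zero hb)]
  ring

lemma ord_mul_units (a b : Fˣ) : ord ((a * b : Fˣ) : F) = ord (a : F) + ord (b : F) := by
  rw [Units.val_mul, ord_mul a.ne_zero b.ne_zero]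

@[simp] lemma ord_one : ord (1 : F) = 0 := by simp [ord]

/-- The normalized valuation as a homomorphism. -/
noncomputable def ordHom (F : Type*) [Field F] [ValuativeRel F] [TopologicalSpace F]
    [IsNonarchimedeanLocalField F] : Fˣ →* Multiplicative ℤ where
  toFun a := Multiplicative.ofAdd (ord (a : F))
  map_one' := by simp
  map_mul' a b := by simp only [ord_mul_units, ofAdd_add]

lemma ord_inv_units (a : Fˣ) : ord ((a⁻¹ : Fˣ) : F) = -ord (a : F) := by
  have := ord_mul_units a a⁻¹
  simp only [mul_inv_cancel, Units.val_one, ord_one] at this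
  omega

lemma ord_zpow_units (a : Fˣ) (n : ℤ) : ord ((a ^ n : Fˣ) : F) = n * ord (a : F) := by
  have := congrArg Multiplicative.toAdd (map_zpow (ordHom F) a n)
  simpa [ordHom] using this

lemma ord_pow_units (a : Fˣ) (n : ℕ) : ord ((a ^ n : Fˣ) : F) = n * ord (a : F) := by
  have := ord_zpow_units a n
  simpa using this

lemma units_mem_integer_iff (a : Fˣ) : (a : F) ∈ 𝒪[F] ↔ 0 ≤ ord (a : F) := by
  have h : (a : F) ∈ 𝒪[F] ↔ valuation F (a : F) ≤ 1 := Iff.rfl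
  rw [h]
  have h2 : valuation F (a : F) ≤ 1 ↔ viso (valuation F (a : F)) ≤ viso 1 :=
    (map_le_map_iff (viso)).symm
  rw [h2, map_one, ord, neg_nonneg, ← WithZero.log_one (M := ℤ),
    WithZero.log_le_log (viso_ne_zero a.ne_zero) one_ne_zero]

lemma mem_integer_iff_ord {a : F} (ha : a ≠ 0) : a ∈ 𝒪[F] ↔ 0 ≤ ord a :=
  units_mem_integer_iff (Units.mk0 a ha)

lemma exists_ord_eq (n : ℤ) : ∃ a : Fˣ, ord (a : F) = n := by
  obtain ⟨x, hx⟩ := (viso).surjective (WithZero.exp (-n))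
  obtain ⟨a, rfl⟩ := ValuativeRel.valuation_surjective x
  have ha : a ≠ 0 := by
    rintro rfl
    rw [map_zero] at hx
    exact WithZero.exp_ne_zero ((map_zero (viso)).symm.trans hx).symm
  refine ⟨Units.mk0 a ha, ?_⟩
  have hx' : viso (valuation F a) = WithZero.exp (-n) := hx
  simp [ord, hx']

lemma ord_uniformizer : ord (uniformizer F : F) = 1 := Classical.epsilon_spec (exists_ord_eq 1)

lemma isUnit_integer_iff (a : 𝒪[F]) : IsUnit a ↔ (a : F) ≠ 0 ∧ ord (a : F) = 0 := by
  constructor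
  · rintro ⟨u, rfl⟩
    have h0 : ((u : 𝒪[F]) : F) ≠ 0 := by
      intro h
      exact u.ne_zero (Subtype.ext h)
    have h0' : ((u⁻¹ : 𝒪[F]ˣ) : F) ≠ 0 := by
      intro h
      exact (u⁻¹).ne_zero (Subtype.ext h)
    refine ⟨h0, ?_⟩
    have h1 := (mem_integer_iff_ord h0).1 (u : 𝒪[F]).2
    have h2 := (mem_integer_iff_ord h0').1 ((u⁻¹ : 𝒪[F]ˣ) : 𝒪[F]).2
    have h3 : ((u : 𝒪[F]) : F) * ((u⁻¹ : 𝒪[F]ˣ) : 𝒪[F]) = 1 := by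
      exact_mod_cast congrArg Subtype.val (u.mul_inv)
    have h4 := ord_mul h0 h0'
    rw [h3, ord_one] at h4
    omega
  · rintro ⟨h0, h1⟩
    have h2 : (a : F)⁻¹ ∈ 𝒪[F] := by
      rw [mem_integer_iff_ord (inv_ne_zero h0)]
      have := ord_inv_units (Units.mk0 _ h0)
      simp only [Units.val_inv_eq_inv_val, Units.val_mk0] at this
      omega
    exact IsUnit.of_mul_eq_one ⟨_, h2⟩ (Subtype.ext (mul_inv_cancel₀ h0))

lemma red_of_mem {a : F} (h : a ∈ 𝒪[F]) : red a = IsLocalRing.residue 𝒪[F] ⟨a, h⟩ := by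
  simp [red, h]

lemma red_coe (a : 𝒪[F]) : red (a : F) = IsLocalRing.residue 𝒪[F] a := red_of_mem a.2

lemma red_add {a b : F} (ha : a ∈ 𝒪[F]) (hb : b ∈ 𝒪[F]) : red (a + b) = red a + red b := by
  rw [red_of_mem ha, red_of_mem hb, red_of_mem (add_mem ha hb), ← map_add]; rfl

lemma red_mul {a b : F} (ha : a ∈ 𝒪[F]) (hb : b ∈ 𝒪[F]) : red (a * b) = red a * red b := by
  rw [red_of_mem ha, red_of_mem hb, red_of_mem (mul_mem ha hb), ← map_mul]; rfl

lemma red_neg {a : F} (ha : a ∈ 𝒪[F]) : red (-a) = -red a := by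
  rw [red_of_mem ha, red_of_mem (neg_mem ha), ← map_neg]; rfl

lemma red_sub {a b : F} (ha : a ∈ 𝒪[F]) (hb : b ∈ 𝒪[F]) : red (a - b) = red a - red b := by
  rw [red_of_mem ha, red_of_mem hb, red_of_mem (sub_mem ha hb), ← map_sub]; rfl

@[simp] lemma red_zero : red (0 : F) = 0 := by
  rw [red_of_mem (zero_mem _)]; exact map_zero _

@[simp] lemma red_one : red (1 : F) = 1 := by
  rw [red_of_mem (one_mem _)]; exact map_one _

lemma red_lift (u : 𝓀[F]) : red (lift F u : F) = u := by
  rw [red_coe]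
  exact Function.surjInv_eq IsLocalRing.residue_surjective u

lemma red_units_ne_zero_iff (a : Fˣ) (ha : (a : F) ∈ 𝒪[F]) :
    red (a : F) ≠ 0 ↔ ord (a : F) = 0 := by
  rw [red_of_mem ha, IsLocalRing.residue_ne_zero_iff_isUnit, isUnit_integer_iff]
  simp

lemma red_ne_zero_iff {a : F} (ha : a ∈ 𝒪[F]) : red a ≠ 0 ↔ a ≠ 0 ∧ ord a = 0 := by
  rw [red_of_mem ha, IsLocalRing.residue_ne_zero_iff_isUnit, isUnit_integer_iff]

lemma units_mem_of_ord_eq_zero {a : Fˣ} (ha : ord (a : F) = 0) : (a : F) ∈ 𝒪[F] := by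
  rw [units_mem_integer_iff]; omega

lemma ord_liftUnit (u : 𝓀[F]ˣ) : ord (liftUnit F u : F) = 0 := by
  have h : (liftUnit F u : F) ∈ 𝒪[F] := (lift F (u : 𝓀[F])).2
  rw [← red_units_ne_zero_iff _ h]
  have : red (liftUnit F u : F) = u := red_lift _
  rw [this]
  exact u.ne_zero

lemma red_liftUnit (u : 𝓀[F]ˣ) : red (liftUnit F u : F) = u := red_lift _

/-- Division by an element of smaller valuation. -/
lemma div_mem_of_ord_le {a b : F} (hb : b ≠ 0) (h : a ≠ 0 → ord b ≤ ord a) : a / b ∈ 𝒪[F] := by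
  by_cases ha : a = 0
  · simp [ha]
  · rw [mem_integer_iff_ord (div_ne_zero ha hb)]
    have h1 := ord_mul (div_ne_zero ha hb) hb
    rw [div_mul_cancel₀ _ hb] at h1
    have := h ha
    omega

lemma div_mem_of_red_eq_zero {a : F} (ha : a ∈ 𝒪[F]) (h : red a = 0) {ϖ : Fˣ}
    (hϖ : ord (ϖ : F) = 1) : a / ϖ ∈ 𝒪[F] := by
  refine div_mem_of_ord_le ϖ.ne_zero fun h0 => ?_
  have h1 := (mem_integer_iff_ord h0).1 ha
  have h2 := (red_ne_zero_iff ha).not.1 (not_not.2 h)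
  have : ord a ≠ 0 := fun h3 => h2 ⟨h0, h3⟩
  omega

lemma red_eq_zero_of_ord_pos {a : F} (h : 0 < ord a) : red a = 0 := by
  by_contra h1
  by_cases ha : a ∈ 𝒪[F]
  · have := ((red_ne_zero_iff ha).1 h1).2
    omega
  · exact h1 (by simp [red, ha])

lemma ord_neg (a : F) : ord (-a) = ord a := by
  simp [ord, Valuation.map_neg]

/-- An element `1 + x` with `x` in the maximal ideal is a unit. -/
lemma ord_one_add {x : F} (hx : x ∈ 𝒪[F]) (h : red x = 0) : 1 + x ≠ 0 ∧ ord (1 + x) = 0 := by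
  rw [← red_ne_zero_iff (add_mem (one_mem _) hx), red_add (one_mem _) hx, h]
  simp

lemma one_lt_q : 1 < q F := by
  have : Finite 𝓀[F] := inferInstance
  exact Finite.one_lt_card

lemma q_pos : 0 < q F := lt_trans one_pos one_lt_q

lemma absF_eq (a : Fˣ) : absF a = (q F : ℝ) ^ (-ord (a : F)) := rfl

/-- `|a|ˢ = (q⁻ˢ) ^ ord a`. -/
lemma absF_cpow (a : Fˣ) (s : ℂ) :
    (absF a : ℂ) ^ s = ((q F : ℂ) ^ (-s)) ^ (ord (a : F)) := by
  have hq : (0 : ℝ) < q F := by exact_mod_cast q_pos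
  have hq0 : (q F : ℂ) ≠ 0 := by exact_mod_cast hq.ne'
  have h1 : (absF a : ℂ) = Complex.exp (((-ord (a : F) : ℝ) * Real.log (q F) : ℝ) : ℂ) := by
    rw [absF_eq, ← Complex.ofReal_exp, mul_comm, ← Real.rpow_def_of_pos hq, ← Real.rpow_intCast]
    push_cast
    rfl
  rw [h1, Complex.cpow_def_of_ne_zero (Complex.exp_ne_zero _), ← Complex.ofReal_exp,
    ← Complex.ofReal_log (Real.exp_pos _).le, Real.log_exp, Complex.cpow_def_of_ne_zero hq0,
    ← Complex.exp_int_mul]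
  congr 1
  rw [show (q F : ℂ) = ((q F : ℝ) : ℂ) by simp, ← Complex.ofReal_log hq.le]
  push_cast
  ring

/-! ### Integration over `Fˣ` -/

lemma isOpen_integer : IsOpen (𝒪[F] : Set F) := by
  refine AddSubgroup.isOpen_of_mem_nhds (𝒪[F]).toAddSubgroup (g := 0) ?_
  refine Filter.mem_of_superset
    ((IsValuativeTopology.hasBasis_nhds_zero' F).mem_of_mem (i := 1) one_ne_zero) fun x hx => ?_
  exact le_of_lt (show valuation F x < 1 from hx)

/-- After a shift by an element of valuation `-n` the shell becomes the unit group, where an element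
and its inverse are both integral; these are open conditions. -/
lemma isOpen_ord_eq (n : ℤ) : IsOpen {a : Fˣ | ord (a : F) = n} := by
  obtain ⟨b, hb⟩ := exists_ord_eq (F := F) (-n)
  have h : {a : Fˣ | ord (a : F) = n} = (fun a : Fˣ => ((a * b : Fˣ) : F)) ⁻¹' (𝒪[F] : Set F) ∩
      (fun a : Fˣ => (((a * b)⁻¹ : Fˣ) : F)) ⁻¹' (𝒪[F] : Set F) := by
    ext a
    simp only [Set.mem_ofPred_eq, Set.mem_inter_iff, Set.mem_preimage, SetLike.mem_coe,
      units_mem_integer_iff, ord_inv_units, ord_mul_units, hb]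
    omega
  rw [h]
  exact (isOpen_integer.preimage (by fun_prop)).inter (isOpen_integer.preimage
    (Units.continuous_val.comp (continuous_inv.comp (continuous_mul_const b))))

lemma continuous_ord : Continuous fun a : Fˣ => ord (a : F) :=
  continuous_discrete_rng.2 fun n => isOpen_ord_eq n

variable [MeasurableSpace F] [BorelSpace F]


lemma units_measurableSpace_eq :
    (Units.instMeasurableSpace : MeasurableSpace Fˣ) = borel Fˣ := by
  have h2 : borel Fˣ = MeasurableSpace.comap (fun a : Fˣ => (a : F)) (borel F) := by
    refine Eq.trans ?_ borel_comap
    exact congrArg (fun t => @borel Fˣ t) Units.isEmbedding_val₀.eq_induced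
  rw [h2, ← BorelSpace.measurable_eq (α := F)]
  rfl

instance unitsBorelSpace : BorelSpace Fˣ := ⟨units_measurableSpace_eq⟩

variable (ν : Measure Fˣ) [ν.IsHaarMeasure]

lemma measure_ord_eq (hν : ν {a : Fˣ | ord (a : F) = 0} = 1) (n : ℤ) :
    ν {a : Fˣ | ord (a : F) = n} = 1 := by
  obtain ⟨b, hb⟩ := exists_ord_eq (F := F) (-n)
  rw [← hν, ← measure_preimage_mul ν b {a : Fˣ | ord (a : F) = 0}]
  congr 1
  ext a
  simp only [Set.mem_ofPred_eq, Set.mem_preimage, ord_mul_units, hb]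
  omega

/-- Translation carries the unit group to every shell, so all shells have mass one. Integrals of
functions of the valuation thereby become sums over `ℤ`. -/
lemma map_ord (hν : ν {a : Fˣ | ord (a : F) = 0} = 1) :
    ν.map (fun a : Fˣ => ord (a : F)) = Measure.count := by
  refine Measure.ext_of_singleton fun n => ?_
  rw [Measure.map_apply continuous_ord.measurable (measurableSet_singleton n),
    Measure.count_singleton]
  exact measure_ord_eq ν hν n

variable {ν}

lemma integrable_ord_iff (hν : ν {a : Fˣ | ord (a : F) = 0} = 1) {G : ℤ → ℂ} :
    Integrable (fun a : Fˣ => G (ord (a : F))) ν ↔ Summable G := by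
  have h : Integrable G (ν.map fun a : Fˣ => ord (a : F)) ↔ _ :=
    integrable_map_measure (by fun_prop) continuous_ord.measurable.aemeasurable
  rw [map_ord ν hν, integrable_count_iff, summable_norm_iff] at h
  exact h.symm

lemma integral_ord (hν : ν {a : Fˣ | ord (a : F) = 0} = 1) {G : ℤ → ℂ} (hG : Summable G) :
    ∫ a : Fˣ, G (ord (a : F)) ∂ν = ∑' n, G n := by
  have h : ∫ n, G n ∂(ν.map fun a : Fˣ => ord (a : F)) = _ :=
    integral_map continuous_ord.measurable.aemeasurable (by fun_prop)
  rw [← h, map_ord ν hν, integral_countable]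
  · simp
  · rw [integrable_count_iff]
    exact hG.norm

/-- Substituting `u * a` for `a` shows that the integral is its own negative; integrability is not
needed. All odd or ramified contributions are discarded this way. -/
lemma integral_eq_zero_of_twist {G : Fˣ → ℂ} (u : Fˣ) (hG : ∀ a, G (u * a) = -G a) :
    ∫ a, G a ∂ν = 0 := by
  have h := integral_mul_left_eq_self (μ := ν) G u
  simp only [hG, integral_neg] at h
  exact self_eq_neg.1 h.symm

end FieldLemmas

end LocalSpherical

namespace LocalSpherical

open Matrix

/-! ### Matrix identities in `PGL₂` -/

section GroupLemmas

variable {F : Type*} [Field F]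

@[simp] lemma coe_tri (a : Fˣ) (b : F) (d : Fˣ) :
    (tri a b d : Matrix (Fin 2) (Fin 2) F) = !![(a : F), b; 0, (d : F)] := rfl

lemma coe_mkOfDetNeZero (A : Matrix (Fin 2) (Fin 2) F) (h : A.det ≠ 0) :
    (GeneralLinearGroup.mkOfDetNeZero A h : Matrix (Fin 2) (Fin 2) F) = A := rfl

/-- Two invertible matrices that agree up to a nonzero scalar have the same image in `PGL₂`. -/
lemma mk_eq_mk_of_smul {g h : GL (Fin 2) F} (u : Fˣ)
    (H : ∀ i j, g i j * (u : F) = h i j) : ProjGenLinGroup.mk g = ProjGenLinGroup.mk h := by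
  rw [ProjGenLinGroup.mk_eq_mk_iff]
  refine ⟨u, Units.ext ?_⟩
  ext i j
  rw [← H i j, Units.val_mul, GeneralLinearGroup.coe_scalar]
  simp [Matrix.scalar_apply]

lemma mk_scalar_mul (z : Fˣ) (g : GL (Fin 2) F) :
    ProjGenLinGroup.mk (GeneralLinearGroup.scalar (Fin 2) z * g) = ProjGenLinGroup.mk g := by
  rw [map_mul, ProjGenLinGroup.mk_scalar, one_mul]

lemma scalar_mul_apply (z : Fˣ) (g : GL (Fin 2) F) (i j : Fin 2) :
    (GeneralLinearGroup.scalar (Fin 2) z * g) i j = z * g i j := by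
  rw [Units.val_mul, GeneralLinearGroup.coe_scalar]
  simp [Matrix.scalar_apply]

lemma det_scalar_mul (z : Fˣ) (g : GL (Fin 2) F) :
    ((GeneralLinearGroup.scalar (Fin 2) z * g : GL (Fin 2) F) : Matrix (Fin 2) (Fin 2) F).det =
      (z : F) * z * (g : Matrix (Fin 2) (Fin 2) F).det := by
  rw [Matrix.det_fin_two, Matrix.det_fin_two]
  simp only [scalar_mul_apply]
  ring

lemma torus_mul (a b : Fˣ) : torus (a * b) = torus a * torus b := by
  rw [torus, torus, torus, ← map_mul]
  congr 1
  ext i j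
  fin_cases i <;> fin_cases j <;> simp [Matrix.mul_apply, Fin.sum_univ_two]

@[simp] lemma torus_one : torus (1 : Fˣ) = 1 := by
  rw [torus, ← map_one ProjGenLinGroup.mk]
  congr 1
  ext i j
  fin_cases i <;> fin_cases j <;> simp

/-- The homomorphism `a ↦ diag(a, 1)`. -/
noncomputable def torusHom (F : Type*) [Field F] : Fˣ →* PGL(2, F) where
  toFun := torus
  map_one' := torus_one
  map_mul' := torus_mul

lemma torus_inv (a : Fˣ) : torus a⁻¹ = (torus a)⁻¹ := map_inv (torusHom F) a

lemma torus_pow (a : Fˣ) (n : ℕ) : torus (a ^ n) = torus a ^ n := map_pow (torusHom F) a n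

lemma unip_add (x y : F) : unip (x + y) = unip x * unip y := by
  rw [unip, unip, unip, ← map_mul]
  congr 1
  ext i j
  fin_cases i <;> fin_cases j <;> simp [Matrix.mul_apply, Fin.sum_univ_two, add_comm]

@[simp] lemma unip_zero : unip (0 : F) = 1 := by
  rw [unip, ← map_one ProjGenLinGroup.mk]
  congr 1
  ext i j
  fin_cases i <;> fin_cases j <;> simp

lemma unip_neg (x : F) : unip (-x) = (unip x)⁻¹ := by
  rw [eq_inv_iff_mul_eq_one, ← unip_add, neg_add_cancel, unip_zero]

lemma torus_mul_unip (a : Fˣ) (x : F) : torus a * unip x = unip (a * x) * torus a := by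
  rw [unip, unip, torus, ← map_mul, ← map_mul]
  congr 1
  ext i j
  fin_cases i <;> fin_cases j <;> simp [Matrix.mul_apply, Fin.sum_univ_two]

lemma borel_mul (x x' : F) (y y' : Fˣ) :
    unip x * torus y * (unip x' * torus y') = unip (x + y * x') * torus (y * y') := by
  rw [unip_add, torus_mul]
  simp only [mul_assoc]
  rw [← mul_assoc (torus y), torus_mul_unip, mul_assoc]

lemma mk_tri (a : Fˣ) (b : F) (d : Fˣ) :
    ProjGenLinGroup.mk (tri a b d) = unip (b / d) * torus (a / d) := by
  rw [unip, torus, ← map_mul]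
  refine mk_eq_mk_of_smul d⁻¹ fun i j => ?_
  fin_cases i <;> fin_cases j <;> simp [Matrix.mul_apply, Fin.sum_univ_two, div_eq_mul_inv]

/-- The Weyl element. -/
noncomputable def weylGL (F : Type*) [Field F] : GL (Fin 2) F :=
  GeneralLinearGroup.mkOfDetNeZero !![0, 1; 1, 0] (by simp)

/-- The Weyl element of `PGL₂(F)`. -/
noncomputable def weyl (F : Type*) [Field F] : PGL(2, F) := ProjGenLinGroup.mk (weylGL F)

lemma coe_weylGL : (weylGL F : Matrix (Fin 2) (Fin 2) F) = !![0, 1; 1, 0] := rfl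

lemma weyl_mul_weyl : weyl F * weyl F = 1 := by
  rw [weyl, ← map_mul, ← map_one ProjGenLinGroup.mk]
  congr 1
  ext i j
  fin_cases i <;> fin_cases j <;> simp [Matrix.mul_apply, Fin.sum_univ_two, coe_weylGL]

lemma weyl_torus_weyl (a : Fˣ) : weyl F * torus a * weyl F = torus a⁻¹ := by
  rw [weyl, torus, torus, ← map_mul, ← map_mul]
  refine mk_eq_mk_of_smul a⁻¹ fun i j => ?_
  fin_cases i <;> fin_cases j <;> simp [Matrix.mul_apply, Fin.sum_univ_two, coe_weylGL]

/-- The image in `PGL₂(F)` of the lower triangular unipotent matrix `(1 0; x 1)`. -/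
noncomputable def lowerUnip (x : F) : PGL(2, F) :=
  ProjGenLinGroup.mk (GeneralLinearGroup.mkOfDetNeZero !![1, 0; x, 1] (by simp))

/-- The generic case of the Iwasawa decomposition. -/
lemma mk_eq_borel_mul_lowerUnip (g : GL (Fin 2) F) (hd : g 1 1 ≠ 0) :
    ∃ y : Fˣ, ProjGenLinGroup.mk g =
      unip (g 0 1 / g 1 1) * torus y * lowerUnip (g 1 0 / g 1 1) := by
  have hdet : g 0 0 * g 1 1 - g 0 1 * g 1 0 ≠ 0 := by
    rw [← Matrix.det_fin_two]; exact g.det_ne_zero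
  refine ⟨Units.mk0 ((g 0 0 * g 1 1 - g 0 1 * g 1 0) / g 1 1 ^ 2)
    (div_ne_zero hdet (pow_ne_zero 2 hd)), ?_⟩
  rw [unip, torus, lowerUnip, ← map_mul, ← map_mul]
  refine mk_eq_mk_of_smul (Units.mk0 _ hd)⁻¹ fun i j => ?_
  fin_cases i <;> fin_cases j <;>
    simp [Matrix.mul_apply, Fin.sum_univ_two] <;> field_simp <;> ring

/-- The generic case of the Cartan decomposition. -/
lemma unip_mul_torus_eq (x y : Fˣ) :
    unip (x : F) * torus y = lowerUnip ((x⁻¹ : Fˣ) : F) * torus (-(x ^ 2 / y)) *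
      unip ((y / x : Fˣ) : F) * weyl F := by
  rw [unip, torus, torus, unip, lowerUnip, weyl, ← map_mul, ← map_mul, ← map_mul, ← map_mul]
  refine mk_eq_mk_of_smul (-(x / y)) fun i j => ?_
  fin_cases i <;> fin_cases j <;>
    simp [Matrix.mul_apply, Fin.sum_univ_two, coe_weylGL] <;> field_simp <;> norm_num

end GroupLemmas

/-! ### The maximal compact subgroup, Iwasawa and Cartan decompositions -/

section LocalGroup

variable {F : Type*} [Field F] [ValuativeRel F] [TopologicalSpace F] [IsNonarchimedeanLocalField F]

/-- Matrices in `GL₂(𝒪)`. -/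
def IsIntegralGL (g : GL (Fin 2) F) : Prop :=
  (∀ i j, g i j ∈ 𝒪[F]) ∧ ord (g : Matrix (Fin 2) (Fin 2) F).det = 0

lemma mk_mem_maxCompact {g : GL (Fin 2) F} (hg : IsIntegralGL g) :
    ProjGenLinGroup.mk g ∈ maxCompact F := by
  let M : Matrix (Fin 2) (Fin 2) 𝒪[F] := fun i j => ⟨g i j, hg.1 i j⟩
  have hM : M.map (algebraMap 𝒪[F] F) = (g : Matrix (Fin 2) (Fin 2) F) := by
    ext i j
    rfl
  have hdet : ((M.det : 𝒪[F]) : F) = (g : Matrix (Fin 2) (Fin 2) F).det := by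
    rw [← hM]
    exact RingHom.map_det (algebraMap 𝒪[F] F) M
  have hu : IsUnit M.det := by
    rw [isUnit_integer_iff, hdet]
    exact ⟨g.det_ne_zero, hg.2⟩
  refine ⟨ProjGenLinGroup.mk (Matrix.nonsingInvUnit M hu), ?_⟩
  rw [ProjGenLinGroup.map_mk]
  congr 1
  exact Units.ext hM

lemma exists_of_mem_maxCompact {x : PGL(2, F)} (hx : x ∈ maxCompact F) :
    ∃ g : GL (Fin 2) F, IsIntegralGL g ∧ ProjGenLinGroup.mk g = x := by
  obtain ⟨y, rfl⟩ := hx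
  obtain ⟨h, rfl⟩ := ProjGenLinGroup.mk_surjective y
  refine ⟨_, ⟨fun i j => ?_, ?_⟩, (ProjGenLinGroup.map_mk _ h).symm⟩
  · exact (h i j).2
  · have : (GeneralLinearGroup.map (algebraMap 𝒪[F] F) h : Matrix (Fin 2) (Fin 2) F).det =
        (((h : Matrix (Fin 2) (Fin 2) 𝒪[F]).det : 𝒪[F]) : F) :=
      (RingHom.map_det (algebraMap 𝒪[F] F) (h : Matrix (Fin 2) (Fin 2) 𝒪[F])).symm
    rw [this]
    exact ((isUnit_integer_iff _).1 ((Matrix.isUnit_iff_isUnit_det _).1 h.isUnit)).2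

lemma ord_det_scalar_mul (z : Fˣ) (g : GL (Fin 2) F) :
    ord ((GeneralLinearGroup.scalar (Fin 2) z * g : GL (Fin 2) F) :
      Matrix (Fin 2) (Fin 2) F).det = 2 * ord (z : F) +
        ord (g : Matrix (Fin 2) (Fin 2) F).det := by
  rw [det_scalar_mul, ord_mul (mul_ne_zero z.ne_zero z.ne_zero) g.det_ne_zero,
    ord_mul z.ne_zero z.ne_zero]
  ring

lemma exists_scalar_mul_of_mk_eq {g h : GL (Fin 2) F}
    (H : ProjGenLinGroup.mk g = ProjGenLinGroup.mk h) :
    ∃ z : Fˣ, GeneralLinearGroup.scalar (Fin 2) z * g = h := by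
  obtain ⟨z, hz⟩ := ProjGenLinGroup.mk_eq_mk_iff.1 H
  refine ⟨z, hz ▸ ?_⟩
  exact Units.ext ((Matrix.scalar_commute _ (fun _ => Commute.all _ _) _).eq)

/-- Some scalar multiple lies in `GL₂(𝒪)`, and comparing determinants forces the scalar to be a
unit. Membership in `K` thus becomes an entrywise test once the determinant is normalized. -/
lemma isIntegralGL_of_mk_mem {g : GL (Fin 2) F} (hg : ProjGenLinGroup.mk g ∈ maxCompact F)
    (hdet : ord (g : Matrix (Fin 2) (Fin 2) F).det = 0) : IsIntegralGL g := by
  obtain ⟨h, hh, hgh⟩ := exists_of_mem_maxCompact hg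
  obtain ⟨z, rfl⟩ := exists_scalar_mul_of_mk_eq hgh
  rw [ord_det_scalar_mul] at hdet
  have hz : ord (z : F) = 0 := by have := hh.2; omega
  refine ⟨fun i j => ?_, by rw [ord_det_scalar_mul, hdet]⟩
  rw [scalar_mul_apply]
  exact mul_mem (units_mem_of_ord_eq_zero hz) (hh.1 i j)

lemma unip_mem_maxCompact {x : F} (hx : x ∈ 𝒪[F]) : unip x ∈ maxCompact F := by
  refine mk_mem_maxCompact ⟨fun i j => ?_, by simp⟩
  fin_cases i <;> fin_cases j <;> simp [hx, one_mem, zero_mem]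

lemma mem_of_unip_mem_maxCompact {x : F} (hx : unip x ∈ maxCompact F) : x ∈ 𝒪[F] := by
  have h := (isIntegralGL_of_mk_mem hx (by simp)).1 0 1
  simpa using h

lemma torus_mem_maxCompact {a : Fˣ} (ha : ord (a : F) = 0) : torus a ∈ maxCompact F := by
  refine mk_mem_maxCompact ⟨fun i j => ?_, by simp [ha]⟩
  fin_cases i <;> fin_cases j <;> simp [units_mem_of_ord_eq_zero ha, one_mem, zero_mem]

lemma weyl_mem_maxCompact : weyl F ∈ maxCompact F := by
  refine mk_mem_maxCompact ⟨fun i j => ?_, by simp [coe_weylGL, ord_neg]⟩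
  fin_cases i <;> fin_cases j <;> simp [coe_weylGL, one_mem, zero_mem]

lemma lowerUnip_mem_maxCompact {x : F} (hx : x ∈ 𝒪[F]) : lowerUnip x ∈ maxCompact F := by
  refine mk_mem_maxCompact ⟨fun i j => ?_, by simp⟩
  fin_cases i <;> fin_cases j <;> simp [hx, one_mem, zero_mem]

/-- The Iwasawa decomposition. -/
theorem exists_iwasawa (g : PGL(2, F)) :
    ∃ (x : F) (y : Fˣ), ∃ k ∈ maxCompact F, g = unip x * torus y * k := by
  have key : ∀ g : GL (Fin 2) F, g 1 1 ≠ 0 → (g 1 0 ≠ 0 → ord (g 1 1) ≤ ord (g 1 0)) →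
      ∃ (x : F) (y : Fˣ), ∃ k ∈ maxCompact F, ProjGenLinGroup.mk g = unip x * torus y * k := by
    intro g h1 h2
    obtain ⟨y, hy⟩ := mk_eq_borel_mul_lowerUnip g h1
    exact ⟨_, y, _, lowerUnip_mem_maxCompact (div_mem_of_ord_le h1 h2), hy⟩
  obtain ⟨g, rfl⟩ := ProjGenLinGroup.mk_surjective g
  by_cases h : g 1 1 ≠ 0 ∧ (g 1 0 ≠ 0 → ord (g 1 1) ≤ ord (g 1 0))
  · exact key g h.1 h.2
  · have hdet : g 0 0 * g 1 1 - g 0 1 * g 1 0 ≠ 0 := by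
      rw [← Matrix.det_fin_two]; exact g.det_ne_zero
    have h10 : g 1 0 ≠ 0 := by
      intro h0
      apply h
      refine ⟨fun h1 => hdet (by rw [h1, h0]; ring), fun h2 => absurd h0 h2⟩
    have e1 : (g * weylGL F) 1 1 = g 1 0 := by
      simp [Matrix.mul_apply, Fin.sum_univ_two, coe_weylGL]
    have e2 : (g * weylGL F) 1 0 = g 1 1 := by
      simp [Matrix.mul_apply, Fin.sum_univ_two, coe_weylGL]
    -- If the lower left entry has the smaller valuation, the Weyl element swaps the columns and the
    -- generic case applies.
    obtain ⟨x, y, k, hk, hg⟩ := key (g * weylGL F) (e1 ▸ h10) (by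
      rw [e1, e2]
      intro h1
      by_contra h2
      exact h ⟨h1, fun _ => by omega⟩)
    refine ⟨x, y, k * weyl F, mul_mem hk weyl_mem_maxCompact, ?_⟩
    rw [← mul_assoc, ← hg, map_mul, mul_assoc]
    change _ = _ * (weyl F * weyl F)
    rw [weyl_mul_weyl, mul_one]

/-- The Cartan decomposition. -/
theorem exists_cartan {ϖ : Fˣ} (hϖ : ord (ϖ : F) = 1) (g : PGL(2, F)) :
    ∃ k ∈ maxCompact F, ∃ n : ℕ, ∃ k' ∈ maxCompact F, g = k * torus ϖ ^ n * k' := by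
  have h1 : ∀ y : Fˣ, ∃ k ∈ maxCompact F, ∃ n : ℕ, ∃ k' ∈ maxCompact F,
      torus y = k * torus ϖ ^ n * k' := by
    intro y
    have key : ∀ y : Fˣ, 0 ≤ ord (y : F) → ∃ n : ℕ, ∃ k' ∈ maxCompact F,
        torus y = torus ϖ ^ n * k' := by
      intro y hy
      obtain ⟨n, hn⟩ := Int.eq_ofNat_of_zero_le hy
      refine ⟨n, torus (y / ϖ ^ n), torus_mem_maxCompact ?_, ?_⟩
      · rw [div_eq_mul_inv, ord_mul_units, ord_inv_units, ord_pow_units, hϖ, hn]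
        simp
      · rw [← torus_pow, ← torus_mul, mul_div_cancel]
    rcases le_total 0 (ord (y : F)) with hy | hy
    · obtain ⟨n, k', hk', h⟩ := key y hy
      exact ⟨1, one_mem _, n, k', hk', by rw [h, one_mul]⟩
    · obtain ⟨n, k', hk', h⟩ := key y⁻¹ (by rw [ord_inv_units]; omega)
      refine ⟨weyl F, weyl_mem_maxCompact, n, k' * weyl F,
        mul_mem hk' weyl_mem_maxCompact, ?_⟩
      have h2 := weyl_torus_weyl (F := F) y⁻¹
      rw [inv_inv, h] at h2
      rw [← h2]
      simp only [mul_assoc]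
  have h2 : ∀ k₁ ∈ maxCompact F, ∀ y : Fˣ, ∀ k₂ ∈ maxCompact F,
      ∃ k ∈ maxCompact F, ∃ n : ℕ, ∃ k' ∈ maxCompact F,
        k₁ * torus y * k₂ = k * torus ϖ ^ n * k' := by
    intro k₁ hk₁ y k₂ hk₂
    obtain ⟨k, hk, n, k', hk', h⟩ := h1 y
    refine ⟨k₁ * k, mul_mem hk₁ hk, n, k' * k₂, mul_mem hk' hk₂, ?_⟩
    rw [h]
    simp only [mul_assoc]
  obtain ⟨x, y, k₂, hk₂, rfl⟩ := exists_iwasawa g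
  by_cases hx : x ∈ 𝒪[F]
  · exact h2 _ (unip_mem_maxCompact hx) y k₂ hk₂
  by_cases hxy : ((y⁻¹ : Fˣ) : F) * x ∈ 𝒪[F]
  · have : unip x * torus y = torus y * unip (((y⁻¹ : Fˣ) : F) * x) := by
      rw [torus_mul_unip]
      simp
    rw [this, ← one_mul (torus y), mul_assoc]
    exact h2 1 (one_mem _) y _ (mul_mem (unip_mem_maxCompact hxy) hk₂)
  · have hx0 : x ≠ 0 := by
      rintro rfl
      exact hx (zero_mem _)
    lift x to Fˣ using hx0.isUnit
    rw [units_mem_integer_iff] at hx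
    rw [← Units.val_mul, units_mem_integer_iff, ord_mul_units, ord_inv_units] at hxy
    -- Neither `x` nor `y⁻¹ * x` is integral here, so `x⁻¹` and `y / x` are, and the factorization
    -- has a torus element between two elements of `K`.
    rw [unip_mul_torus_eq]
    simp only [mul_assoc]
    rw [← mul_assoc (lowerUnip _)]
    simp only [← mul_assoc (_ : PGL(2, F)) (torus ϖ ^ _) _]
    refine h2 _ (lowerUnip_mem_maxCompact ?_) _ _ (mul_mem (unip_mem_maxCompact ?_)
      (mul_mem weyl_mem_maxCompact hk₂))
    · rw [units_mem_integer_iff, ord_inv_units]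
      omega
    · rw [units_mem_integer_iff, div_eq_mul_inv, ord_mul_units, ord_inv_units]
      omega

end LocalGroup

end LocalSpherical

namespace LocalSpherical

open Matrix

/-- A function that is right invariant under an open neighbourhood of `1` is locally constant. -/
lemma isLocallyConstant_of_mul_right {G X : Type*} [Group G] [TopologicalSpace G]
    [ContinuousMul G] {U : Set G} (hU : IsOpen U) (h1 : (1 : G) ∈ U) {φ : G → X}
    (hφ : ∀ g, ∀ u ∈ U, φ (g * u) = φ g) : IsLocallyConstant φ := by
  rw [IsLocallyConstant.iff_exists_open]
  intro g
  refine ⟨(fun x => g⁻¹ * x) ⁻¹' U, hU.preimage (continuous_const_mul _), by simpa using h1, ?_⟩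
  intro x hx
  have := hφ g _ hx
  rwa [mul_inv_cancel_left] at this

/-! ### The quadratic character of the residue field -/

section EtaBar

variable {F : Type*} [Field F] [ValuativeRel F] [TopologicalSpace F] [IsNonarchimedeanLocalField F]

@[simp] lemma etaBar_zero : etaBar (0 : 𝓀[F]) = 0 := by simp [etaBar]

@[simp] lemma etaBar_one : etaBar (1 : 𝓀[F]) = 1 := by simp [etaBar]

open Classical in
lemma etaBar_eq_quadraticChar [Fintype 𝓀[F]] (u : 𝓀[F]) :
    etaBar u = (quadraticChar 𝓀[F] u : ℂ) := by
  rw [quadraticChar_apply, quadraticCharFun, etaBar]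
  split_ifs <;> simp

lemma etaBar_mul (u v : 𝓀[F]) : etaBar (u * v) = etaBar u * etaBar v := by
  classical
  have : Fintype 𝓀[F] := Fintype.ofFinite _
  simp only [etaBar_eq_quadraticChar, map_mul, Int.cast_mul]

lemma etaBar_mul_self {u : 𝓀[F]} (hu : u ≠ 0) : etaBar u * etaBar u = 1 := by
  simp only [etaBar, if_neg hu]
  split_ifs <;> simp

lemma etaBar_eq_or {u : 𝓀[F]} (hu : u ≠ 0) : etaBar u = 1 ∨ etaBar u = -1 := by
  simp only [etaBar, if_neg hu]
  split_ifs <;> simp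

lemma conj_etaBar (u : 𝓀[F]) : starRingEnd ℂ (etaBar u) = etaBar u := by
  unfold etaBar
  split_ifs <;> simp

lemma sum_etaBar [Fintype 𝓀[F]] (hodd : ringChar 𝓀[F] ≠ 2) : ∑ u : 𝓀[F], etaBar u = 0 := by
  classical
  simp only [etaBar_eq_quadraticChar]
  exact_mod_cast quadraticChar_sum_zero hodd

lemma exists_etaBar_eq_neg_one (hodd : ringChar 𝓀[F] ≠ 2) : ∃ u : 𝓀[F]ˣ, etaBar (u : 𝓀[F]) = -1 := by
  classical
  have : Fintype 𝓀[F] := Fintype.ofFinite _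
  obtain ⟨u, hu⟩ := quadraticChar_exists_neg_one hodd
  have h1 : etaBar u = -1 := by rw [etaBar_eq_quadraticChar, hu]; simp
  have h0 : u ≠ 0 := by
    rintro rfl
    simp at h1
  exact ⟨Units.mk0 u h0, h1⟩

end EtaBar

/-! ### Rank-one reductions, test functions on `GL₂`, and coset representatives -/

section TestFunctions

variable {F : Type*} [Field F] [ValuativeRel F] [TopologicalSpace F] [IsNonarchimedeanLocalField F]

/-- If all entries reduced to zero, the determinant would be divisible by the square of a
uniformizer. -/
lemma exists_red_ne_zero {g : GL (Fin 2) F} (hg : IsInMatDetOne g) :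
    ∃ i j, red (g i j) ≠ 0 := by
  by_contra! h
  have hϖ := ord_uniformizer (F := F)
  have h1 : ∀ i j, g i j / (uniformizer F : F) ∈ 𝒪[F] := fun i j =>
    div_mem_of_red_eq_zero (hg.1 i j) (h i j) hϖ
  have h2 : (g : Matrix (Fin 2) (Fin 2) F).det / (uniformizer F : F) / (uniformizer F : F) ∈ 𝒪[F] := by
    have : (g : Matrix (Fin 2) (Fin 2) F).det / (uniformizer F : F) / (uniformizer F : F) =
        (g 0 0 / uniformizer F) * (g 1 1 / uniformizer F) -
        (g 0 1 / uniformizer F) * (g 1 0 / uniformizer F) := by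
      rw [Matrix.det_fin_two]
      field_simp
    rw [this]
    exact sub_mem (mul_mem (h1 _ _) (h1 _ _)) (mul_mem (h1 _ _) (h1 _ _))
  lift (g : Matrix (Fin 2) (Fin 2) F).det to Fˣ using g.det_ne_zero.isUnit with d hd
  have hd1 : ord (d : F) = 1 := by rw [hd]; exact hg.2
  rw [← Units.val_div_eq_div_val, ← Units.val_div_eq_div_val, units_mem_integer_iff,
    div_eq_mul_inv, div_eq_mul_inv, ord_mul_units, ord_mul_units, ord_inv_units, hϖ, hd1] at h2
  omega

lemma red_det_eq {g : GL (Fin 2) F} (hg : IsInMatDetOne g) :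
    red (g 0 0) * red (g 1 1) = red (g 0 1) * red (g 1 0) := by
  have h := red_eq_zero_of_ord_pos (a := (g : Matrix (Fin 2) (Fin 2) F).det) (by rw [hg.2]; simp)
  rw [Matrix.det_fin_two, red_sub (mul_mem (hg.1 _ _) (hg.1 _ _)) (mul_mem (hg.1 _ _) (hg.1 _ _)),
    red_mul (hg.1 _ _) (hg.1 _ _), red_mul (hg.1 _ _) (hg.1 _ _)] at h
  exact sub_eq_zero.1 h

/-- The reduction of an integral matrix whose determinant is a uniformizer has rank one. -/
lemma exists_red_eq_mul {g : GL (Fin 2) F} (hg : IsInMatDetOne g) :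
    ∃ x y : Fin 2 → 𝓀[F], ∀ i j, red (g i j) = x i * y j := by
  obtain ⟨i₀, j₀, h0⟩ := exists_red_ne_zero hg
  have hdet := red_det_eq hg
  refine ⟨fun i => red (g i j₀) / red (g i₀ j₀), fun j => red (g i₀ j), fun i j => ?_⟩
  rw [div_mul_eq_mul_div, eq_div_iff h0]
  fin_cases i₀ <;> fin_cases j₀ <;> fin_cases i <;> fin_cases j <;> simp at hdet ⊢ <;>
    first | ring1 | linear_combination hdet | linear_combination -hdet

/-- Row `i` contributes the square `x i * x i`, on which the character is one. This is why the two
cases of the definition agree, and it leaves a dependence on `y` only. -/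
lemma fSquareTilde_eq {g : GL (Fin 2) F} (hg : IsInMatDetOne g) {x y : Fin 2 → 𝓀[F]}
    (h : ∀ i j, red (g i j) = x i * y j) : fSquareTilde g = etaBar (y 0 * y 1) := by
  have hx : x 0 ≠ 0 ∨ x 1 ≠ 0 := by
    by_contra! hx
    obtain ⟨i, j, h0⟩ := exists_red_ne_zero hg
    rw [h] at h0
    fin_cases i <;> simp [hx] at h0
  unfold fSquareTilde
  rw [if_pos hg]
  simp only [h]
  by_cases h0 : y 0 = 0
  · simp [h0]
  by_cases h1 : y 1 = 0
  · simp [h1]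
  have key : ∀ i, x i ≠ 0 → etaBar (x i * y 0 * (x i * y 1)) = etaBar (y 0 * y 1) := by
    intro i hi
    rw [show x i * y 0 * (x i * y 1) = x i * x i * (y 0 * y 1) by ring, etaBar_mul (x i * x i),
      etaBar_mul (x i), etaBar_mul_self hi, one_mul]
  by_cases hx0 : x 0 = 0
  · have hx1 : x 1 ≠ 0 := hx.resolve_left (not_not.2 hx0)
    rw [if_neg (by simp [h, hx0]), if_pos (by simp [h, hx1, h0, h1]), key 1 hx1]
  · rw [if_pos (by simp [h, hx0, h0, h1]), key 0 hx0]

/-- The analogue of `f̃^□` with the roles of rows and columns interchanged. -/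
noncomputable def fColTilde (g : GL (Fin 2) F) : ℂ := by
  classical
  exact if IsInMatDetOne g then
    (if red (g 0 0) ≠ 0 ∧ red (g 1 0) ≠ 0 then etaBar (red (g 0 0) * red (g 1 0))
    else if red (g 0 1) ≠ 0 ∧ red (g 1 1) ≠ 0 then etaBar (red (g 0 1) * red (g 1 1))
    else 0)
  else 0

lemma fColTilde_eq {g : GL (Fin 2) F} (hg : IsInMatDetOne g) {x y : Fin 2 → 𝓀[F]}
    (h : ∀ i j, red (g i j) = x i * y j) : fColTilde g = etaBar (x 0 * x 1) := by
  have hy : y 0 ≠ 0 ∨ y 1 ≠ 0 := by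
    by_contra! hy
    obtain ⟨i, j, h0⟩ := exists_red_ne_zero hg
    rw [h] at h0
    fin_cases j <;> simp [hy] at h0
  unfold fColTilde
  rw [if_pos hg]
  simp only [h]
  by_cases h0 : x 0 = 0
  · simp [h0]
  by_cases h1 : x 1 = 0
  · simp [h1]
  have key : ∀ i, y i ≠ 0 → etaBar (x 0 * y i * (x 1 * y i)) = etaBar (x 0 * x 1) := by
    intro i hi
    rw [show x 0 * y i * (x 1 * y i) = y i * y i * (x 0 * x 1) by ring, etaBar_mul (y i * y i),
      etaBar_mul (y i), etaBar_mul_self hi, one_mul]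
  by_cases hy0 : y 0 = 0
  · have hy1 : y 1 ≠ 0 := hy.resolve_left (not_not.2 hy0)
    rw [if_neg (by simp [h, hy0]), if_pos (by simp [h, hy1, h0, h1]), key 1 hy1]
  · rw [if_pos (by simp [h, hy0, h0, h1]), key 0 hy0]

lemma isInMatDetOne_mul_left {k g : GL (Fin 2) F} (hk : IsIntegralGL k) (hg : IsInMatDetOne g) :
    IsInMatDetOne (k * g) := by
  refine ⟨fun i j => ?_, ?_⟩
  · rw [Units.val_mul, Matrix.mul_apply]
    exact sum_mem fun l _ => mul_mem (hk.1 _ _) (hg.1 _ _)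
  · rw [Units.val_mul, Matrix.det_mul, ord_mul k.det_ne_zero g.det_ne_zero, hk.2, hg.2, zero_add]

lemma isInMatDetOne_mul_right {k g : GL (Fin 2) F} (hk : IsIntegralGL k) (hg : IsInMatDetOne g) :
    IsInMatDetOne (g * k) := by
  refine ⟨fun i j => ?_, ?_⟩
  · rw [Units.val_mul, Matrix.mul_apply]
    exact sum_mem fun l _ => mul_mem (hg.1 _ _) (hk.1 _ _)
  · rw [Units.val_mul, Matrix.det_mul, ord_mul g.det_ne_zero k.det_ne_zero, hk.2, hg.2, add_zero]

/-- Left multiplication changes only the factor `x` of the rank-one reduction. -/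
lemma fSquareTilde_mul_left {k g : GL (Fin 2) F} (hk : IsIntegralGL k) (hg : IsInMatDetOne g) :
    fSquareTilde (k * g) = fSquareTilde g := by
  obtain ⟨x, y, h⟩ := exists_red_eq_mul hg
  rw [fSquareTilde_eq hg h, fSquareTilde_eq (isInMatDetOne_mul_left hk hg)
    (x := fun i => red (k i 0) * x 0 + red (k i 1) * x 1) (y := y)]
  intro i j
  rw [Units.val_mul, Matrix.mul_apply, Fin.sum_univ_two,
    red_add (mul_mem (hk.1 _ _) (hg.1 _ _)) (mul_mem (hk.1 _ _) (hg.1 _ _)),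
    red_mul (hk.1 _ _) (hg.1 _ _), red_mul (hk.1 _ _) (hg.1 _ _), h, h]
  ring

lemma fColTilde_mul_right {k g : GL (Fin 2) F} (hk : IsIntegralGL k) (hg : IsInMatDetOne g) :
    fColTilde (g * k) = fColTilde g := by
  obtain ⟨x, y, h⟩ := exists_red_eq_mul hg
  rw [fColTilde_eq hg h, fColTilde_eq (isInMatDetOne_mul_right hk hg)
    (y := fun j => y 0 * red (k 0 j) + y 1 * red (k 1 j)) (x := x)]
  intro i j
  rw [Units.val_mul, Matrix.mul_apply, Fin.sum_univ_two,
    red_add (mul_mem (hg.1 _ _) (hk.1 _ _)) (mul_mem (hg.1 _ _) (hk.1 _ _)),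
    red_mul (hg.1 _ _) (hk.1 _ _), red_mul (hg.1 _ _) (hk.1 _ _), h, h]
  ring

lemma isIntegralGL_tri {u : Fˣ} (hu : ord (u : F) = 0) : IsIntegralGL (tri u 0 1) := by
  refine ⟨fun i j => ?_, by simp [hu]⟩
  fin_cases i <;> fin_cases j <;> simp [units_mem_of_ord_eq_zero hu, one_mem, zero_mem]

/-- Only `x 0` is rescaled. This equivariance is what later makes the column part of `h^□` invisible
to `λ♮(·, 1, s)`. -/
lemma fColTilde_tri_mul {u : Fˣ} (hu : ord (u : F) = 0) {g : GL (Fin 2) F}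
    (hg : IsInMatDetOne g) : fColTilde (tri u 0 1 * g) = etaBar (red (u : F)) * fColTilde g := by
  obtain ⟨x, y, h⟩ := exists_red_eq_mul hg
  have hk := isIntegralGL_tri hu
  rw [fColTilde_eq hg h, fColTilde_eq (isInMatDetOne_mul_left hk hg)
    (x := ![red (u : F) * x 0, x 1]) (y := y)]
  · simp [etaBar_mul, mul_assoc]
  · intro i j
    have hu' := units_mem_of_ord_eq_zero hu
    fin_cases i <;>
      simp [Matrix.mul_apply, Fin.sum_univ_two, red_mul hu' (hg.1 _ _), h, mul_assoc]

lemma isIntegralGL_scalar {z : Fˣ} (hz : ord (z : F) = 0) :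
    IsIntegralGL (GeneralLinearGroup.scalar (Fin 2) z) := by
  refine ⟨fun i j => ?_, ?_⟩
  · rw [GeneralLinearGroup.coe_scalar]
    fin_cases i <;> fin_cases j <;>
      simp [Matrix.scalar_apply, units_mem_of_ord_eq_zero hz, zero_mem]
  · rw [GeneralLinearGroup.coe_scalar]
    have := ord_pow_units z 2
    rw [hz, Units.val_pow_eq_pow_val] at this
    simpa [Matrix.scalar_apply] using this

lemma fColTilde_scalar_mul {u : Fˣ} (hu : ord (u : F) = 0) {g : GL (Fin 2) F}
    (hg : IsInMatDetOne g) :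
    fColTilde (GeneralLinearGroup.scalar (Fin 2) u * g) = fColTilde g := by
  have h : GeneralLinearGroup.scalar (Fin 2) u * g = g * GeneralLinearGroup.scalar (Fin 2) u :=
    Units.ext (Matrix.scalar_commute _ (fun _ => Commute.all _ _) _).eq
  rw [h, fColTilde_mul_right (isIntegralGL_scalar hu) hg]

/-- The elements of `PGL₂(F)` represented by integral matrices with determinant of valuation `1`. -/
def detOneSet (F : Type*) [Field F] [ValuativeRel F] [TopologicalSpace F]
    [IsNonarchimedeanLocalField F] : Set PGL(2, F) :=
  {x | ∃ g : GL (Fin 2) F, IsInMatDetOne g ∧ ProjGenLinGroup.mk g = x}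

lemma mul_mem_detOneSet_left {k x : PGL(2, F)} (hk : k ∈ maxCompact F) (hx : x ∈ detOneSet F) :
    k * x ∈ detOneSet F := by
  obtain ⟨k, hk', rfl⟩ := exists_of_mem_maxCompact hk
  obtain ⟨g, hg, rfl⟩ := hx
  exact ⟨k * g, isInMatDetOne_mul_left hk' hg, map_mul _ _ _⟩

lemma mul_mem_detOneSet_right {k x : PGL(2, F)} (hk : k ∈ maxCompact F) (hx : x ∈ detOneSet F) :
    x * k ∈ detOneSet F := by
  obtain ⟨k, hk', rfl⟩ := exists_of_mem_maxCompact hk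
  obtain ⟨g, hg, rfl⟩ := hx
  exact ⟨g * k, isInMatDetOne_mul_right hk' hg, map_mul _ _ _⟩

lemma mul_mem_detOneSet_left_iff {k x : PGL(2, F)} (hk : k ∈ maxCompact F) :
    k * x ∈ detOneSet F ↔ x ∈ detOneSet F :=
  ⟨fun h => by simpa using mul_mem_detOneSet_left (inv_mem hk) h, mul_mem_detOneSet_left hk⟩

lemma mul_mem_detOneSet_right_iff {k x : PGL(2, F)} (hk : k ∈ maxCompact F) :
    x * k ∈ detOneSet F ↔ x ∈ detOneSet F :=
  ⟨fun h => by simpa using mul_mem_detOneSet_right (inv_mem hk) h, mul_mem_detOneSet_right hk⟩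

/-- Modulo the centre the inverse is the adjugate, which is integral with the same determinant. -/
lemma inv_mem_detOneSet {x : PGL(2, F)} (hx : x ∈ detOneSet F) : x⁻¹ ∈ detOneSet F := by
  obtain ⟨g, hg, rfl⟩ := hx
  have hdet : (!![g 1 1, -g 0 1; -g 1 0, g 0 0]).det = (g : Matrix (Fin 2) (Fin 2) F).det := by
    rw [Matrix.det_fin_two, Matrix.det_fin_two]
    simp
    ring
  refine ⟨GeneralLinearGroup.mkOfDetNeZero !![g 1 1, -g 0 1; -g 1 0, g 0 0]
    (by rw [hdet]; exact g.det_ne_zero), ⟨fun i j => ?_, ?_⟩, ?_⟩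
  · fin_cases i <;> fin_cases j <;> simp [hg.1]
  · rw [coe_mkOfDetNeZero, hdet, hg.2]
  · rw [eq_inv_iff_mul_eq_one, ← map_mul, ← map_one ProjGenLinGroup.mk, eq_comm]
    refine mk_eq_mk_of_smul (Units.mk0 _ g.det_ne_zero) fun i j => ?_
    fin_cases i <;> fin_cases j <;>
      simp [Matrix.mul_apply, Fin.sum_univ_two, Matrix.det_fin_two] <;> ring

/-- Representatives of the right cosets of the maximal compact subgroup in `detOneSet F`. -/
noncomputable def cosetRep (ϖ : Fˣ) : Option 𝓀[F] → PGL(2, F)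
  | none => torus ϖ
  | some u => torus ϖ⁻¹ * unip (lift F u : F)

lemma cosetRep_none_inv (ϖ : Fˣ) : (cosetRep (F := F) ϖ none)⁻¹ = torus ϖ⁻¹ := (torus_inv ϖ).symm

lemma cosetRep_some_inv (ϖ : Fˣ) (u : 𝓀[F]) :
    (cosetRep ϖ (some u))⁻¹ = unip (-(lift F u : F)) * torus ϖ := by
  rw [cosetRep, _root_.mul_inv_rev, ← unip_neg, ← torus_inv, inv_inv]

/-- The coset `K g` is determined by the line spanned by `y` in the rank-one reduction: `(0, 1)`
here, `(1, u)` in the companion lemma. After a column operation one column is divisible by `ϖ`, and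
removing that factor leaves an element of `GL₂(𝒪)`. -/
lemma mk_mul_cosetRep_none_inv_mem {ϖ : Fˣ} (hϖ : ord (ϖ : F) = 1) {g : GL (Fin 2) F}
    (hg : IsInMatDetOne g) (h : ∀ i, red (g i 0) = 0) :
    ProjGenLinGroup.mk g * (cosetRep ϖ none)⁻¹ ∈ maxCompact F := by
  have hdet : (!![g 0 0 / ϖ, g 0 1; g 1 0 / ϖ, g 1 1]).det * ϖ =
      (g : Matrix (Fin 2) (Fin 2) F).det := by
    rw [Matrix.det_fin_two, Matrix.det_fin_two]
    simp
    field_simp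
  have hdet0 : (!![g 0 0 / (ϖ : F), g 0 1; g 1 0 / ϖ, g 1 1]).det ≠ 0 := by
    intro h0
    rw [h0, zero_mul] at hdet
    exact g.det_ne_zero hdet.symm
  have hM : ProjGenLinGroup.mk g = ProjGenLinGroup.mk (GeneralLinearGroup.mkOfDetNeZero
      !![g 0 0 / (ϖ : F), g 0 1; g 1 0 / ϖ, g 1 1] hdet0) * cosetRep ϖ none := by
    rw [cosetRep, torus, ← map_mul]
    refine mk_eq_mk_of_smul 1 fun i j => ?_
    fin_cases i <;> fin_cases j <;> simp [Matrix.mul_apply, Fin.sum_univ_two]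
  rw [hM, mul_inv_cancel_right]
  refine mk_mem_maxCompact ⟨fun i j => ?_, ?_⟩
  · fin_cases i <;> fin_cases j <;>
      simp [hg.1, div_mem_of_red_eq_zero (hg.1 _ _) (h _) hϖ]
  · rw [coe_mkOfDetNeZero]
    have h1 := ord_mul hdet0 ϖ.ne_zero
    rw [hdet, hg.2, hϖ] at h1
    omega

lemma mk_mul_cosetRep_some_inv_mem {ϖ : Fˣ} (hϖ : ord (ϖ : F) = 1) {g : GL (Fin 2) F}
    (hg : IsInMatDetOne g) {u : 𝓀[F]} (h : ∀ i, red (g i 1) = u * red (g i 0)) :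
    ProjGenLinGroup.mk g * (cosetRep ϖ (some u))⁻¹ ∈ maxCompact F := by
  set v : F := (lift F u : F) with hv
  have hvm : v ∈ 𝒪[F] := (lift F u).2
  have hred : ∀ i, (g i 1 - v * g i 0) / ϖ ∈ 𝒪[F] := fun i =>
    div_mem_of_red_eq_zero (sub_mem (hg.1 _ _) (mul_mem hvm (hg.1 _ _)))
      (by rw [red_sub (hg.1 _ _) (mul_mem hvm (hg.1 _ _)), red_mul hvm (hg.1 _ _), hv, red_lift,
        h, sub_self]) hϖ
  have hdet : (!![g 0 0, (g 0 1 - v * g 0 0) / ϖ; g 1 0, (g 1 1 - v * g 1 0) / ϖ]).det * ϖ =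
      (g : Matrix (Fin 2) (Fin 2) F).det := by
    rw [Matrix.det_fin_two, Matrix.det_fin_two]
    simp
    field_simp
    ring
  have hdet0 : (!![g 0 0, (g 0 1 - v * g 0 0) / ϖ; g 1 0, (g 1 1 - v * g 1 0) / ϖ]).det ≠ 0 := by
    intro h0
    rw [h0, zero_mul] at hdet
    exact g.det_ne_zero hdet.symm
  have hM : ProjGenLinGroup.mk g = ProjGenLinGroup.mk (GeneralLinearGroup.mkOfDetNeZero _ hdet0) *
      cosetRep ϖ (some u) := by
    rw [cosetRep, torus, unip, ← map_mul, ← map_mul]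
    refine mk_eq_mk_of_smul ϖ⁻¹ fun i j => ?_
    fin_cases i <;> fin_cases j <;>
      simp [Matrix.mul_apply, Fin.sum_univ_two] <;> field_simp <;> ring
  rw [hM, mul_inv_cancel_right]
  refine mk_mem_maxCompact ⟨fun i j => ?_, ?_⟩
  · fin_cases i <;> fin_cases j <;> simp [hg.1, hred]
  · rw [coe_mkOfDetNeZero]
    have h1 := ord_mul hdet0 ϖ.ne_zero
    rw [hdet, hg.2, hϖ] at h1
    omega

lemma exists_mul_cosetRep_inv_mem {ϖ : Fˣ} (hϖ : ord (ϖ : F) = 1) {g : PGL(2, F)}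
    (hg : g ∈ detOneSet F) : ∃ i, g * (cosetRep ϖ i)⁻¹ ∈ maxCompact F := by
  obtain ⟨g, hg, rfl⟩ := hg
  obtain ⟨x, y, h⟩ := exists_red_eq_mul hg
  by_cases hy : y 0 = 0
  · exact ⟨none, mk_mul_cosetRep_none_inv_mem hϖ hg fun i => by rw [h, hy, mul_zero]⟩
  · refine ⟨some (y 1 / y 0), mk_mul_cosetRep_some_inv_mem hϖ hg fun i => ?_⟩
    rw [h, h]
    field_simp

lemma cosetRep_none_ne_some {ϖ : Fˣ} (hϖ : ord (ϖ : F) = 1) (u : 𝓀[F]) :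
    cosetRep ϖ none * (cosetRep ϖ (some u))⁻¹ ∉ maxCompact F := by
  intro h
  rw [cosetRep_some_inv, cosetRep, ← mul_assoc, torus_mul_unip, mul_assoc, ← torus_mul,
    unip, torus, ← map_mul, ← mk_scalar_mul ϖ⁻¹] at h
  -- The product is represented by an upper triangular matrix with diagonal `(ϖ², 1)`. Scaling by
  -- `ϖ⁻¹` gives determinant of valuation zero but lower right entry `ϖ⁻¹`, which is not integral.
  have h1 := (isIntegralGL_of_mk_mem h (by
    rw [ord_det_scalar_mul, ord_inv_units]
    simp [-Units.val_mul, ord_mul_units, hϖ])).1 1 1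
  rw [scalar_mul_apply] at h1
  simp [Matrix.mul_apply, Fin.sum_univ_two] at h1
  rw [← Units.val_inv_eq_inv_val, units_mem_integer_iff, ord_inv_units, hϖ] at h1
  omega

/-- The representatives belong to different cosets. -/
lemma cosetRep_injective {ϖ : Fˣ} (hϖ : ord (ϖ : F) = 1) {i j : Option 𝓀[F]}
    (h : cosetRep ϖ i * (cosetRep ϖ j)⁻¹ ∈ maxCompact F) : i = j := by
  match i, j with
  | none, none => rfl
  | none, some u => exact absurd h (cosetRep_none_ne_some hϖ u)
  | some u, none =>
    rw [← inv_mem_iff, _root_.mul_inv_rev, inv_inv] at h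
    exact absurd h (cosetRep_none_ne_some hϖ u)
  | some u, some v =>
    rw [cosetRep_some_inv, cosetRep, mul_assoc, ← mul_assoc (unip _), ← unip_add, ← mul_assoc,
      torus_mul_unip, mul_assoc, ← torus_mul, inv_mul_cancel, torus_one, mul_one] at h
    have h1 := mem_of_unip_mem_maxCompact h
    set d : F := (lift F u : F) + -(lift F v : F) with hd
    have hdm : d ∈ 𝒪[F] := add_mem (lift F u).2 (neg_mem (lift F v).2)
    have h2 : red d = 0 := by
      have : d = ϖ * ((ϖ⁻¹ : Fˣ) * d) := by simp
      rw [this, red_mul ((units_mem_integer_iff _).2 (by omega)) h1,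
        red_eq_zero_of_ord_pos (a := (ϖ : F)) (by omega), zero_mul]
    rw [hd, red_add (lift F u).2 (neg_mem (lift F v).2), red_neg (lift F v).2, red_lift,
      red_lift, ← sub_eq_add_neg, sub_eq_zero] at h2
    rw [h2]

/-- The matrix `(1 u; 0 ϖ)`. -/
lemma cosetRep_some_eq (ϖ : Fˣ) (u : 𝓀[F]) :
    cosetRep ϖ (some u) = ProjGenLinGroup.mk (tri 1 (lift F u : F) ϖ) := by
  rw [mk_tri, cosetRep, torus_mul_unip]
  simp [div_eq_inv_mul]

lemma isInMatDetOne_tri {ϖ : Fˣ} (hϖ : ord (ϖ : F) = 1) (u : 𝒪[F]) :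
    IsInMatDetOne (tri 1 (u : F) ϖ) := by
  refine ⟨fun i j => ?_, by simp [hϖ]⟩
  have h1 : (ϖ : F) ∈ 𝒪[F] := (units_mem_integer_iff _).2 (by omega)
  fin_cases i <;> fin_cases j <;> simp [h1, one_mem, zero_mem]

lemma isInMatDetOne_tri' {ϖ : Fˣ} (hϖ : ord (ϖ : F) = 1) :
    IsInMatDetOne (tri ϖ (0 : F) 1) := by
  refine ⟨fun i j => ?_, by simp [hϖ]⟩
  have h1 : (ϖ : F) ∈ 𝒪[F] := (units_mem_integer_iff _).2 (by omega)
  fin_cases i <;> fin_cases j <;> simp [h1, one_mem, zero_mem]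

lemma cosetRep_mem {ϖ : Fˣ} (hϖ : ord (ϖ : F) = 1) (i : Option 𝓀[F]) :
    cosetRep ϖ i ∈ detOneSet F := by
  match i with
  | none => exact ⟨_, isInMatDetOne_tri' hϖ, rfl⟩
  | some u => exact ⟨_, isInMatDetOne_tri hϖ _, (cosetRep_some_eq ϖ u).symm⟩

lemma fSquareTilde_tri {ϖ : Fˣ} (hϖ : ord (ϖ : F) = 1) (u : 𝓀[F]) :
    fSquareTilde (tri 1 (lift F u : F) ϖ) = etaBar u := by
  rw [fSquareTilde_eq (isInMatDetOne_tri hϖ _) (x := ![1, 0]) (y := ![1, u])]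
  · simp
  · have h1 : red (ϖ : F) = 0 := red_eq_zero_of_ord_pos (by omega)
    intro i j
    fin_cases i <;> fin_cases j <;> simp [red_lift, h1]

lemma fSquareTilde_tri' {ϖ : Fˣ} (hϖ : ord (ϖ : F) = 1) :
    fSquareTilde (tri ϖ (0 : F) 1) = 0 := by
  rw [fSquareTilde_eq (isInMatDetOne_tri' hϖ) (x := ![0, 1]) (y := ![0, 1])]
  · simp
  · have h1 : red (ϖ : F) = 0 := red_eq_zero_of_ord_pos (by omega)
    intro i j
    fin_cases i <;> fin_cases j <;> simp [h1]

end TestFunctions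

end LocalSpherical

namespace LocalSpherical

open Matrix

/-! ### Integration of locally constant compactly supported vector-valued functions -/

section TestFun

variable {G V : Type*} [Group G] [TopologicalSpace G] [IsTopologicalGroup G]
  [AddCommGroup V] [Module ℂ V]

/-- Locally constant functions that vanish outside a compact set. -/
structure IsTestFun {X : Type*} [Zero X] (φ : G → X) : Prop where
  isLocallyConstant : IsLocallyConstant φ
  exists_compact : ∃ C : Set G, IsCompact C ∧ ∀ g ∉ C, φ g = 0

variable {X Y : Type*} [Zero X] [Zero Y]

lemma IsTestFun.finite_range {φ : G → X} (hφ : IsTestFun φ) : (Set.range φ).Finite := by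
  obtain ⟨C, hC, h0⟩ := hφ.exists_compact
  have : CompactSpace C := isCompact_iff_compactSpace.1 hC
  have h1 : (Set.range (φ ∘ ((↑) : C → G))).Finite :=
    (hφ.isLocallyConstant.comp_continuous continuous_subtype_val).range_finite
  refine (h1.union (Set.finite_singleton 0)).subset ?_
  rintro _ ⟨g, rfl⟩
  by_cases hg : g ∈ C
  · exact Or.inl ⟨⟨g, hg⟩, rfl⟩
  · exact Or.inr (h0 g hg)

lemma IsTestFun.comp {φ : G → X} (hφ : IsTestFun φ) (f : X → Y) (hf : f 0 = 0) :
    IsTestFun fun g => f (φ g) := by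
  obtain ⟨C, hC, h0⟩ := hφ.exists_compact
  exact ⟨hφ.isLocallyConstant.comp f, C, hC, fun g hg => by rw [h0 g hg, hf]⟩

lemma IsTestFun.smul {f : G → ℂ} (hf : IsTestFun f) {φ : G → V} (hφ : IsLocallyConstant φ) :
    IsTestFun fun g => f g • φ g := by
  obtain ⟨C, hC, h0⟩ := hf.exists_compact
  exact ⟨hf.isLocallyConstant.comp₂ hφ (fun a v => a • v), C, hC,
    fun g hg => by rw [h0 g hg, zero_smul]⟩

lemma IsTestFun.mul {f : G → ℂ} (hf : IsTestFun f) {φ : G → ℂ} (hφ : IsLocallyConstant φ) :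
    IsTestFun fun g => f g * φ g := hf.smul hφ

lemma IsTestFun.add {φ φ' : G → V} (hφ : IsTestFun φ) (hφ' : IsTestFun φ') :
    IsTestFun fun g => φ g + φ' g := by
  obtain ⟨C, hC, h0⟩ := hφ.exists_compact
  obtain ⟨C', hC', h0'⟩ := hφ'.exists_compact
  refine ⟨hφ.isLocallyConstant.comp₂ hφ'.isLocallyConstant (· + ·), C ∪ C', hC.union hC',
    fun g hg => ?_⟩
  rw [h0 g fun h => hg (Or.inl h), h0' g fun h => hg (Or.inr h), add_zero]

lemma IsTestFun.hasCompactSupport {φ : G → X} (hφ : IsTestFun φ) : HasCompactSupport φ := by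
  obtain ⟨C, hC, h0⟩ := hφ.exists_compact
  exact HasCompactSupport.intro hC fun {g} hg => h0 g hg

lemma IsTestFun.mul_right {φ : G → X} (hφ : IsTestFun φ) (h : G) :
    IsTestFun fun g => φ (g * h) := by
  obtain ⟨C, hC, h0⟩ := hφ.exists_compact
  refine ⟨hφ.isLocallyConstant.comp_continuous (continuous_mul_const h),
    (fun g => g * h⁻¹) '' C, hC.image (continuous_mul_const _), fun g hg => h0 _ fun h1 => ?_⟩
  exact hg ⟨g * h, h1, mul_inv_cancel_right _ _⟩

lemma IsTestFun.mul_left {φ : G → X} (hφ : IsTestFun φ) (h : G) :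
    IsTestFun fun g => φ (h * g) := by
  obtain ⟨C, hC, h0⟩ := hφ.exists_compact
  refine ⟨hφ.isLocallyConstant.comp_continuous (continuous_const_mul h),
    (fun g => h⁻¹ * g) '' C, hC.image (continuous_const_mul _), fun g hg => h0 _ fun h1 => ?_⟩
  exact hg ⟨h * g, h1, inv_mul_cancel_left _ _⟩

variable [MeasurableSpace G] [BorelSpace G] (μ : Measure G) [IsFiniteMeasureOnCompacts μ]

omit [IsTopologicalGroup G] in
lemma IsTestFun.measure_preimage_lt_top {φ : G → X} (hφ : IsTestFun φ) {y : X} (hy : y ≠ 0) :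
    μ (φ ⁻¹' {y}) < ⊤ := by
  obtain ⟨C, hC, h0⟩ := hφ.exists_compact
  refine lt_of_le_of_lt (measure_mono fun g hg => ?_) hC.measure_lt_top
  by_contra h
  exact hy (hg.symm.trans (h0 g h))

/-- Only finitely many values occur, each nonzero one on a set of finite measure, so the integral is
a finite sum. No topology on `V` is needed: the vector is pinned down by its pairings with linear
functionals. -/
lemma IsTestFun.exists_integral {φ : G → V} (hφ : IsTestFun φ) :
    ∃ v : V, ∀ ℓ : V →ₗ[ℂ] ℂ, Integrable (fun g => ℓ (φ g)) μ ∧ ℓ v = ∫ g, ℓ (φ g) ∂μ := by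
  classical
  set s : Finset V := hφ.finite_range.toFinset.erase 0 with hs
  refine ⟨∑ y ∈ s, (μ.real (φ ⁻¹' {y}) : ℂ) • y, fun ℓ => ?_⟩
  have h1 : (fun g => ℓ (φ g)) = fun g => ∑ y ∈ s, (φ ⁻¹' {y}).indicator (fun _ => ℓ y) g := by
    funext g
    by_cases hg : φ g = 0
    · rw [hg, map_zero, eq_comm]
      refine Finset.sum_eq_zero fun y hy => Set.indicator_of_notMem (fun h => ?_) _
      exact (Finset.mem_erase.1 hy).1 (h.symm.trans hg)
    · rw [Finset.sum_eq_single (φ g)]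
      · exact (Set.indicator_of_mem (show g ∈ φ ⁻¹' {φ g} from rfl) fun _ => ℓ (φ g)).symm
      · intro y _ hy
        exact Set.indicator_of_notMem (fun h => hy h.symm) _
      · intro h
        exact absurd (Finset.mem_erase.2 ⟨hg, hφ.finite_range.mem_toFinset.2 ⟨g, rfl⟩⟩) h
  have hmeas : ∀ y, MeasurableSet (φ ⁻¹' {y}) := fun y =>
    (hφ.isLocallyConstant.isOpen_fiber y).measurableSet
  have h2 : ∀ y ∈ s, Integrable ((φ ⁻¹' {y}).indicator fun _ => ℓ y) μ := fun y hy =>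
    (integrable_indicator_iff (hmeas y)).2
      (integrableOn_const (hφ.measure_preimage_lt_top μ (Finset.mem_erase.1 hy).1).ne)
  rw [h1]
  refine ⟨integrable_finsetSum _ h2, ?_⟩
  rw [integral_finsetSum _ h2, map_sum]
  refine Finset.sum_congr rfl fun y _ => ?_
  rw [integral_indicator_const _ (hmeas y), map_smul]
  simp

/-- The integral of a locally constant compactly supported function with values in a complex
vector space. -/
noncomputable def testInt (φ : G → V) : V :=
  Classical.epsilon fun v : V => ∀ ℓ : V →ₗ[ℂ] ℂ, ℓ v = ∫ g, ℓ (φ g) ∂μ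

lemma apply_testInt {φ : G → V} (hφ : IsTestFun φ) (ℓ : V →ₗ[ℂ] ℂ) :
    ℓ (testInt μ φ) = ∫ g, ℓ (φ g) ∂μ := by
  obtain ⟨v, hv⟩ := hφ.exists_integral μ
  exact Classical.epsilon_spec (p := fun v : V => ∀ ℓ : V →ₗ[ℂ] ℂ, ℓ v = ∫ g, ℓ (φ g) ∂μ)
    ⟨v, fun ℓ => (hv ℓ).2⟩ ℓ

lemma IsTestFun.integrable {φ : G → ℂ} (hφ : IsTestFun φ) : Integrable φ μ := by
  obtain ⟨v, hv⟩ := hφ.exists_integral μ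
  exact (hv LinearMap.id).1

omit [TopologicalSpace G] [IsTopologicalGroup G] [MeasurableSpace G] [BorelSpace G] [Group G] in
lemma eq_of_forall_dual {v w : V} (h : ∀ ℓ : V →ₗ[ℂ] ℂ, ℓ v = ℓ w) : v = w := by
  rw [← sub_eq_zero, ← Module.forall_dual_apply_eq_zero_iff ℂ]
  intro ℓ
  rw [map_sub, h, sub_self]

lemma testInt_map {W : Type*} [AddCommGroup W] [Module ℂ W] {φ : G → V} (hφ : IsTestFun φ)
    (T : V →ₗ[ℂ] W) : T (testInt μ φ) = testInt μ fun g => T (φ g) := by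
  refine eq_of_forall_dual fun ℓ => ?_
  rw [apply_testInt μ (hφ.comp T (map_zero T))]
  exact apply_testInt μ hφ (ℓ ∘ₗ T)

lemma testInt_add {φ φ' : G → V} (hφ : IsTestFun φ) (hφ' : IsTestFun φ') :
    testInt μ (fun g => φ g + φ' g) = testInt μ φ + testInt μ φ' := by
  refine eq_of_forall_dual fun ℓ => ?_
  rw [map_add, apply_testInt μ (hφ.add hφ'), apply_testInt μ hφ, apply_testInt μ hφ',
    ← integral_add ((hφ.comp ℓ (map_zero ℓ)).integrable μ)
      ((hφ'.comp ℓ (map_zero ℓ)).integrable μ)]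
  simp only [map_add]

lemma testInt_smul {φ : G → V} (hφ : IsTestFun φ) (c : ℂ) :
    testInt μ (fun g => c • φ g) = c • testInt μ φ :=
  (testInt_map μ hφ (LinearMap.lsmul ℂ V c)).symm

lemma testInt_mul_left [μ.IsMulLeftInvariant] {φ : G → V} (hφ : IsTestFun φ) (h : G) :
    testInt μ (fun g => φ (h * g)) = testInt μ φ := by
  refine eq_of_forall_dual fun ℓ => ?_
  rw [apply_testInt μ hφ, apply_testInt μ (hφ.mul_left h)]
  exact integral_mul_left_eq_self (fun g => ℓ (φ g)) h

/-- The integral of a function that is constant on the members of a finite disjoint family of sets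
and zero elsewhere. -/
lemma integral_eq_sum_of_const {ι : Type*} [Fintype ι] {A : ι → Set G}
    (hA : ∀ i, MeasurableSet (A i)) (hA' : ∀ i, μ (A i) ≠ ⊤)
    (hdisj : ∀ i j g, g ∈ A i → g ∈ A j → i = j) {φ : G → ℂ} {c : ι → ℂ}
    (hφ : ∀ i, ∀ g ∈ A i, φ g = c i) (h0 : ∀ g, (∀ i, g ∉ A i) → φ g = 0) :
    ∫ g, φ g ∂μ = ∑ i, (μ.real (A i) : ℂ) * c i := by
  classical
  have h1 : φ = fun g => ∑ i, (A i).indicator (fun _ => c i) g := by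
    funext g
    by_cases hg : ∃ i, g ∈ A i
    · obtain ⟨i, hi⟩ := hg
      rw [Finset.sum_eq_single i, Set.indicator_of_mem hi, hφ i g hi]
      · intro j _ hj
        exact Set.indicator_of_notMem (fun h => hj (hdisj j i g h hi)) _
      · simp
    · push Not at hg
      rw [h0 g hg, eq_comm]
      exact Finset.sum_eq_zero fun i _ => Set.indicator_of_notMem (hg i) _
  have h2 : ∀ i ∈ Finset.univ, Integrable ((A i).indicator fun _ => c i) μ := fun i _ =>
    (integrable_indicator_iff (hA i)).2 (integrableOn_const (hA' i))
  rw [h1, integral_finsetSum _ h2]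
  refine Finset.sum_congr rfl fun i _ => ?_
  rw [integral_indicator_const _ (hA i)]
  simp

end TestFun

/-! ### Topology and measure on `PGL₂(F)` -/

section PGLTopology

variable {F : Type*} [Field F] [ValuativeRel F] [TopologicalSpace F] [IsNonarchimedeanLocalField F]

instance pglIsTopologicalGroup : IsTopologicalGroup PGL(2, F) :=
  inferInstanceAs (IsTopologicalGroup (GL (Fin 2) F ⧸ Subgroup.center (GL (Fin 2) F)))

instance pglBorelSpace : BorelSpace PGL(2, F) := ⟨rfl⟩

lemma continuous_pgl_mk : Continuous (ProjGenLinGroup.mk : GL (Fin 2) F → PGL(2, F)) :=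
  QuotientGroup.continuous_mk

lemma isOpenMap_pgl_mk : IsOpenMap (ProjGenLinGroup.mk : GL (Fin 2) F → PGL(2, F)) :=
  QuotientGroup.isOpenMap_coe

/-- The set of integral matrices. -/
def integralMatrices (F : Type*) [Field F] [ValuativeRel F] : Set (Matrix (Fin 2) (Fin 2) F) :=
  {M | ∀ i j, M i j ∈ 𝒪[F]}

lemma isOpen_integralMatrices : IsOpen (integralMatrices F) := by
  have : integralMatrices F = ⋂ i, ⋂ j, {M | M i j ∈ 𝒪[F]} := by
    ext M
    simp [integralMatrices]
  rw [this]
  refine isOpen_iInter_of_finite fun i => isOpen_iInter_of_finite fun j => ?_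
  exact isOpen_integer.preimage (continuous_apply_apply i j)

lemma isCompact_integralMatrices : IsCompact (integralMatrices F) := by
  have h1 : IsCompact (𝒪[F] : Set F) :=
    IsNonarchimedeanLocalField.isCompact_closedBall F 1
  have h2 : IsCompact (Set.pi Set.univ fun _ : Fin 2 => Set.pi Set.univ fun _ : Fin 2 =>
      (𝒪[F] : Set F)) := isCompact_univ_pi fun _ => isCompact_univ_pi fun _ => h1
  have h3 : integralMatrices F = Set.pi Set.univ fun _ : Fin 2 => Set.pi Set.univ
      fun _ : Fin 2 => (𝒪[F] : Set F) := by
    ext M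
    exact ⟨fun h i _ j _ => h i j, fun h i j => h i trivial j trivial⟩
  rw [h3]
  exact h2

/-- This form is adapted to the topology of the unit group: it exhibits `GL₂(𝒪)` as open, and as the
preimage of a compact set under the closed embedding `g ↦ (g, g⁻¹)`. -/
lemma isIntegralGL_iff {g : GL (Fin 2) F} : IsIntegralGL g ↔
    (g : Matrix (Fin 2) (Fin 2) F) ∈ integralMatrices F ∧
      ((g⁻¹ : GL (Fin 2) F) : Matrix (Fin 2) (Fin 2) F) ∈ integralMatrices F := by
  constructor
  · intro hg
    refine ⟨hg.1, (isIntegralGL_of_mk_mem (g := g⁻¹) ?_ ?_).1⟩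
    · rw [map_inv]
      exact inv_mem (mk_mem_maxCompact hg)
    · have h := ord_mul g.det_ne_zero (g⁻¹).det_ne_zero
      rw [← Matrix.det_mul, ← Units.val_mul, mul_inv_cancel, Units.val_one, Matrix.det_one,
        ord_one, hg.2] at h
      omega
  · rintro ⟨h1, h2⟩
    have hdet : ∀ g : GL (Fin 2) F, (g : Matrix (Fin 2) (Fin 2) F) ∈ integralMatrices F →
        0 ≤ ord (g : Matrix (Fin 2) (Fin 2) F).det := fun g hg => by
      rw [← mem_integer_iff_ord g.det_ne_zero, Matrix.det_fin_two]
      exact sub_mem (mul_mem (hg _ _) (hg _ _)) (mul_mem (hg _ _) (hg _ _))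
    refine ⟨h1, ?_⟩
    have h := ord_mul g.det_ne_zero (g⁻¹).det_ne_zero
    rw [← Matrix.det_mul, ← Units.val_mul, mul_inv_cancel, Units.val_one, Matrix.det_one,
      ord_one] at h
    have h3 := hdet g h1
    have h4 := hdet g⁻¹ h2
    omega

lemma maxCompact_eq_image : (maxCompact F : Set PGL(2, F)) =
    ProjGenLinGroup.mk '' {g | IsIntegralGL g} := by
  ext x
  constructor
  · intro hx
    obtain ⟨g, hg, rfl⟩ := exists_of_mem_maxCompact hx
    exact ⟨g, hg, rfl⟩
  · rintro ⟨g, hg, rfl⟩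
    exact mk_mem_maxCompact hg

lemma isOpen_maxCompact : IsOpen (maxCompact F : Set PGL(2, F)) := by
  rw [maxCompact_eq_image]
  refine isOpenMap_pgl_mk _ ?_
  simp only [isIntegralGL_iff]
  exact (isOpen_integralMatrices.preimage Units.continuous_val).inter
    (isOpen_integralMatrices.preimage (Units.continuous_val.comp continuous_inv))

instance localFieldT1Space : T1Space F := by
  let := IsTopologicalAddGroup.rightUniformSpace F
  have := isUniformAddGroup_of_addCommGroup (G := F)
  have : T0Space F := ValuedRing.separated (Γ₀ := ValueGroupWithZero F)
  infer_instance

lemma isCompact_maxCompact : IsCompact (maxCompact F : Set PGL(2, F)) := by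
  rw [maxCompact_eq_image]
  refine IsCompact.image ?_ continuous_pgl_mk
  have h1 : {g : GL (Fin 2) F | IsIntegralGL g} = Units.embedProduct _ ⁻¹'
      (integralMatrices F ×ˢ (MulOpposite.op '' integralMatrices F)) := by
    ext g
    simp [isIntegralGL_iff, -MulOpposite.op_inv, -Matrix.coe_units_inv]
  rw [h1]
  refine Topology.IsClosedEmbedding.isCompact_preimage ?_ (isCompact_integralMatrices.prod
    (isCompact_integralMatrices.image MulOpposite.continuous_op))
  exact Units.isClosedEmbedding_embedProduct

instance pglLocallyCompactSpace : LocallyCompactSpace PGL(2, F) :=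
  isCompact_maxCompact.locallyCompactSpace_of_mem_nhds_of_group
    (isOpen_maxCompact.mem_nhds (one_mem _))

lemma continuous_torus : Continuous (torus : Fˣ → PGL(2, F)) := by
  refine continuous_pgl_mk.comp ?_
  have h : ∀ u : Fˣ → Fˣ, Continuous u → Continuous fun a : Fˣ =>
      (tri (u a) 0 1 : Matrix (Fin 2) (Fin 2) F) := by
    intro u hu
    refine continuous_matrix fun i j => ?_
    fin_cases i <;> fin_cases j <;> simp <;> fun_prop
  rw [Units.continuous_iff]
  refine ⟨h id continuous_id, ?_⟩
  have h1 : ∀ a : Fˣ, ((tri a 0 1)⁻¹ : GL (Fin 2) F) = tri a⁻¹ 0 1 := by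
    intro a
    rw [inv_eq_iff_mul_eq_one]
    ext i j
    fin_cases i <;> fin_cases j <;> simp [Matrix.mul_apply, Fin.sum_univ_two]
  simp only [h1]
  exact h _ continuous_inv

section Haar

lemma isTestFun_maxCompact : IsTestFun ((maxCompact F : Set PGL(2, F)).indicator
    fun _ => (1 : ℂ)) := by
  refine ⟨isLocallyConstant_of_mul_right isOpen_maxCompact (one_mem _) fun g u hu => ?_,
    _, isCompact_maxCompact, fun g hg => Set.indicator_of_notMem hg _⟩
  by_cases hg : g ∈ (maxCompact F : Set PGL(2, F))
  · rw [Set.indicator_of_mem hg, Set.indicator_of_mem (mul_mem hg hu)]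
  · rw [Set.indicator_of_notMem hg, Set.indicator_of_notMem]
    intro h
    exact hg (by simpa using mul_mem h (inv_mem (show u ∈ maxCompact F from hu)))

variable (μ : Measure PGL(2, F)) [μ.IsHaarMeasure]

lemma integral_mul_right_modular {φ : PGL(2, F) → ℂ} (hφ : IsTestFun φ) (h : PGL(2, F)) :
    ∫ g, φ (g * h) ∂μ = (Measure.modularCharacterFun h : ℂ) * ∫ g, φ g ∂μ := by
  have h1 : ∫ g, φ g ∂(μ.map (· * h)) = ∫ g, φ (g * h) ∂μ :=
    integral_map (continuous_mul_const h).measurable.aemeasurable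
      hφ.isLocallyConstant.continuous.aestronglyMeasurable
  -- Uniqueness of Haar measure is applied to real-valued test functions, so real and imaginary
  -- parts are treated separately.
  have h2 : ∀ f : ℂ → ℝ, f 0 = 0 → ∫ g, f (φ g) ∂(μ.map (· * h)) =
      (Measure.modularCharacterFun h : ℝ) * ∫ g, f (φ g) ∂μ := by
    intro f hf
    have hφ' := hφ.comp f hf
    rw [Measure.integral_isMulLeftInvariant_eq_smul_of_hasCompactSupport (μ.map (· * h)) μ
      hφ'.isLocallyConstant.continuous hφ'.hasCompactSupport, integral_smul_nnreal_measure,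
      Measure.modularCharacterFun_eq_haarScalarFactor μ h, NNReal.smul_def, smul_eq_mul]
  have h3 := integral_re_add_im (hφ.integrable (μ.map (· * h)))
  have h4 := integral_re_add_im (hφ.integrable μ)
  have h5 := h2 Complex.re Complex.zero_re
  have h6 := h2 Complex.im Complex.zero_im
  have hc : ∀ r : ℝ, (RCLike.ofReal r : ℂ) = Complex.ofReal r := fun _ => rfl
  simp only [RCLike.re_to_complex, RCLike.im_to_complex, hc] at h3 h4
  rw [← h1, ← h3, ← h4, h5, h6, Complex.ofReal_mul, Complex.ofReal_mul]
  ring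

lemma measureReal_maxCompact_ne_zero : (μ.real (maxCompact F : Set PGL(2, F)) : ℂ) ≠ 0 := by
  rw [Complex.ofReal_ne_zero, Measure.real, ENNReal.toReal_ne_zero]
  exact ⟨(isOpen_maxCompact.measure_pos μ ⟨1, one_mem _⟩).ne',
    isCompact_maxCompact.measure_lt_top.ne⟩

lemma integral_indicator_maxCompact : ∫ g, (maxCompact F : Set PGL(2, F)).indicator
    (fun _ => (1 : ℂ)) g ∂μ = μ.real (maxCompact F : Set PGL(2, F)) := by
  rw [integral_indicator_const _ isOpen_maxCompact.measurableSet]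
  simp

/-- The modular character is trivial on `K`, whose volume is finite and positive. The Weyl element
inverts the torus, so the character squares to one there and, being nonnegative, is one. The Cartan
decomposition covers the rest. -/
lemma modularCharacterFun_eq_one (h : PGL(2, F)) : Measure.modularCharacterFun h = 1 := by
  have hK : ∀ k ∈ maxCompact F, Measure.modularCharacterFun k = 1 := by
    intro k hk
    have h1 := integral_mul_right_modular Measure.haar (isTestFun_maxCompact (F := F)) k
    have h2 : ∀ g, (maxCompact F : Set PGL(2, F)).indicator (fun _ => (1 : ℂ)) (g * k) =
        (maxCompact F : Set PGL(2, F)).indicator (fun _ => (1 : ℂ)) g := by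
      intro g
      classical
      simp only [Set.indicator, SetLike.mem_coe, Subgroup.mul_mem_cancel_right _ hk]
    simp only [h2] at h1
    rw [integral_indicator_maxCompact, eq_comm, mul_eq_right₀
      (measureReal_maxCompact_ne_zero _)] at h1
    exact_mod_cast h1
  have hw := hK _ (weyl_mem_maxCompact (F := F))
  have ht : ∀ a : Fˣ, Measure.modularCharacterFun (torus a) = 1 := by
    intro a
    have h1 := congrArg Measure.modularCharacterFun (weyl_torus_weyl a)
    rw [Measure.modularCharacterFun_map_mul, Measure.modularCharacterFun_map_mul, hw, one_mul,
      mul_one] at h1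
    have h2 : Measure.modularCharacterFun (torus a * torus a⁻¹) = 1 := by
      rw [← torus_mul, mul_inv_cancel, torus_one, Measure.modularCharacterFun_map_one]
    rw [Measure.modularCharacterFun_map_mul, ← h1, ← sq, pow_eq_one_iff_of_nonneg zero_le two_ne_zero] at h2
    exact h2
  obtain ⟨k, hk, n, k', hk', rfl⟩ := exists_cartan (ord_uniformizer (F := F)) h
  rw [Measure.modularCharacterFun_map_mul, Measure.modularCharacterFun_map_mul, hK k hk,
    hK k' hk', ← torus_pow, ht]
  simp

/-- `PGL₂(F)` is unimodular. -/
lemma integral_mul_right {φ : PGL(2, F) → ℂ} (hφ : IsTestFun φ) (h : PGL(2, F)) :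
    ∫ g, φ (g * h) ∂μ = ∫ g, φ g ∂μ := by
  rw [integral_mul_right_modular μ hφ, modularCharacterFun_eq_one]
  simp

lemma testInt_mul_right {V : Type*} [AddCommGroup V] [Module ℂ V] {φ : PGL(2, F) → V}
    (hφ : IsTestFun φ) (h : PGL(2, F)) : testInt μ (fun g => φ (g * h)) = testInt μ φ := by
  refine eq_of_forall_dual fun ℓ => ?_
  rw [apply_testInt μ hφ, apply_testInt μ (hφ.mul_right h)]
  exact integral_mul_right μ (hφ.comp ℓ (map_zero ℓ)) h

/-- The integral of a left `K`-invariant function supported on finitely many right cosets. -/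
lemma integral_eq_sum_rightCosets {ι : Type*} [Fintype ι] {c : ι → PGL(2, F)}
    (hc : ∀ i j, c i * (c j)⁻¹ ∈ maxCompact F → i = j) {φ : PGL(2, F) → ℂ}
    (hφ : ∀ k ∈ maxCompact F, ∀ g, φ (k * g) = φ g)
    (h0 : ∀ g, (∀ i, g * (c i)⁻¹ ∉ maxCompact F) → φ g = 0) :
    ∫ g, φ g ∂μ = μ.real (maxCompact F : Set PGL(2, F)) * ∑ i, φ (c i) := by
  set A : ι → Set PGL(2, F) := fun i => (fun g => g * (c i)⁻¹) ⁻¹' (maxCompact F) with hA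
  have hopen : ∀ i, IsOpen (A i) := fun i => isOpen_maxCompact.preimage (continuous_mul_const _)
  have hvol : ∀ i, μ.real (A i) = μ.real (maxCompact F : Set PGL(2, F)) := by
    intro i
    -- Unimodularity gives right translates of `K` the volume of `K`.
    have h1 := integral_mul_right μ (isTestFun_maxCompact (F := F)) (c i)⁻¹
    rw [integral_indicator_maxCompact] at h1
    have h2 : ∫ g, (A i).indicator (fun _ => (1 : ℂ)) g ∂μ = μ.real (A i) := by
      rw [integral_indicator_const _ (hopen i).measurableSet]
      simp
    exact_mod_cast h2.symm.trans h1
  rw [integral_eq_sum_of_const μ (A := A) (c := fun i => φ (c i)) (fun i => (hopen i).measurableSet),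
    Finset.mul_sum]
  · simp only [hvol]
  -- An infinite measure would have real value `0`, contradicting the nonzero volume of `K`.
  · intro i h1
    apply measureReal_maxCompact_ne_zero μ
    rw [← hvol i, Measure.real, h1]
    simp
  · intro i j g hi hj
    refine hc i j ?_
    have := mul_mem (inv_mem (show g * (c i)⁻¹ ∈ maxCompact F from hi)) hj
    simpa [mul_assoc] using this
  · intro i g hg
    have := hφ _ hg (c i)
    rwa [inv_mul_cancel_right] at this
  · exact h0

/-- The integral of a right `K`-invariant function supported on finitely many left cosets. -/
lemma integral_eq_sum_leftCosets {ι : Type*} [Fintype ι] {c : ι → PGL(2, F)}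
    (hc : ∀ i j, (c i)⁻¹ * c j ∈ maxCompact F → i = j) {φ : PGL(2, F) → ℂ}
    (hφ : ∀ k ∈ maxCompact F, ∀ g, φ (g * k) = φ g)
    (h0 : ∀ g, (∀ i, (c i)⁻¹ * g ∉ maxCompact F) → φ g = 0) :
    ∫ g, φ g ∂μ = μ.real (maxCompact F : Set PGL(2, F)) * ∑ i, φ (c i) := by
  set A : ι → Set PGL(2, F) := fun i => (fun g => (c i)⁻¹ * g) ⁻¹' (maxCompact F) with hA
  have hopen : ∀ i, IsOpen (A i) := fun i => isOpen_maxCompact.preimage (continuous_const_mul _)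
  have hvol : ∀ i, μ (A i) = μ (maxCompact F : Set PGL(2, F)) := fun i =>
    measure_preimage_mul μ _ _
  rw [integral_eq_sum_of_const μ (A := A) (c := fun i => φ (c i)) (fun i => (hopen i).measurableSet),
    Finset.mul_sum]
  · simp only [Measure.real, hvol]
  · intro i
    rw [hvol]
    exact isCompact_maxCompact.measure_lt_top.ne
  · intro i j g hi hj
    refine hc i j ?_
    have := mul_mem (show (c i)⁻¹ * g ∈ maxCompact F from hi)
      (inv_mem (show (c j)⁻¹ * g ∈ maxCompact F from hj))
    simpa [mul_assoc] using this
  · intro i g hg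
    have := hφ _ hg (c i)
    rwa [mul_inv_cancel_left] at this
  · exact h0

end Haar

end PGLTopology

end LocalSpherical

namespace LocalSpherical

open Matrix

lemma isLocallyConstant_of_mul_left {G X : Type*} [Group G] [TopologicalSpace G]
    [ContinuousMul G] {U : Set G} (hU : IsOpen U) (h1 : (1 : G) ∈ U) {φ : G → X}
    (hφ : ∀ g, ∀ u ∈ U, φ (u * g) = φ g) : IsLocallyConstant φ := by
  rw [IsLocallyConstant.iff_exists_open]
  intro g
  refine ⟨(fun x => x * g⁻¹) ⁻¹' U, hU.preimage (continuous_mul_const _), by simpa using h1, ?_⟩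
  intro x hx
  have := hφ g _ hx
  rwa [inv_mul_cancel_right] at this

/-! ### The double coset of `diag(ϖ, 1)` and the even part of `h̃^□` -/

section DetOneSet

variable {F : Type*} [Field F] [ValuativeRel F] [TopologicalSpace F] [IsNonarchimedeanLocalField F]

lemma exists_compact_detOneSet : ∃ C : Set PGL(2, F), IsCompact C ∧ detOneSet F ⊆ C := by
  have : Finite (Option 𝓀[F]) := inferInstance
  refine ⟨⋃ i, (fun g => g * cosetRep (uniformizer F) i) '' (maxCompact F),
    isCompact_iUnion fun i => isCompact_maxCompact.image (continuous_mul_const _), fun x hx => ?_⟩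
  obtain ⟨i, hi⟩ := exists_mul_cosetRep_inv_mem ord_uniformizer hx
  exact Set.mem_iUnion.2 ⟨i, _, hi, inv_mul_cancel_right _ _⟩

open Classical in
/-- The indicator function of `detOneSet F`. -/
noncomputable def detOneInd (x : PGL(2, F)) : ℂ := if x ∈ detOneSet F then 1 else 0

lemma detOneInd_mul_left {k : PGL(2, F)} (hk : k ∈ maxCompact F) (x : PGL(2, F)) :
    detOneInd (k * x) = detOneInd x :=
  congrArg (fun p : Prop => @ite ℂ p (Classical.propDecidable p) 1 0)
    (propext (mul_mem_detOneSet_left_iff hk))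

lemma detOneInd_mul_right {k : PGL(2, F)} (hk : k ∈ maxCompact F) (x : PGL(2, F)) :
    detOneInd (x * k) = detOneInd x :=
  congrArg (fun p : Prop => @ite ℂ p (Classical.propDecidable p) 1 0)
    (propext (mul_mem_detOneSet_right_iff hk))

lemma isTestFun_detOneInd : IsTestFun (detOneInd : PGL(2, F) → ℂ) := by
  obtain ⟨C, hC, hSC⟩ := exists_compact_detOneSet (F := F)
  exact ⟨isLocallyConstant_of_mul_right isOpen_maxCompact (one_mem _)
    fun g u hu => detOneInd_mul_right hu g, C, hC, fun g hg => if_neg fun h => hg (hSC h)⟩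

/-- The even part, under a change of sign, of the product defining `h̃^□`. -/
lemma even_part_prod {a b : Fin 2 → ℂ} (ha : ∀ i, a i = 0 ∨ a i = 1 ∨ a i = -1)
    (hb : ∀ i, b i = 0 ∨ b i = 1 ∨ b i = -1) (ha0 : a 0 ≠ 0 ∨ a 1 ≠ 0) (hb0 : b 0 ≠ 0 ∨ b 1 ≠ 0)
    {c : ℂ} (hc : c = if a 0 ≠ 0 ∧ a 1 ≠ 0 ∧ b 0 ≠ 0 ∧ b 1 ≠ 0 then 1 / 2 else 1) :
    c * ((1 + a 0 * b 0) * (1 + a 0 * b 1) * ((1 + a 1 * b 0) * (1 + a 1 * b 1))) +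
      c * ((1 - a 0 * b 0) * (1 - a 0 * b 1) * ((1 - a 1 * b 0) * (1 - a 1 * b 1))) =
    2 * ((1 + a 0 * a 1) * (1 + b 0 * b 1)) := by
  -- A finite check. When all four values are nonzero and `a 0 * a 1 = b 0 * b 1 = 1`, exactly one
  -- of the two products is `16` and the other is `0`, against `8` on the right; this is the origin
  -- of the factor `1 / 2`.
  rcases ha 0 with h1 | h1 | h1 <;> rcases ha 1 with h2 | h2 | h2 <;>
    rcases hb 0 with h3 | h3 | h3 <;> rcases hb 1 with h4 | h4 | h4 <;>
    simp only [h1, h2, h3, h4] at ha0 hb0 hc ⊢ <;>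
    first
      | (exfalso; simp at ha0; done)
      | (exfalso; simp at hb0; done)
      | (norm_num at hc; rw [hc]; norm_num)

lemma etaBar_cases (u : 𝓀[F]) : etaBar u = 0 ∨ etaBar u = 1 ∨ etaBar u = -1 := by
  by_cases hu : u = 0
  · exact Or.inl (by rw [hu, etaBar_zero])
  · exact Or.inr (etaBar_eq_or hu)

lemma etaBar_ne_zero_iff (u : 𝓀[F]) : etaBar u ≠ 0 ↔ u ≠ 0 := by
  refine ⟨fun h h0 => h (by rw [h0, etaBar_zero]), fun h h0 => ?_⟩
  have := etaBar_mul_self h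
  rw [h0] at this
  simp at this

/-- The quadratic character on units, extended by zero. -/
noncomputable def unitChar (z : Fˣ) : ℂ := if ord (z : F) = 0 then etaBar (red (z : F)) else 0

lemma unitChar_mul {u : Fˣ} (hu : ord (u : F) = 0) (z : Fˣ) :
    unitChar (u * z) = etaBar (red (u : F)) * unitChar z := by
  by_cases hz : ord (z : F) = 0
  · rw [unitChar, unitChar, if_pos (by rw [ord_mul_units, hu, hz, add_zero]), if_pos hz,
      Units.val_mul, red_mul (units_mem_of_ord_eq_zero hu) (units_mem_of_ord_eq_zero hz),
      etaBar_mul]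
  · rw [unitChar, unitChar, if_neg (by rwa [ord_mul_units, hu, zero_add]), if_neg hz, mul_zero]

lemma isOpen_red_eq_one : IsOpen {z : Fˣ | ord (z : F) = 0 ∧ red (z : F) = 1} := by
  set ϖ := uniformizer F
  have hϖ : ord (ϖ : F) = 1 := ord_uniformizer
  have h : {z : Fˣ | ord (z : F) = 0 ∧ red (z : F) = 1} =
      (fun z : Fˣ => ((z : F) - 1) * ((ϖ⁻¹ : Fˣ) : F)) ⁻¹' (𝒪[F] : Set F) := by
    ext z
    simp only [Set.mem_ofPred_eq, Set.mem_preimage, SetLike.mem_coe]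
    constructor
    · rintro ⟨h1, h2⟩
      rw [Units.val_inv_eq_inv_val, ← div_eq_mul_inv]
      have hz := units_mem_of_ord_eq_zero h1
      exact div_mem_of_red_eq_zero (sub_mem hz (one_mem _))
        (by rw [red_sub hz (one_mem _), h2, red_one, sub_self]) hϖ
    · intro h1
      have hϖm : (ϖ : F) ∈ 𝒪[F] := (units_mem_integer_iff _).2 (by omega)
      set y := ((z : F) - 1) * ((ϖ⁻¹ : Fˣ) : F)
      have h2 : (z : F) = 1 + ϖ * y := by
        simp only [y, Units.val_inv_eq_inv_val]
        field_simp
        ring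
      have h3 : red ((ϖ : F) * y) = 0 := by
        rw [red_mul hϖm h1, red_eq_zero_of_ord_pos (a := (ϖ : F)) (by omega), zero_mul]
      have h4 := mul_mem hϖm h1
      rw [h2]
      exact ⟨(ord_one_add h4 h3).2, by rw [red_add (one_mem _) h4, h3, red_one, add_zero]⟩
  rw [h]
  exact isOpen_integer.preimage (by fun_prop)

lemma isLocallyConstant_unitChar : IsLocallyConstant (unitChar : Fˣ → ℂ) := by
  refine isLocallyConstant_of_mul_left isOpen_red_eq_one (by simp) fun z u hu => ?_
  rw [unitChar_mul hu.1, hu.2, etaBar_one, one_mul]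

/-- The value of `h̃^□` on a multiple of an integral matrix by a unit. -/
lemma hSquareTilde_scalar_mul {g : GL (Fin 2) F} (hg : IsInMatDetOne g) {x y : Fin 2 → 𝓀[F]}
    (h : ∀ i j, red (g i j) = x i * y j) {z : Fˣ} (hz : ord (z : F) = 0) :
    hSquareTilde (GeneralLinearGroup.scalar (Fin 2) z * g) =
      hSquareTilde g + (etaBar (red (z : F)) - 1) *
        (hSquareTilde g - (1 + fColTilde g) * (1 + fSquareTilde g)) := by
  classical
  have hz' := units_mem_of_ord_eq_zero hz
  have hz0 : red (z : F) ≠ 0 := (red_units_ne_zero_iff z hz').2 hz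
  have hzg := isInMatDetOne_mul_left (isIntegralGL_scalar hz) hg
  have hred : ∀ i j, red ((GeneralLinearGroup.scalar (Fin 2) z * g) i j) =
      red (z : F) * (x i * y j) := fun i j => by
    rw [scalar_mul_apply, red_mul hz' (hg.1 _ _), h]
  obtain ⟨i₀, j₀, h0⟩ := exists_red_ne_zero hg
  rw [h] at h0
  have hx : x 0 ≠ 0 ∨ x 1 ≠ 0 := by
    by_contra! hx
    fin_cases i₀ <;> simp [hx] at h0
  have hy : y 0 ≠ 0 ∨ y 1 ≠ 0 := by
    by_contra! hy
    fin_cases j₀ <;> simp [hy] at h0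
  set a : Fin 2 → ℂ := fun i => etaBar (x i) with ha
  set b : Fin 2 → ℂ := fun i => etaBar (y i) with hb
  set c : ℂ := if a 0 ≠ 0 ∧ a 1 ≠ 0 ∧ b 0 ≠ 0 ∧ b 1 ≠ 0 then 1 / 2 else 1 with hc
  have key := even_part_prod (a := a) (b := b) (fun i => etaBar_cases _) (fun i => etaBar_cases _)
    (by simpa only [ha, etaBar_ne_zero_iff] using hx)
    (by simpa only [hb, etaBar_ne_zero_iff] using hy) hc
  have hiff : (∀ i j, x i * y j ≠ 0) ↔ a 0 ≠ 0 ∧ a 1 ≠ 0 ∧ b 0 ≠ 0 ∧ b 1 ≠ 0 := by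
    simp only [ha, hb, etaBar_ne_zero_iff, Fin.forall_fin_two, mul_ne_zero_iff]
    tauto
  have hiff' : (∀ i j, red (z : F) * (x i * y j) ≠ 0) ↔
      a 0 ≠ 0 ∧ a 1 ≠ 0 ∧ b 0 ≠ 0 ∧ b 1 ≠ 0 := by
    rw [← hiff]
    simp only [mul_ne_zero_iff, ne_eq, hz0, not_false_eq_true, true_and]
  have e1 : hSquareTilde g =
      c * ((1 + a 0 * b 0) * (1 + a 0 * b 1) * ((1 + a 1 * b 0) * (1 + a 1 * b 1))) := by
    rw [hSquareTilde, if_pos hg]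
    simp only [h, hiff, etaBar_mul, Fin.prod_univ_two]
    rw [hc]
    split_ifs <;> simp [ha, hb]
  have e2 : hSquareTilde (GeneralLinearGroup.scalar (Fin 2) z * g) =
      c * ((1 + etaBar (red (z : F)) * (a 0 * b 0)) * (1 + etaBar (red (z : F)) * (a 0 * b 1)) *
        ((1 + etaBar (red (z : F)) * (a 1 * b 0)) * (1 + etaBar (red (z : F)) * (a 1 * b 1)))) := by
    rw [hSquareTilde, if_pos hzg]
    simp only [hred, hiff', etaBar_mul, Fin.prod_univ_two]
    rw [hc]
    split_ifs <;> simp [ha, hb]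
  rw [e2, e1, fColTilde_eq hg h, fSquareTilde_eq hg h, etaBar_mul, etaBar_mul]
  change _ = _ + _ * (_ - (1 + a 0 * a 1) * (1 + b 0 * b 1))
  -- For `η̄(z) = 1` the value is unchanged; for `η̄(z) = -1` every sign flips and the even-part
  -- identity applies.
  rcases etaBar_eq_or hz0 with he | he <;> rw [he]
  · ring
  · linear_combination key

end DetOneSet

/-! ### Descent of the test functions to `PGL₂` and decomposition of `h^□` -/

section Pushforward

variable {F : Type*} [Field F] [ValuativeRel F] [TopologicalSpace F] [IsNonarchimedeanLocalField F]
  [MeasurableSpace F] [BorelSpace F] {ν : Measure Fˣ} [ν.IsHaarMeasure]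

/-- Two representatives differ by a scalar, which Haar invariance absorbs, so the chosen
representative is irrelevant. -/
lemma pushforward_mk (φ : GL (Fin 2) F → ℂ) (g : GL (Fin 2) F) :
    pushforward ν φ (ProjGenLinGroup.mk g) =
      ∫ z : Fˣ, φ (GeneralLinearGroup.scalar (Fin 2) z * g) ∂ν := by
  obtain ⟨w, hw⟩ := exists_scalar_mul_of_mk_eq (g := g)
    (h := Function.surjInv ProjGenLinGroup.mk_surjective (ProjGenLinGroup.mk g))
    (Function.surjInv_eq ProjGenLinGroup.mk_surjective _).symm
  rw [pushforward, ← hw, ← integral_mul_left_eq_self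
    (fun z : Fˣ => φ (GeneralLinearGroup.scalar (Fin 2) z * g)) w]
  refine integral_congr_ae (Filter.Eventually.of_forall fun z => ?_)
  simp only
  rw [← mul_assoc, ← map_mul, mul_comm z w]

lemma pushforward_eq_zero {φ : GL (Fin 2) F → ℂ} (hφ : ∀ g, ¬ IsInMatDetOne g → φ g = 0)
    {x : PGL(2, F)} (hx : x ∉ detOneSet F) : pushforward ν φ x = 0 := by
  obtain ⟨g, rfl⟩ := ProjGenLinGroup.mk_surjective x
  rw [pushforward_mk]
  refine integral_eq_zero_of_ae (Filter.Eventually.of_forall fun z => hφ _ fun h => hx ?_)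
  exact ⟨_, h, mk_scalar_mul z g⟩

lemma isInMatDetOne_scalar_mul_iff {g : GL (Fin 2) F} (hg : IsInMatDetOne g) (z : Fˣ) :
    IsInMatDetOne (GeneralLinearGroup.scalar (Fin 2) z * g) ↔ ord (z : F) = 0 := by
  constructor
  · intro h
    have h1 := h.2
    rw [ord_det_scalar_mul, hg.2] at h1
    omega
  · intro h
    exact isInMatDetOne_mul_left (isIntegralGL_scalar h) hg

lemma pushforward_mk_of_invariant (hν : ν {a : Fˣ | ord (a : F) = 0} = 1)
    {φ : GL (Fin 2) F → ℂ} (hφ : ∀ g, ¬ IsInMatDetOne g → φ g = 0)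
    (hinv : ∀ (z : Fˣ) (g : GL (Fin 2) F), ord (z : F) = 0 → IsInMatDetOne g →
      φ (GeneralLinearGroup.scalar (Fin 2) z * g) = φ g)
    {g : GL (Fin 2) F} (hg : IsInMatDetOne g) :
    pushforward ν φ (ProjGenLinGroup.mk g) = φ g := by
  classical
  have h1 : (fun z : Fˣ => φ (GeneralLinearGroup.scalar (Fin 2) z * g)) =
      {a : Fˣ | ord (a : F) = 0}.indicator fun _ => φ g := by
    funext z
    by_cases hz : ord (z : F) = 0
    · rw [hinv z g hz hg, Set.indicator_of_mem (by exact hz)]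
    · rw [hφ _ ((isInMatDetOne_scalar_mul_iff hg z).not.2 hz), Set.indicator_of_notMem (by exact hz)]
  rw [pushforward_mk, h1, integral_indicator_const _ (isOpen_ord_eq 0).measurableSet, Measure.real,
    hν]
  simp

lemma fSquareTilde_eq_zero (g : GL (Fin 2) F) (hg : ¬ IsInMatDetOne g) : fSquareTilde g = 0 := by
  rw [fSquareTilde, if_neg hg]

lemma fColTilde_eq_zero (g : GL (Fin 2) F) (hg : ¬ IsInMatDetOne g) : fColTilde g = 0 := by
  rw [fColTilde, if_neg hg]

lemma hSquareTilde_eq_zero (g : GL (Fin 2) F) (hg : ¬ IsInMatDetOne g) : hSquareTilde g = 0 := by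
  rw [hSquareTilde, if_neg hg]

lemma fSquare_mk (hν : ν {a : Fˣ | ord (a : F) = 0} = 1) {g : GL (Fin 2) F}
    (hg : IsInMatDetOne g) : fSquare ν (ProjGenLinGroup.mk g) = fSquareTilde g :=
  pushforward_mk_of_invariant hν fSquareTilde_eq_zero
    (fun _ _ hz hg => fSquareTilde_mul_left (isIntegralGL_scalar hz) hg) hg

/-- The function on `PGL₂(F)` obtained from `fColTilde`. -/
noncomputable def fCol (ν : Measure Fˣ) : PGL(2, F) → ℂ := pushforward ν fColTilde

lemma fCol_mk (hν : ν {a : Fˣ | ord (a : F) = 0} = 1) {g : GL (Fin 2) F}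
    (hg : IsInMatDetOne g) : fCol ν (ProjGenLinGroup.mk g) = fColTilde g :=
  pushforward_mk_of_invariant hν fColTilde_eq_zero
    (fun _ _ hz hg => fColTilde_scalar_mul hz hg) hg

lemma fSquare_eq_zero {x : PGL(2, F)} (hx : x ∉ detOneSet F) : fSquare ν x = 0 :=
  pushforward_eq_zero fSquareTilde_eq_zero hx

lemma fCol_eq_zero {x : PGL(2, F)} (hx : x ∉ detOneSet F) : fCol ν x = 0 :=
  pushforward_eq_zero fColTilde_eq_zero hx

lemma fSquare_mul_left (hν : ν {a : Fˣ | ord (a : F) = 0} = 1) {k : PGL(2, F)}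
    (hk : k ∈ maxCompact F) (x : PGL(2, F)) : fSquare ν (k * x) = fSquare ν x := by
  by_cases hx : x ∈ detOneSet F
  · obtain ⟨k, hk', rfl⟩ := exists_of_mem_maxCompact hk
    obtain ⟨g, hg, rfl⟩ := hx
    rw [← map_mul, fSquare_mk hν hg, fSquare_mk hν (isInMatDetOne_mul_left hk' hg),
      fSquareTilde_mul_left hk' hg]
  · rw [fSquare_eq_zero hx, fSquare_eq_zero ((mul_mem_detOneSet_left_iff hk).not.2 hx)]

lemma fCol_mul_right (hν : ν {a : Fˣ | ord (a : F) = 0} = 1) {k : PGL(2, F)}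
    (hk : k ∈ maxCompact F) (x : PGL(2, F)) : fCol ν (x * k) = fCol ν x := by
  by_cases hx : x ∈ detOneSet F
  · obtain ⟨k, hk', rfl⟩ := exists_of_mem_maxCompact hk
    obtain ⟨g, hg, rfl⟩ := hx
    rw [← map_mul, fCol_mk hν hg, fCol_mk hν (isInMatDetOne_mul_right hk' hg),
      fColTilde_mul_right hk' hg]
  · rw [fCol_eq_zero hx, fCol_eq_zero ((mul_mem_detOneSet_right_iff hk).not.2 hx)]

lemma fCol_torus_mul (hν : ν {a : Fˣ | ord (a : F) = 0} = 1) {u : Fˣ} (hu : ord (u : F) = 0)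
    (x : PGL(2, F)) : fCol ν (torus u * x) = etaBar (red (u : F)) * fCol ν x := by
  by_cases hx : x ∈ detOneSet F
  · obtain ⟨g, hg, rfl⟩ := hx
    rw [torus, ← map_mul, fCol_mk hν hg,
      fCol_mk hν (isInMatDetOne_mul_left (isIntegralGL_tri hu) hg), fColTilde_tri_mul hu hg]
  · rw [fCol_eq_zero hx, fCol_eq_zero
      ((mul_mem_detOneSet_left_iff (torus_mem_maxCompact hu)).not.2 hx), mul_zero]

lemma fSquare_cosetRep_some (hν : ν {a : Fˣ | ord (a : F) = 0} = 1) {ϖ : Fˣ}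
    (hϖ : ord (ϖ : F) = 1) (u : 𝓀[F]) : fSquare ν (cosetRep ϖ (some u)) = etaBar u := by
  rw [cosetRep_some_eq, fSquare_mk hν (isInMatDetOne_tri hϖ _), fSquareTilde_tri hϖ]

lemma fSquare_cosetRep_none (hν : ν {a : Fˣ | ord (a : F) = 0} = 1) {ϖ : Fˣ}
    (hϖ : ord (ϖ : F) = 1) : fSquare ν (cosetRep (F := F) ϖ none) = 0 := by
  rw [cosetRep, torus, fSquare_mk hν (isInMatDetOne_tri' hϖ), fSquareTilde_tri' hϖ]

lemma isTestFun_fSquare (hν : ν {a : Fˣ | ord (a : F) = 0} = 1) :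
    IsTestFun (fSquare ν : PGL(2, F) → ℂ) := by
  obtain ⟨C, hC, hSC⟩ := exists_compact_detOneSet (F := F)
  exact ⟨isLocallyConstant_of_mul_left isOpen_maxCompact (one_mem _)
    fun g u hu => fSquare_mul_left hν hu g, C, hC, fun g hg => fSquare_eq_zero fun h => hg (hSC h)⟩

lemma isTestFun_fCol (hν : ν {a : Fˣ | ord (a : F) = 0} = 1) :
    IsTestFun (fCol ν : PGL(2, F) → ℂ) := by
  obtain ⟨C, hC, hSC⟩ := exists_compact_detOneSet (F := F)
  exact ⟨isLocallyConstant_of_mul_right isOpen_maxCompact (one_mem _)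
    fun g u hu => fCol_mul_right hν hu g, C, hC, fun g hg => fCol_eq_zero fun h => hg (hSC h)⟩

lemma integrable_unitChar (hν : ν {a : Fˣ | ord (a : F) = 0} = 1) :
    Integrable (unitChar : Fˣ → ℂ) ν := by
  have h1 : (unitChar : Fˣ → ℂ) = {a : Fˣ | ord (a : F) = 0}.indicator unitChar := by
    funext z
    by_cases hz : ord (z : F) = 0
    · rw [Set.indicator_of_mem (by exact hz)]
    · rw [Set.indicator_of_notMem (by exact hz), unitChar, if_neg hz]
  rw [h1, integrable_indicator_iff (isOpen_ord_eq 0).measurableSet]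
  refine Measure.integrableOn_of_bounded (M := 1) (by rw [hν]; simp)
    isLocallyConstant_unitChar.continuous.aestronglyMeasurable
    (Filter.Eventually.of_forall fun z => ?_)
  rw [unitChar]
  split_ifs
  · rcases etaBar_cases (red (z : F)) with h | h | h <;> simp [h]
  · simp

lemma integral_unitChar (hodd : ringChar 𝓀[F] ≠ 2) : ∫ z : Fˣ, unitChar z ∂ν = 0 := by
  obtain ⟨u, hu⟩ := exists_etaBar_eq_neg_one hodd
  refine integral_eq_zero_of_twist (liftUnit F u) fun a => ?_
  rw [unitChar_mul (ord_liftUnit u), red_liftUnit, hu, neg_one_mul]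

/-- The decomposition of the test function `h^□`. -/
theorem hSquare_eq (hodd : ringChar 𝓀[F] ≠ 2) (hν : ν {a : Fˣ | ord (a : F) = 0} = 1)
    (x : PGL(2, F)) :
    hSquare ν x = detOneInd x + fSquare ν x + fCol ν x * (1 + fSquare ν x) := by
  by_cases hx : x ∈ detOneSet F
  · rw [detOneInd, if_pos hx]
    obtain ⟨g, hg, rfl⟩ := hx
    obtain ⟨x, y, h⟩ := exists_red_eq_mul hg
    set A := (1 + fColTilde g) * (1 + fSquareTilde g) with hA
    -- On unit scalars the integrand is the even part `A` plus a multiple of `unitChar`, and the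
    -- latter integrates to zero.
    have h1 : (fun z : Fˣ => hSquareTilde (GeneralLinearGroup.scalar (Fin 2) z * g)) =
        fun z => {a : Fˣ | ord (a : F) = 0}.indicator (fun _ => A) z +
          unitChar z * (hSquareTilde g - A) := by
      funext z
      by_cases hz : ord (z : F) = 0
      · rw [hSquareTilde_scalar_mul hg h hz, Set.indicator_of_mem (by exact hz), unitChar,
          if_pos hz]
        ring
      · rw [hSquareTilde_eq_zero _ ((isInMatDetOne_scalar_mul_iff hg z).not.2 hz),
          Set.indicator_of_notMem (by exact hz), unitChar, if_neg hz]
        simp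
    rw [hSquare, pushforward_mk, h1, integral_add _ ((integrable_unitChar hν).mul_const _),
      integral_mul_const, integral_unitChar hodd,
      integral_indicator_const _ (isOpen_ord_eq 0).measurableSet, Measure.real, hν,
      fSquare_mk hν hg, fCol_mk hν hg]
    · simp only [ENNReal.toReal_one, one_smul, zero_mul, add_zero, hA]
      ring
    · rw [integrable_indicator_iff (isOpen_ord_eq 0).measurableSet]
      exact integrableOn_const (by rw [hν]; simp)
  · rw [hSquare, pushforward_eq_zero hSquareTilde_eq_zero hx, fSquare_eq_zero hx, fCol_eq_zero hx,
      detOneInd, if_neg hx]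
    simp

end Pushforward

end LocalSpherical

namespace LocalSpherical

/-! ### Quadratic extensions generated by a square root -/

section Quadratic

variable {F : Type*} [Field F] {L : Type*} [Field L] [Algebra F L]

/-- A quadratic extension in characteristic different from two is generated by a square root. -/
lemma exists_sq_eq_algebraMap (h2 : (2 : F) ≠ 0) (hL : Module.finrank F L = 2) :
    ∃ (s : L) (d : F), s ^ 2 = algebraMap F L d ∧ s ∉ Set.range (algebraMap F L) := by
  have hfin : FiniteDimensional F L := Module.finite_of_finrank_eq_succ hL
  obtain ⟨θ, hθ⟩ : ∃ θ : L, θ ∉ Set.range (algebraMap F L) := by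
    by_contra! h
    have h1 : Module.finrank F L = 1 :=
      finrank_eq_one_iff_of_nonzero' (1 : L) one_ne_zero |>.2 fun w => by
        obtain ⟨c, hc⟩ := h w
        exact ⟨c, by rw [Algebra.smul_def, hc, mul_one]⟩
    omega
  have hint : IsIntegral F θ := IsIntegral.of_finite F θ
  have hdeg : (minpoly F θ).natDegree = 2 := by
    have h1 : (minpoly F θ).natDegree ∣ 2 := hL ▸ minpoly.degree_dvd hint
    have h3 : (minpoly F θ).natDegree ≠ 1 := fun h => hθ (minpoly.natDegree_eq_one_iff.1 h)
    rcases (Nat.dvd_prime Nat.prime_two).1 h1 with h | h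
    · exact absurd h h3
    · exact h
  have heval := minpoly.aeval F θ
  have hmon := minpoly.monic hint
  rw [Polynomial.aeval_eq_sum_range, hdeg, Finset.sum_range_succ, Finset.sum_range_succ,
    Finset.sum_range_one, ← hdeg, Polynomial.Monic.coeff_natDegree hmon, hdeg, one_smul, pow_zero,
    pow_one, Algebra.smul_def, Algebra.smul_def, mul_one] at heval
  set b := (minpoly F θ).coeff 1
  set c := (minpoly F θ).coeff 0
  -- Completing the square in `θ² + b θ + c = 0`.
  refine ⟨θ + algebraMap F L (b / 2), b ^ 2 / 4 - c, ?_, ?_⟩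
  · have h4 : algebraMap F L (b / 2) * 2 = algebraMap F L b := by
      rw [← map_ofNat (algebraMap F L) 2, ← map_mul, div_mul_cancel₀ _ h2]
    have h5 : algebraMap F L (b ^ 2 / 4 - c) = algebraMap F L (b / 2) ^ 2 - algebraMap F L c := by
      rw [← map_pow, ← map_sub]
      congr 2
      rw [div_pow]
      norm_num
    rw [h5]
    linear_combination heval + θ * h4
  · rintro ⟨x, hx⟩
    exact hθ ⟨x - b / 2, by rw [map_sub, hx]; ring⟩

variable {s : L} {d : F} (hL : Module.finrank F L = 2) (hs : s ^ 2 = algebraMap F L d)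
  (hs' : s ∉ Set.range (algebraMap F L))

include hs' in
lemma linearIndependent_one_sqrt : LinearIndependent F ![(1 : L), s] := by
  rw [LinearIndependent.pair_iff]
  intro a b hab
  rw [Algebra.smul_def, Algebra.smul_def, mul_one] at hab
  have hb : b = 0 := by
    by_contra hb
    have hb' : algebraMap F L b ≠ 0 := by simpa using hb
    refine hs' ⟨-a / b, ?_⟩
    rw [map_div₀, map_neg, div_eq_iff hb']
    linear_combination -hab
  subst hb
  simpa using hab

include hL hs hs' in
lemma exists_basis_norm_trace : (∀ x : L, ∃ a b : F, x = algebraMap F L a + algebraMap F L b * s) ∧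
    ∀ a b : F, Algebra.norm F (algebraMap F L a + algebraMap F L b * s) = a ^ 2 - d * b ^ 2 ∧
      Algebra.trace F L (algebraMap F L a + algebraMap F L b * s) = 2 * a := by
  set B := basisOfLinearIndependentOfCardEqFinrank (linearIndependent_one_sqrt hs')
    (by rw [hL]; simp) with hB
  have hB0 : B 0 = 1 := by simp [hB]
  have hB1 : B 1 = s := by simp [hB]
  have hrepr : ∀ a b : F, B.repr (algebraMap F L a + algebraMap F L b * s) =
      Finsupp.single 0 a + Finsupp.single 1 b := by
    intro a b
    rw [← B.repr.apply_symm_apply (Finsupp.single 0 a + Finsupp.single 1 b)]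
    congr 1
    rw [map_add, Module.Basis.repr_symm_single, Module.Basis.repr_symm_single, hB0, hB1,
      Algebra.smul_def, Algebra.smul_def, mul_one]
  refine ⟨fun x => ⟨B.repr x 0, B.repr x 1, ?_⟩, fun a b => ?_⟩
  · conv_lhs => rw [← B.sum_repr x]
    rw [Fin.sum_univ_two, hB0, hB1, Algebra.smul_def, Algebra.smul_def, mul_one]
  · have hM : Algebra.leftMulMatrix B (algebraMap F L a + algebraMap F L b * s) =
        !![a, d * b; b, a] := by
      have e1 : (algebraMap F L a + algebraMap F L b * s) * 1 =
        algebraMap F L a + algebraMap F L b * s := mul_one _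
      have e2 : (algebraMap F L a + algebraMap F L b * s) * s =
          algebraMap F L (d * b) + algebraMap F L a * s := by
        rw [map_mul, ← hs]
        ring
      ext i j
      rw [Algebra.leftMulMatrix_eq_repr_mul]
      fin_cases j
      · change B.repr (_ * B 0) i = _
        rw [hB0, e1, hrepr]
        fin_cases i <;> simp
      · change B.repr (_ * B 1) i = _
        rw [hB1, e2, hrepr]
        fin_cases i <;> simp
    rw [Algebra.norm_eq_matrix_det B, Algebra.trace_eq_matrix_trace B, hM]
    simp [Matrix.det_fin_two, Matrix.trace_fin_two]
    constructor <;> ring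

end Quadratic

/-! ### Norms from a ramified quadratic extension and the character `η` -/

section Eta

variable {F : Type*} [Field F] [ValuativeRel F] [TopologicalSpace F] [IsNonarchimedeanLocalField F]
  {L : Type*} [Field L] [Algebra F L]

lemma red_two_ne_zero (hodd : ringChar 𝓀[F] ≠ 2) : red (2 : F) ≠ 0 := by
  have h2 : (2 : F) = 1 + 1 := by norm_num
  rw [h2, red_add (one_mem _) (one_mem _), red_one, one_add_one_eq_two]
  exact Ring.two_ne_zero hodd

lemma two_mem_integer : (2 : F) ∈ 𝒪[F] := ofNat_mem _ 2

-- Hensel's lemma for `X² - v`, whose derivative at `a₀` is the unit `2 a₀`.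
open IsLocalRing in
lemma exists_sq_eq_of_residue {R : Type*} [CommRing R] [IsLocalRing R]
    [HenselianRing R (maximalIdeal R)] {v a₀ : R} (h : residue R a₀ ^ 2 = residue R v)
    (h2 : residue R (2 * a₀) ≠ 0) : ∃ a, a ^ 2 = v := by
  have h1 : Polynomial.eval a₀ (Polynomial.X ^ 2 - Polynomial.C v) ∈ maximalIdeal R := by
    rw [← residue_eq_zero_iff]
    simp [h]
  have h3 : Polynomial.eval a₀ (Polynomial.derivative (Polynomial.X ^ 2 - Polynomial.C v)) =
      2 * a₀ := by
    simp [one_add_one_eq_two]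
  obtain ⟨a, ha, -⟩ := HenselianRing.is_henselian (I := maximalIdeal R)
    (Polynomial.X ^ 2 - Polynomial.C v) (Polynomial.monic_X_pow_sub_C _ two_ne_zero) a₀ h1
    (by rw [h3]; exact h2.isUnit)
  refine ⟨a, sub_eq_zero.1 ?_⟩
  simpa [Polynomial.IsRoot] using ha

lemma exists_sq_eq_of_isSquare_red (hodd : ringChar 𝓀[F] ≠ 2) {v : Fˣ} (hv : ord (v : F) = 0)
    (hsq : IsSquare (red (v : F))) : ∃ x : F, x ^ 2 = v := by
  let := IsTopologicalAddGroup.rightUniformSpace F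
  have := isUniformAddGroup_of_addCommGroup (G := F)
  have hvm := units_mem_of_ord_eq_zero hv
  obtain ⟨r, hr⟩ := hsq
  have hr0 : r ≠ 0 := by
    rintro rfl
    rw [mul_zero] at hr
    exact (red_units_ne_zero_iff v hvm).2 hv hr
  have ha₀ : IsLocalRing.residue 𝒪[F] (lift F r) = r := by rw [← red_coe]; exact red_lift r
  obtain ⟨a, ha⟩ := exists_sq_eq_of_residue (v := (⟨v, hvm⟩ : 𝒪[F])) (a₀ := lift F r)
    (by rw [ha₀, ← red_of_mem hvm, hr, sq])
    (by rw [map_mul, ha₀, map_ofNat]; exact mul_ne_zero (Ring.two_ne_zero hodd) hr0)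
  exact ⟨a, congrArg Subtype.val ha⟩

/-- The extension generated by the square root of a unit is unramified. -/
lemma not_isRamifiedExtension_of_unit (hodd : ringChar 𝓀[F] ≠ 2) (hL : Module.finrank F L = 2)
    {s : L} {d : Fˣ} (hd : ord (d : F) = 0) (hs : s ^ 2 = algebraMap F L d)
    (hs' : s ∉ Set.range (algebraMap F L)) : ¬ IsRamifiedExtension F L := by
  rw [IsRamifiedExtension, not_not, Algebra.formallyUnramified_iff]
  have hfin : FiniteDimensional F L := Module.finite_of_finrank_eq_succ hL
  obtain ⟨hspan, hnt⟩ := exists_basis_norm_trace hL hs hs'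
  have hdm := units_mem_of_ord_eq_zero hd
  have h2 : (2 : F) ≠ 0 := by
    intro h
    have := red_two_ne_zero hodd
    rw [h, red_zero] at this
    exact this rfl
  have hsint : IsIntegral 𝒪[F] s := by
    refine ⟨Polynomial.X ^ 2 - Polynomial.C ⟨(d : F), hdm⟩,
      Polynomial.monic_X_pow_sub_C _ two_ne_zero, ?_⟩
    simp only [Polynomial.eval₂_sub, Polynomial.eval₂_X_pow, Polynomial.eval₂_C, hs]
    exact sub_self _
  have hinv : ((2 * d : F))⁻¹ ∈ 𝒪[F] := by
    have h3 : red (2 * d : F) ≠ 0 := by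
      rw [red_mul two_mem_integer hdm]
      exact mul_ne_zero (red_two_ne_zero hodd) ((red_units_ne_zero_iff d hdm).2 hd)
    have h4 := (red_ne_zero_iff (mul_mem two_mem_integer hdm)).1 h3
    have h5 := ord_inv_units (Units.mk0 _ h4.1)
    simp only [Units.val_inv_eq_inv_val, Units.val_mk0] at h5
    rw [mem_integer_iff_ord (inv_ne_zero h4.1)]
    omega
  -- The trace of an integral element is integral over `𝒪`, which is integrally closed.
  have hint : ∀ x : L, IsIntegral 𝒪[F] x → Algebra.trace F L x ∈ 𝒪[F] := fun x hx =>
    (Valuation.integer.integers (valuation F)).mem_of_integral (Algebra.isIntegral_trace hx)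
  have half : ∀ a : F, 2 * d * a ∈ 𝒪[F] → a ∈ 𝒪[F] := by
    intro a ha
    have := mul_mem hinv ha
    rwa [inv_mul_cancel_left₀ (mul_ne_zero h2 d.ne_zero)] at this
  set A := integralClosure 𝒪[F] L
  set s' : A := ⟨s, hsint⟩ with hs'def
  have hss : s' * s' = algebraMap 𝒪[F] A ⟨(d : F), hdm⟩ := by
    apply Subtype.ext
    change s * s = algebraMap F L d
    rw [← hs, sq]
  -- Differentiating `s² = d` gives `2 s ds = 0`, and `2 s` is a unit with inverse `(2 d)⁻¹ s`.
  have hDs : KaehlerDifferential.D 𝒪[F] A s' = 0 := by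
    have h3 := congrArg (KaehlerDifferential.D 𝒪[F] A) hss
    rw [Derivation.map_algebraMap, Derivation.leibniz, ← add_smul] at h3
    have h4 : (algebraMap 𝒪[F] A ⟨_, hinv⟩ * s') * (s' + s') = 1 := by
      apply Subtype.ext
      change algebraMap F L ((2 * d : F))⁻¹ * s * (s + s) = 1
      have h5 : s * (s + s) = algebraMap F L (2 * d) := by
        rw [map_mul, ← hs, map_ofNat]
        ring
      rw [mul_assoc, h5, ← map_mul, inv_mul_cancel₀ (mul_ne_zero h2 d.ne_zero), map_one]
    rw [← one_smul A (KaehlerDifferential.D 𝒪[F] A s'), ← h4, mul_smul, h3]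
    exact smul_zero (M := A) (A := Ω[A⁄𝒪[F]]) _
  -- The traces of `x` and `x * s` are `2 a` and `2 d b`. As `2` and `d` are units, integral
  -- elements have integral coordinates, so every differential is a multiple of `ds = 0`.
  have hD : ∀ x : A, KaehlerDifferential.D 𝒪[F] A x = 0 := by
    rintro ⟨x, hx⟩
    obtain ⟨a, b, rfl⟩ := hspan x
    have ha : a ∈ 𝒪[F] := by
      have h3 := hint _ hx
      rw [(hnt a b).2] at h3
      refine half a ?_
      have := mul_mem hdm h3
      convert this using 1
      ring
    have hb : b ∈ 𝒪[F] := by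
      have h3 := hint _ (hx.mul hsint)
      have h4 : (algebraMap F L a + algebraMap F L b * s) * s =
          algebraMap F L (d * b) + algebraMap F L a * s := by
        rw [map_mul, ← hs]
        ring
      rw [h4, (hnt _ _).2, ← mul_assoc] at h3
      exact half b h3
    have hx' : (⟨algebraMap F L a + algebraMap F L b * s, hx⟩ : A) =
        algebraMap 𝒪[F] A ⟨a, ha⟩ + algebraMap 𝒪[F] A ⟨b, hb⟩ * s' := rfl
    rw [hx', map_add, Derivation.leibniz, Derivation.map_algebraMap, Derivation.map_algebraMap,
      hDs]
    simp
  have htop := KaehlerDifferential.span_range_derivation 𝒪[F] A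
  have hbot : Submodule.span A (Set.range (KaehlerDifferential.D 𝒪[F] A)) = ⊥ := by
    rw [Submodule.span_eq_bot]
    rintro _ ⟨x, rfl⟩
    exact hD x
  have hz : ∀ x : Ω[A⁄𝒪[F]], x = 0 := fun x => by
    have hx : x ∈ (⊤ : Submodule A Ω[A⁄𝒪[F]]) := Submodule.mem_top
    rwa [← htop, hbot, Submodule.mem_bot] at hx
  exact ⟨fun x y => (hz x).trans (hz y).symm⟩

/-- A ramified quadratic extension is generated by the square root of a uniformizer. -/
lemma exists_sq_eq_uniformizer (hodd : ringChar 𝓀[F] ≠ 2) (hL : Module.finrank F L = 2)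
    (hram : IsRamifiedExtension F L) : ∃ (s : L) (d : Fˣ), ord (d : F) = 1 ∧
      s ^ 2 = algebraMap F L d ∧ s ∉ Set.range (algebraMap F L) := by
  have h2 : (2 : F) ≠ 0 := by
    intro h
    have := red_two_ne_zero hodd
    rw [h, red_zero] at this
    exact this rfl
  obtain ⟨s, d, hs, hs'⟩ := exists_sq_eq_algebraMap h2 hL
  have hd0 : d ≠ 0 := by
    rintro rfl
    rw [map_zero, sq_eq_zero_iff] at hs
    exact hs' ⟨0, by rw [hs, map_zero]⟩
  lift d to Fˣ using hd0.isUnit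
  -- Integer division rounds down, so `c² d` has valuation `0` or `1`; valuation `0` is excluded by
  -- ramification.
  obtain ⟨c, hc⟩ := exists_ord_eq (F := F) (-(ord (d : F) / 2))
  have hcs : (algebraMap F L c * s) ^ 2 = algebraMap F L ((c ^ 2 * d : Fˣ) : F) := by
    rw [mul_pow, hs]
    simp
  have hcs' : algebraMap F L c * s ∉ Set.range (algebraMap F L) := by
    rintro ⟨x, hx⟩
    have hc0 : algebraMap F L c ≠ 0 := by simp
    refine hs' ⟨x / c, ?_⟩
    rw [map_div₀, hx, mul_div_cancel_left₀ _ hc0]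
  have hord : ord ((c ^ 2 * d : Fˣ) : F) = ord (d : F) % 2 := by
    rw [ord_mul_units, ord_pow_units, hc]
    push_cast
    omega
  rcases Int.emod_two_eq_zero_or_one (ord (d : F)) with h | h
  · exact absurd hram (not_isRamifiedExtension_of_unit hodd hL (hord.trans h) hcs hcs')
  · exact ⟨_, _, hord.trans h, hcs, hcs'⟩

/-- The norm form is `x² - d y²` with `d` a uniformizer. Its two terms have valuations of opposite
parity and cannot cancel, so a unit norm has `x`, `y` integral and reduces to a square. The converse
is Hensel's lemma, and `-d` is the norm of the square root of `d`. -/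
lemma eta_norm_facts (hodd : ringChar 𝓀[F] ≠ 2) (hL : Module.finrank F L = 2)
    (hram : IsRamifiedExtension F L) :
    (∀ v : Fˣ, ord (v : F) = 0 →
      ((∃ y : L, Algebra.norm F y = (v : F)) ↔ IsSquare (red (v : F)))) ∧
    ∃ p : Fˣ, ord (p : F) = 1 ∧ ∃ y : L, Algebra.norm F y = (p : F) := by
  obtain ⟨s, d, hd, hs, hs'⟩ := exists_sq_eq_uniformizer hodd hL hram
  obtain ⟨hspan, hnt⟩ := exists_basis_norm_trace hL hs hs'
  refine ⟨fun v hv => ⟨?_, fun h => ?_⟩, -d, by rw [Units.val_neg, ord_neg, hd], s, ?_⟩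
  · rintro ⟨z, hz⟩
    obtain ⟨x, y, rfl⟩ := hspan z
    rw [(hnt x y).1] at hz
    have hdm : (d : F) ∈ 𝒪[F] := (units_mem_integer_iff _).2 (by omega)
    have key : x ∈ 𝒪[F] ∧ y ∈ 𝒪[F] := by
      rcases eq_or_ne x 0 with rfl | hx
      · exfalso
        rcases eq_or_ne y 0 with rfl | hy
        · exact v.ne_zero (by rw [← hz]; ring)
        · lift y to Fˣ using hy.isUnit
          have : ((-d * y ^ 2 : Fˣ) : F) = v := by
            rw [← hz]
            push_cast
            ring
          rw [← this, ord_mul_units, ord_pow_units, Units.val_neg, ord_neg] at hv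
          push_cast at hv
          omega
      · rcases eq_or_ne y 0 with rfl | hy
        · lift x to Fˣ using hx.isUnit
          have : ((x ^ 2 : Fˣ) : F) = v := by
            rw [← hz]
            push_cast
            ring
          rw [← this, ord_pow_units] at hv
          push_cast at hv
          exact ⟨(units_mem_integer_iff _).2 (by omega), zero_mem _⟩
        · lift x to Fˣ using hx.isUnit
          lift y to Fˣ using hy.isUnit
          rw [units_mem_integer_iff, units_mem_integer_iff]
          by_contra hcon
          -- Factoring out the term of smaller valuation leaves a unit, so that term alone must have
          -- valuation zero. Equality is impossible by parity.
          rcases lt_trichotomy (2 * ord (x : F)) (1 + 2 * ord (y : F)) with h | h | h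
          · have h1 : ord ((-d * y ^ 2 * (x ^ 2)⁻¹ : Fˣ) : F) = 1 + 2 * ord (y : F) - 2 * ord (x : F) := by
              rw [ord_mul_units, ord_inv_units, ord_mul_units, ord_pow_units, ord_pow_units,
                Units.val_neg, ord_neg, hd]
              push_cast
              ring
            have h2 := (ord_one_add ((units_mem_integer_iff _).2 (by rw [h1]; omega))
              (red_eq_zero_of_ord_pos (a := ((-d * y ^ 2 * (x ^ 2)⁻¹ : Fˣ) : F)) (by rw [h1]; omega)))
            have h3 : (v : F) = (x ^ 2 : Fˣ) * (1 + ((-d * y ^ 2 * (x ^ 2)⁻¹ : Fˣ) : F)) := by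
              rw [← hz]
              push_cast
              field_simp
              ring
            rw [h3, ord_mul (by simp) h2.1, ord_pow_units, h2.2] at hv
            push_cast at hv
            omega
          · omega
          · have h1 : ord ((-d⁻¹ * (y ^ 2)⁻¹ * x ^ 2 : Fˣ) : F) = 2 * ord (x : F) - (1 + 2 * ord (y : F)) := by
              rw [ord_mul_units, ord_mul_units, ord_inv_units, ord_pow_units, ord_pow_units,
                Units.val_neg, ord_neg, ord_inv_units, hd]
              push_cast
              ring
            have h2 := (ord_one_add ((units_mem_integer_iff _).2 (by rw [h1]; omega))
              (red_eq_zero_of_ord_pos (a := ((-d⁻¹ * (y ^ 2)⁻¹ * x ^ 2 : Fˣ) : F)) (by rw [h1]; omega)))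
            have h3 : (v : F) = (-d * y ^ 2 : Fˣ) * (1 + ((-d⁻¹ * (y ^ 2)⁻¹ * x ^ 2 : Fˣ) : F)) := by
              rw [← hz]
              push_cast
              field_simp
              ring
            rw [h3, ord_mul (by simp) h2.1, ord_mul_units, ord_pow_units,
              h2.2, Units.val_neg, ord_neg, hd] at hv
            push_cast at hv
            omega
    refine ⟨red x, ?_⟩
    rw [← hz, sq, sq, red_sub (mul_mem key.1 key.1) (mul_mem hdm (mul_mem key.2 key.2)),
      red_mul hdm (mul_mem key.2 key.2), red_mul key.1 key.1,
      red_eq_zero_of_ord_pos (a := (d : F)) (by omega)]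
    ring
  · obtain ⟨x, hx⟩ := exists_sq_eq_of_isSquare_red hodd hv h
    refine ⟨algebraMap F L x + algebraMap F L 0 * s, ?_⟩
    rw [(hnt x 0).1, hx]
    ring
  · have := (hnt 0 1).1
    simpa using this

/-- Powers of a uniformizer `p` that is a norm do not affect being a norm, so only the unit part
matters. -/
lemma exists_eta_eq_etaBar (hodd : ringChar 𝓀[F] ≠ 2) (hL : Module.finrank F L = 2)
    (hram : IsRamifiedExtension F L) : ∃ p : Fˣ, ord (p : F) = 1 ∧
      ∀ a : Fˣ, eta F L a = etaBar (red ((a * (p ^ ord (a : F))⁻¹ : Fˣ) : F)) := by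
  obtain ⟨h1, p, hp, y, hy⟩ := eta_norm_facts hodd hL hram
  have hy0 : y ≠ 0 := by
    rintro rfl
    have hfin : FiniteDimensional F L := Module.finite_of_finrank_eq_succ hL
    rw [Algebra.norm_zero] at hy
    exact p.ne_zero hy.symm
  lift y to Lˣ using hy0.isUnit
  have hp0 : Units.map (Algebra.norm F) y = p := Units.ext hy
  have hp1 : ∀ n : ℤ, ∃ z : L, Algebra.norm F z = ((p ^ n : Fˣ) : F) := fun n =>
    ⟨(y ^ n : Lˣ), by rw [← hp0, ← map_zpow]; rfl⟩
  refine ⟨p, hp, fun a => ?_⟩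
  have hu : ord ((a * (p ^ ord (a : F))⁻¹ : Fˣ) : F) = 0 := by
    rw [ord_mul_units, ord_inv_units, ord_zpow_units, hp]
    ring
  set u := a * (p ^ ord (a : F))⁻¹ with hudef
  have h0 := (red_units_ne_zero_iff u (units_mem_of_ord_eq_zero hu)).2 hu
  have hiff : (∃ z : L, Algebra.norm F z = (a : F)) ↔ IsSquare (red (u : F)) := by
    rw [← h1 u hu]
    constructor
    · rintro ⟨z, hz⟩
      obtain ⟨t, ht⟩ := hp1 (-ord (a : F))
      exact ⟨z * t, by rw [map_mul, hz, ht, hudef, zpow_neg, Units.val_mul]⟩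
    · rintro ⟨z, hz⟩
      obtain ⟨t, ht⟩ := hp1 (ord (a : F))
      exact ⟨z * t, by rw [map_mul, hz, ht, ← Units.val_mul, hudef, inv_mul_cancel_right]⟩
  rw [eta, etaBar, if_neg h0]
  by_cases h : IsSquare (red (u : F))
  · rw [if_pos h, if_pos (hiff.2 h)]
  · rw [if_neg h, if_neg (mt hiff.1 h)]

/-- That the norm group has index at most two is not used: multiplicativity is read off from the
explicit formula in terms of `η̄`. -/
lemma eta_mul (hodd : ringChar 𝓀[F] ≠ 2) (hL : Module.finrank F L = 2)
    (hram : IsRamifiedExtension F L) (a b : Fˣ) : eta F L (a * b) = eta F L a * eta F L b := by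
  obtain ⟨p, hp, h⟩ := exists_eta_eq_etaBar hodd hL hram
  have hu : ∀ a : Fˣ, ord ((a * (p ^ ord (a : F))⁻¹ : Fˣ) : F) = 0 := fun a => by
    rw [ord_mul_units, ord_inv_units, ord_zpow_units, hp]
    ring
  rw [h, h a, h b, ← etaBar_mul, ← red_mul (units_mem_of_ord_eq_zero (hu a))
    (units_mem_of_ord_eq_zero (hu b)), ← Units.val_mul, ord_mul_units, zpow_add]
  congr 3
  rw [_root_.mul_inv, mul_mul_mul_comm]

lemma eta_eq (hodd : ringChar 𝓀[F] ≠ 2) (hL : Module.finrank F L = 2)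
    (hram : IsRamifiedExtension F L) {u : Fˣ} (hu : ord (u : F) = 0) :
    eta F L u = etaBar (red (u : F)) := by
  obtain ⟨p, hp, h⟩ := exists_eta_eq_etaBar hodd hL hram
  rw [h, hu, zpow_zero, inv_one, mul_one]

lemma eta_mul_unit (hodd : ringChar 𝓀[F] ≠ 2) (hL : Module.finrank F L = 2)
    (hram : IsRamifiedExtension F L) (a : Fˣ) {u : Fˣ} (hu : ord (u : F) = 0) :
    eta F L (a * u) = eta F L a * etaBar (red (u : F)) := by
  rw [eta_mul hodd hL hram, eta_eq hodd hL hram hu]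

lemma eta_eq_or (a : Fˣ) : eta F L a = 1 ∨ eta F L a = -1 := by
  rw [eta]
  split_ifs <;> simp

end Eta

end LocalSpherical

namespace LocalSpherical

/-! ### Second-order recurrences and their generating functions -/

section Recurrence

/-- A complex number `α` such that `α + α⁻¹` is real and smaller than `r + r⁻¹` lies in the annulus
of radii `r⁻¹` and `r`. -/
lemma norm_lt_of_add_inv {α : ℂ} (hα : α ≠ 0) {r : ℝ} (hr : 1 < r)
    (hreal : starRingEnd ℂ (α + α⁻¹) = α + α⁻¹) (h : ‖α + α⁻¹‖ < r + r⁻¹) :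
    ‖α‖ < r ∧ ‖α⁻¹‖ < r := by
  have hr0 : 0 < r := by linarith
  have hconj : starRingEnd ℂ α ≠ 0 := by simpa using hα
  -- Reality of `α + α⁻¹` means that `α` is real or lies on the unit circle.
  have key : (starRingEnd ℂ α - α) * (α * starRingEnd ℂ α - 1) = 0 := by
    rw [map_add, map_inv₀] at hreal
    field_simp at hreal
    linear_combination hreal
  have hpos : 0 < ‖α‖ := norm_pos_iff.2 hα
  rcases mul_eq_zero.1 key with h1 | h1
  · obtain ⟨a, rfl⟩ := Complex.conj_eq_iff_real.1 (sub_eq_zero.1 h1)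
    have ha : a ≠ 0 := by simpa using hα
    rw [← Complex.ofReal_inv, ← Complex.ofReal_add, Complex.norm_real, Real.norm_eq_abs] at h
    rw [← Complex.ofReal_inv, Complex.norm_real, Complex.norm_real, Real.norm_eq_abs,
      Real.norm_eq_abs, abs_inv]
    have h2 : |a + a⁻¹| = |a| + |a|⁻¹ := by
      rcases lt_or_gt_of_ne ha with h3 | h3
      · rw [abs_of_neg h3, abs_of_neg (add_neg h3 (inv_lt_zero.2 h3)), inv_neg]
        ring
      · rw [abs_of_pos h3, abs_of_pos (by positivity)]
    rw [h2] at h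
    set t := |a|
    have ht : 0 < t := abs_pos.2 ha
    -- Clearing denominators in `t + t⁻¹ < r + r⁻¹`; the signs then give `r⁻¹ < t < r`.
    have h3 : (t * r - 1) * (t - r) < 0 := by
      have h4 : (t + t⁻¹) * (t * r) < (r + r⁻¹) * (t * r) :=
        mul_lt_mul_of_pos_right h (by positivity)
      have h5 : (t + t⁻¹) * (t * r) = t ^ 2 * r + r := by field_simp
      have h6 : (r + r⁻¹) * (t * r) = r ^ 2 * t + t := by field_simp
      nlinarith
    have h7 : t < r := by
      by_contra! h8
      have : 0 ≤ t * r - 1 := by nlinarith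
      nlinarith [mul_nonneg this (sub_nonneg.2 h8)]
    refine ⟨h7, ?_⟩
    have h9 : 0 < t * r - 1 := by
      by_contra! h10
      nlinarith [mul_nonneg (neg_nonneg.2 h10) (neg_nonneg.2 (sub_nonpos.2 h7.le))]
    rw [inv_lt_comm₀ ht hr0, inv_lt_iff_one_lt_mul₀ hr0]
    linarith
  · have h2 : ‖α‖ = 1 := by
      rw [Complex.mul_conj, sub_eq_zero] at h1
      have h3 : Complex.normSq α = 1 := by exact_mod_cast h1
      rw [Complex.normSq_eq_norm_sq] at h3
      exact (pow_eq_one_iff_of_nonneg (norm_nonneg _) two_ne_zero).1 h3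
    rw [norm_inv, h2]
    simp [hr]

variable {x : ℕ → ℂ} {m α : ℂ} {M : ℝ} (h0 : x 0 = 1) (h1 : x 1 = m)
  (h2 : ∀ n, x (n + 2) = m * x (n + 1) - x n)

-- The solution is the sum of `α ^ (n - 2 k)` for `0 ≤ k ≤ n`, with each term of norm at most `M ^
-- n`. The first-order form `hstep` avoids dividing by `α - α⁻¹`, so `α = ±1` needs no separate
-- case.
include h0 h1 h2 in
lemma recurrence_norm_le (hα : α ≠ 0) (hm : m = α + α⁻¹) (hM : ‖α‖ ≤ M) (hM' : ‖α⁻¹‖ ≤ M) (n : ℕ) :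
    ‖x n‖ ≤ (n + 1) * M ^ n := by
  have hM0 : 0 ≤ M := (norm_nonneg _).trans hM
  have hstep : ∀ n, x (n + 1) = α * x n + α⁻¹ ^ (n + 1) := by
    intro n
    induction n with
    | zero => rw [h0, h1, hm]; simp
    | succ n ih =>
      have h3 : α⁻¹ * (α * x n) = x n := inv_mul_cancel_left₀ hα _
      rw [h2, hm]
      linear_combination α⁻¹ * ih + h3
  induction n with
  | zero => simp [h0]
  | succ n ih =>
    calc ‖x (n + 1)‖ ≤ ‖α‖ * ‖x n‖ + ‖α⁻¹‖ ^ (n + 1) := by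
          rw [hstep, ← norm_mul, ← norm_pow]
          exact norm_add_le _ _
      _ ≤ M * ((n + 1) * M ^ n) + M ^ (n + 1) := by gcongr
      _ = ((n + 1 : ℕ) + 1) * M ^ (n + 1) := by push_cast; ring

lemma summable_of_norm_le {y : ℕ → ℂ} {ρ : ℝ} (hρ : 0 ≤ ρ) (hρ' : ρ < 1)
    (h : ∀ n, ‖y n‖ ≤ (n + 1) ^ 2 * ρ ^ n) : Summable y := by
  refine Summable.of_norm_bounded (g := fun n : ℕ => ((n : ℝ) + 1) ^ 2 * ρ ^ n) ?_ h
  have hn : ‖ρ‖ < 1 := by rwa [Real.norm_of_nonneg hρ]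
  have h3 := ((summable_pow_mul_geometric_of_norm_lt_one 2 hn).add
    ((summable_pow_mul_geometric_of_norm_lt_one 1 hn).mul_left 2)).add
    (summable_pow_mul_geometric_of_norm_lt_one 0 hn)
  refine h3.congr fun n => ?_
  ring

lemma hasSum_of_forall_eq {f g : ℕ → ℂ} {a : ℂ} (hf : HasSum f a) (h : ∀ n, g n = f n) :
    HasSum g a := by
  rwa [funext h]

-- Summing the recurrence against powers of `Y` gives a linear equation for the generating function,
-- here the unramified Euler factor.
include h0 h1 h2 in
lemma recurrence_genFun (hα : α ≠ 0) (hm : m = α + α⁻¹) (hM : ‖α‖ ≤ M) (hM' : ‖α⁻¹‖ ≤ M) {Y : ℂ}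
    (hY : M * ‖Y‖ < 1) : Summable (fun n => x n * Y ^ n) ∧
      (∑' n, x n * Y ^ n) * ((1 - α * Y) * (1 - α⁻¹ * Y)) = 1 := by
  have hM0 : 0 ≤ M := (norm_nonneg _).trans hM
  have hs : Summable (fun n => x n * Y ^ n) := by
    refine summable_of_norm_le (ρ := M * ‖Y‖) (by positivity) hY fun n => ?_
    rw [norm_mul, norm_pow, mul_pow, ← mul_assoc]
    gcongr
    refine (recurrence_norm_le h0 h1 h2 hα hm hM hM' n).trans ?_
    gcongr
    nlinarith
  refine ⟨hs, ?_⟩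
  have hs1 : Summable (fun n => x (n + 1) * Y ^ (n + 1)) :=
    (summable_nat_add_iff (f := fun n => x n * Y ^ n) 1).2 hs
  have e1 := hs.tsum_eq_zero_add
  have e2 := hs1.tsum_eq_zero_add
  have e3 : ∑' n, x (n + 1 + 1) * Y ^ (n + 1 + 1) =
      m * Y * ∑' n, x (n + 1) * Y ^ (n + 1) - Y ^ 2 * ∑' n, x n * Y ^ n := by
    have h3 := ((hs1.hasSum.mul_left (m * Y)).sub
      (hs.hasSum.mul_left (Y ^ 2)))
    exact (hasSum_of_forall_eq h3 fun n => by rw [h2]; ring).tsum_eq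
  have hα' : α * α⁻¹ = 1 := mul_inv_cancel₀ hα
  rw [h0] at e1
  rw [zero_add, h1] at e2
  have e4 : ∑' n, x (n + 1) * Y ^ (n + 1) = (∑' n, x n * Y ^ n) - 1 := by
    rw [e1]
    ring
  rw [e4, e3, e4] at e2
  rw [hm] at e2
  linear_combination e2 + (∑' n, x n * Y ^ n) * Y ^ 2 * hα'

lemma summable_mul_succ_of_summable_sq {x : ℕ → ℂ} {X : ℂ} (hs : Summable fun n => x n ^ 2 * X ^ n) :
    Summable fun n => x (n + 1) * x n * X ^ n := by
  have hs1 : Summable (fun n => x (n + 1) ^ 2 * X ^ (n + 1)) :=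
    (summable_nat_add_iff (f := fun n => x n ^ 2 * X ^ n) 1).2 hs
  have hs' := hs.norm
  have hs1' := hs1.norm
  by_cases hX0 : X = 0
  · refine summable_of_ne_finset_zero (s := {0}) fun n hn => ?_
    rw [hX0, zero_pow (by simpa using hn), mul_zero]
  · refine Summable.of_norm_bounded (hs'.add (hs1'.mul_left ‖X‖⁻¹)) fun n => ?_
    simp only [norm_mul, norm_pow]
    have hX0' : ‖X‖ ≠ 0 := by simpa using hX0
    have e : ‖X‖⁻¹ * (‖x (n + 1)‖ ^ 2 * ‖X‖ ^ (n + 1)) = ‖x (n + 1)‖ ^ 2 * ‖X‖ ^ n := by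
      rw [pow_succ' ‖X‖, mul_left_comm, inv_mul_cancel_left₀ hX0']
    rw [e, ← add_mul]
    gcongr
    linarith [two_mul_le_add_sq (‖x (n + 1)‖) (‖x n‖), mul_nonneg (norm_nonneg (x (n + 1))) (norm_nonneg (x n))]

-- The unramified Rankin-Selberg computation: the recurrence yields two linear relations between the
-- sum `A` of squares and the sum `B` of products of neighbours, and eliminating `B` determines `A`.
include h0 h1 h2 in
lemma recurrence_sq_sum (hα : α ≠ 0) (hm : m = α + α⁻¹) (hM : ‖α‖ ≤ M) (hM' : ‖α⁻¹‖ ≤ M) {X : ℂ}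
    (hX : M ^ 2 * ‖X‖ < 1) : Summable (fun n => x n ^ 2 * X ^ n) ∧
      ((1 - X) ^ 2 * (1 - α ^ 2 * X) * (1 - α⁻¹ ^ 2 * X)) * ∑' n, x n ^ 2 * X ^ n = 1 - X ^ 2 := by
  have hM0 : 0 ≤ M := (norm_nonneg _).trans hM
  have hb := recurrence_norm_le h0 h1 h2 hα hm hM hM'
  have hs : Summable (fun n => x n ^ 2 * X ^ n) := by
    refine summable_of_norm_le (ρ := M ^ 2 * ‖X‖) (by positivity) hX fun n => ?_
    rw [norm_mul, norm_pow, norm_pow]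
    calc ‖x n‖ ^ 2 * ‖X‖ ^ n ≤ ((n + 1) * M ^ n) ^ 2 * ‖X‖ ^ n := by gcongr; exact hb n
      _ = _ := by ring
  have hs1 : Summable (fun n => x (n + 1) ^ 2 * X ^ (n + 1)) :=
    (summable_nat_add_iff (f := fun n => x n ^ 2 * X ^ n) 1).2 hs
  have hs2 := summable_mul_succ_of_summable_sq hs
  refine ⟨hs, ?_⟩
  set A := ∑' n, x n ^ 2 * X ^ n with hA
  set B := ∑' n, x (n + 1) * x n * X ^ n with hB
  have a1 : ∑' n, x (n + 1) ^ 2 * X ^ (n + 1) = A - 1 := by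
    rw [hA, hs.tsum_eq_zero_add, h0]
    ring
  have a2 : ∑' n, x (n + 1 + 1) ^ 2 * X ^ (n + 1 + 1) = A - 1 - m ^ 2 * X := by
    rw [← a1, hs1.tsum_eq_zero_add, zero_add, h1]
    ring
  have b1 : ∑' n, x (n + 1 + 1) * x (n + 1) * X ^ (n + 1) = B - m := by
    rw [hB, hs2.tsum_eq_zero_add, h0, zero_add, h1]
    ring
  have r1 : B - m = m * (A - 1) - X * B := by
    rw [← a1, ← b1]
    have h3 := ((hs1.hasSum.mul_left m).sub (hs2.hasSum.mul_left X))
    exact (hasSum_of_forall_eq h3 fun n => by rw [h2]; ring).tsum_eq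
  have r2 : A - 1 - m ^ 2 * X = m ^ 2 * X * (A - 1) - 2 * m * X ^ 2 * B + X ^ 2 * A := by
    rw [← a2, ← a1]
    have h3 := (((hs1.hasSum.mul_left (m ^ 2 * X)).sub
      (hs2.hasSum.mul_left (2 * m * X ^ 2))).add (hs.hasSum.mul_left (X ^ 2)))
    exact (hasSum_of_forall_eq h3 fun n => by rw [h2]; ring).tsum_eq
  clear hA hB
  clear_value A B
  have r3 : A * ((1 - X) * ((1 + X) ^ 2 - m ^ 2 * X)) = 1 + X := by
    linear_combination (1 + X) * r2 - 2 * m * X ^ 2 * r1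
  have hα' : α * α⁻¹ = 1 := mul_inv_cancel₀ hα
  have e1 : (1 - α ^ 2 * X) * (1 - α⁻¹ ^ 2 * X) = (1 + X) ^ 2 - m ^ 2 * X := by
    rw [hm]
    linear_combination (2 * X + X ^ 2 * (α * α⁻¹ + 1)) * hα'
  linear_combination (1 - X) * r3 + (1 - X) ^ 2 * A * e1

end Recurrence

end LocalSpherical

namespace LocalSpherical

/-! ### The Hecke operator and the line of spherical vectors -/

section Hecke

variable {F : Type*} [Field F] [ValuativeRel F] [TopologicalSpace F] [IsNonarchimedeanLocalField F]
  {V : Type*} [AddCommGroup V] [Module ℂ V] {π : Representation ℂ PGL(2, F) V}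

lemma rep_mul (g h : PGL(2, F)) (v : V) : π (g * h) v = π g (π h v) := by
  rw [map_mul]
  rfl

lemma rep_one (v : V) : π 1 v = v := by
  rw [map_one]
  rfl

lemma rep_mul_fixed {v : V} (hv : v ∈ fixedVectors π (maxCompact F)) (g : PGL(2, F))
    {k : PGL(2, F)} (hk : k ∈ maxCompact F) : π (g * k) v = π g v := by
  rw [rep_mul, hv k hk]

open Classical in
lemma heckeT_eq [Fintype 𝓀[F]] (ϖ : Fˣ) (v : V) :
    heckeT π ϖ v = ∑ u : 𝓀[F], π (unip (lift F u : F) * torus ϖ) v + π (torus ϖ⁻¹) v := by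
  rw [heckeT, finsum_eq_sum_of_fintype]
  simp only [mk_tri]
  simp

/-- The value of a linear map at `heckeT π ϖ v` if it takes a constant value on the `q` upper
triangular terms. -/
lemma map_heckeT_of_const {W : Type*} [AddCommGroup W] [Module ℂ W] (T : V →ₗ[ℂ] W) (ϖ : Fˣ) (v : V)
    {w : W} (h : ∀ u : 𝓀[F], T (π (unip (lift F u : F) * torus ϖ) v) = w) :
    T (heckeT π ϖ v) = (q F : ℂ) • w + T (π (torus ϖ⁻¹) v) := by
  have : Fintype 𝓀[F] := Fintype.ofFinite _
  rw [heckeT_eq, map_add, map_sum, Finset.sum_congr rfl fun u _ => h u, Finset.sum_const,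
    Finset.card_univ, q, Nat.card_eq_fintype_card, Nat.cast_smul_eq_nsmul]

lemma heckeT_add (ϖ : Fˣ) (v w : V) : heckeT π ϖ (v + w) = heckeT π ϖ v + heckeT π ϖ w := by
  have : Fintype 𝓀[F] := Fintype.ofFinite _
  simp only [heckeT_eq, map_add, Finset.sum_add_distrib]
  abel

lemma heckeT_smul (ϖ : Fˣ) (c : ℂ) (v : V) : heckeT π ϖ (c • v) = c • heckeT π ϖ v := by
  have : Fintype 𝓀[F] := Fintype.ofFinite _
  simp only [heckeT_eq, map_smul, Finset.smul_sum, smul_add]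

/-- The chosen lifts need not be odd in `u`; the discrepancy lies in `ϖ 𝒪`, which passes through
`torus ϖ` into `K`. -/
lemma lift_add_lift_neg {ϖ : Fˣ} (hϖ : ord (ϖ : F) = 1) (u : 𝓀[F]) :
    ∃ z ∈ 𝒪[F], (lift F u : F) = -(lift F (-u) : F) + ϖ * z := by
  have hm : (lift F u : F) + lift F (-u) ∈ 𝒪[F] := add_mem (lift F u).2 (lift F (-u)).2
  have hr : red ((lift F u : F) + lift F (-u)) = 0 := by
    rw [red_add (lift F u).2 (lift F (-u)).2, red_lift, red_lift, add_neg_cancel]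
  refine ⟨((lift F u : F) + lift F (-u)) / ϖ, div_mem_of_red_eq_zero hm hr hϖ, ?_⟩
  rw [mul_div_cancel₀ _ ϖ.ne_zero]
  ring

lemma heckeT_eq_sum_cosetRep [Fintype 𝓀[F]] {ϖ : Fˣ} (hϖ : ord (ϖ : F) = 1) {v : V}
    (hv : v ∈ fixedVectors π (maxCompact F)) :
    heckeT π ϖ v = ∑ i : Option 𝓀[F], π (cosetRep ϖ i)⁻¹ v := by
  rw [heckeT_eq, Fintype.sum_option, cosetRep_none_inv, add_comm, add_right_inj]
  refine Fintype.sum_equiv (Equiv.neg _) _ _ fun u => ?_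
  obtain ⟨z, hz, h⟩ := lift_add_lift_neg hϖ u
  rw [Equiv.neg_apply, cosetRep_some_inv, h, unip_add, mul_assoc, ← torus_mul_unip, ← mul_assoc,
    rep_mul_fixed hv _ (unip_mem_maxCompact hz)]

lemma isLocallyConstant_rep (hπ : ∀ v : V, IsOpen {g : PGL(2, F) | π g v = v}) (v : V) :
    IsLocallyConstant fun g => π g v :=
  isLocallyConstant_of_mul_right (hπ v) (rep_one v) fun g u hu => by
    rw [rep_mul, show π u v = v from hu]

variable (μ : Measure PGL(2, F)) [μ.IsHaarMeasure]

/-- The double coset is the union of the left cosets of the inverted representatives. As an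
integral, the Hecke operator visibly preserves `K`-fixed vectors and does not depend on `ϖ`. -/
lemma testInt_detOneInd (hπ : ∀ v : V, IsOpen {g : PGL(2, F) | π g v = v}) {ϖ : Fˣ}
    (hϖ : ord (ϖ : F) = 1) {v : V} (hv : v ∈ fixedVectors π (maxCompact F)) :
    testInt μ (fun g => detOneInd g • π g v) =
      (μ.real (maxCompact F : Set PGL(2, F)) : ℂ) • heckeT π ϖ v := by
  have : Fintype 𝓀[F] := Fintype.ofFinite _
  refine eq_of_forall_dual fun ℓ => ?_
  rw [apply_testInt μ (isTestFun_detOneInd.smul (isLocallyConstant_rep hπ v))]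
  rw [integral_eq_sum_leftCosets μ (c := fun i : Option 𝓀[F] => (cosetRep ϖ i)⁻¹)
    (fun i j h => by rw [inv_inv] at h; exact cosetRep_injective hϖ h)
    (fun k hk g => by rw [detOneInd_mul_right hk, rep_mul_fixed hv g hk])
    (fun g hg => ?_), map_smul, heckeT_eq_sum_cosetRep hϖ hv, map_sum, smul_eq_mul]
  · congr 1
    refine Finset.sum_congr rfl fun i _ => ?_
    rw [detOneInd, if_pos (inv_mem_detOneSet (cosetRep_mem hϖ i)), one_smul]
  · rw [detOneInd, if_neg fun h => ?_, zero_smul, map_zero]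
    obtain ⟨i, hi⟩ := exists_mul_cosetRep_inv_mem hϖ (inv_mem_detOneSet h)
    refine hg i ?_
    have := inv_mem hi
    simpa using this

lemma heckeT_mem_fixedVectors (hπ : ∀ v : V, IsOpen {g : PGL(2, F) | π g v = v}) {ϖ : Fˣ}
    (hϖ : ord (ϖ : F) = 1) {v : V} (hv : v ∈ fixedVectors π (maxCompact F)) :
    heckeT π ϖ v ∈ fixedVectors π (maxCompact F) := by
  have h := testInt_detOneInd Measure.haar hπ hϖ hv
  rw [eq_comm, ← eq_inv_smul_iff₀ (measureReal_maxCompact_ne_zero Measure.haar)] at h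
  rw [h]
  refine Submodule.smul_mem _ _ fun k hk => ?_
  have ht := isTestFun_detOneInd.smul (isLocallyConstant_rep hπ v)
  rw [testInt_map _ ht, ← testInt_mul_left _ ht k]
  congr 1
  funext g
  rw [detOneInd_mul_left hk, map_smul, rep_mul]

lemma heckeT_eq_of_ord (hπ : ∀ v : V, IsOpen {g : PGL(2, F) | π g v = v}) {ϖ ϖ' : Fˣ}
    (hϖ : ord (ϖ : F) = 1) (hϖ' : ord (ϖ' : F) = 1) {v : V}
    (hv : v ∈ fixedVectors π (maxCompact F)) : heckeT π ϖ v = heckeT π ϖ' v := by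
  have h := testInt_detOneInd Measure.haar hπ hϖ hv
  rw [testInt_detOneInd Measure.haar hπ hϖ' hv] at h
  exact (smul_right_injective V (measureReal_maxCompact_ne_zero Measure.haar) h).symm

/-- Spherical vectors that are eigenvectors of the Hecke operator. -/
structure IsHeckeEigenvector (π : Representation ℂ PGL(2, F) V) (lam : ℂ) (v : V) : Prop where
  mem : v ∈ fixedVectors π (maxCompact F)
  ne_zero : v ≠ 0
  heckeT_eq : ∀ ϖ : Fˣ, ord (ϖ : F) = 1 → heckeT π ϖ v = lam • v

/-- By admissibility the nonzero space of `K`-fixed vectors is finite-dimensional, and the Hecke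
operator preserves it. -/
lemma exists_isHeckeEigenvector (hπ : IsIrreducibleAdmissible π) (hunr : IsUnramified π) :
    ∃ (lam : ℂ) (v : V), IsHeckeEigenvector π lam v := by
  have hfin := hπ.admissible (maxCompact F) isOpen_maxCompact
  obtain ⟨v, hv, hv0⟩ := hunr
  have hnt : Nontrivial (fixedVectors π (maxCompact F)) :=
    ⟨⟨v, hv⟩, 0, fun h => hv0 (congrArg Subtype.val h)⟩
  have hϖ := ord_uniformizer (F := F)
  set T : Module.End ℂ (fixedVectors π (maxCompact F)) :=
    { toFun := fun v => ⟨heckeT π (uniformizer F) v, heckeT_mem_fixedVectors hπ.smooth hϖ v.2⟩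
      map_add' := fun v w => Subtype.ext (heckeT_add _ _ _)
      map_smul' := fun c v => Subtype.ext (heckeT_smul _ _ _) } with hT
  obtain ⟨lam, hlam⟩ := Module.End.exists_eigenvalue T
  obtain ⟨w, hw⟩ := hlam.exists_hasEigenvector
  refine ⟨lam, w, w.2, fun h => hw.2 (Subtype.ext h), fun ϖ h => ?_⟩
  rw [heckeT_eq_of_ord hπ.smooth h hϖ w.2]
  exact congrArg Subtype.val hw.apply_eq_smul

lemma sqrt_q_pos : 0 < Real.sqrt (q F) := Real.sqrt_pos.2 (by exact_mod_cast q_pos)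

/-- Solving `α² - (lam / √q) α + 1 = 0` for a Hecke eigenvalue `lam` shows that the choice defining
`satake` is a genuine one. -/
lemma isSatakeParameter_satake (hπ : IsIrreducibleAdmissible π) (hunr : IsUnramified π) :
    IsSatakeParameter π (satake π) := by
  refine Classical.epsilon_spec (p := IsSatakeParameter π) ?_
  obtain ⟨lam, v, hv⟩ := exists_isHeckeEigenvector hπ hunr
  have hq : (Real.sqrt (q F) : ℂ) ≠ 0 := by exact_mod_cast (sqrt_q_pos (F := F)).ne'
  obtain ⟨α, hα⟩ := IsAlgClosed.exists_root
    (Polynomial.X ^ 2 - Polynomial.C (lam / Real.sqrt (q F)) * Polynomial.X + 1 : Polynomial ℂ)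
    (by
      have : (Polynomial.X ^ 2 - Polynomial.C (lam / Real.sqrt (q F)) * Polynomial.X + 1 :
        Polynomial ℂ).degree = 2 := by compute_degree!
      rw [this]
      norm_num)
  simp only [Polynomial.IsRoot, Polynomial.eval_add, Polynomial.eval_sub, Polynomial.eval_pow,
    Polynomial.eval_X, Polynomial.eval_mul, Polynomial.eval_C, Polynomial.eval_one] at hα
  have hα0 : α ≠ 0 := by
    rintro rfl
    simp at hα
  have key : (Real.sqrt (q F) : ℂ) * (α + α⁻¹) = lam := by
    field_simp at hα ⊢
    linear_combination hα
  exact ⟨α, hα0, v, hv.mem, hv.ne_zero, fun ϖ hϖ => by rw [hv.heckeT_eq ϖ hϖ, key]⟩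

/-- An irreducible representation is spanned by the translates of any nonzero vector. -/
lemma span_translates (hπ : π.IsIrreducible) {v : V} (hv : v ≠ 0) :
    Submodule.span ℂ (Set.range fun g => π g v) = ⊤ := by
  set S : Subrepresentation π :=
    { toSubmodule := Submodule.span ℂ (Set.range fun g => π g v)
      apply_mem_toSubmodule := fun g w hw => by
        have : Submodule.span ℂ (Set.range fun g => π g v) ≤
            (Submodule.span ℂ (Set.range fun g => π g v)).comap (π g) := by
          rw [Submodule.span_le]
          rintro _ ⟨h, rfl⟩
          exact Submodule.subset_span ⟨g * h, rep_mul g h v⟩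
        exact this hw } with hS
  have hmem : v ∈ S.toSubmodule := Submodule.subset_span ⟨1, rep_one v⟩
  rcases eq_bot_or_eq_top S with h | h
  · rw [h] at hmem
    exact absurd hmem hv
  · exact congrArg Subrepresentation.toSubmodule h

/-- The translates of a spherical vector under the Borel subgroup span the representation. -/
lemma span_borel (hπ : π.IsIrreducible) {v : V} (hv : v ∈ fixedVectors π (maxCompact F))
    (hv0 : v ≠ 0) :
    Submodule.span ℂ (Set.range fun p : F × Fˣ => π (unip p.1 * torus p.2) v) = ⊤ := by
  rw [← span_translates hπ hv0]
  congr 1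
  ext w
  constructor
  · rintro ⟨p, rfl⟩
    exact ⟨_, rfl⟩
  · rintro ⟨g, rfl⟩
    obtain ⟨x, y, k, hk, rfl⟩ := exists_iwasawa g
    exact ⟨(x, y), (rep_mul_fixed hv _ hk).symm⟩

/-- A linear recurrence of order two with vanishing initial values. -/
lemma recurrence_mem {W : Type*} [AddCommGroup W] [Module ℂ W] (S : Submodule ℂ W) {A : ℕ → W}
    {lam c : ℂ} (hc : c ≠ 0) (h0 : A 0 ∈ S) (h1 : A 1 ∈ S)
    (h : ∀ n, c • A (n + 2) + A n = lam • A (n + 1)) (n : ℕ) : A n ∈ S := by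
  have key : ∀ n, A n ∈ S ∧ A (n + 1) ∈ S := by
    intro n
    induction n with
    | zero => exact ⟨h0, h1⟩
    | succ n ih =>
      refine ⟨ih.2, ?_⟩
      have h2 : A (n + 2) = c⁻¹ • (lam • A (n + 1) - A n) := by
        rw [← h, add_sub_cancel_right, inv_smul_smul₀ hc]
      rw [h2]
      exact S.smul_mem _ (S.sub_mem (S.smul_mem _ ih.2) ih.1)
  exact (key n).1

lemma q_ne_zero : (q F : ℂ) ≠ 0 := by exact_mod_cast q_pos.ne'

/-- The space of spherical vectors is a line. -/
lemma fixedVectors_eq_span (hπ : IsIrreducibleAdmissible π) {lam : ℂ} {v : V}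
    (hv : IsHeckeEigenvector π lam v) {w : V} (hw : w ∈ fixedVectors π (maxCompact F)) :
    ∃ c : ℂ, w = c • v := by
  set μ : Measure PGL(2, F) := Measure.haar
  set ind := (maxCompact F : Set PGL(2, F)).indicator fun _ => (1 : ℂ) with hind
  have hindl : ∀ k ∈ maxCompact F, ∀ g, ind (k * g) = ind g := by
    intro k hk g
    by_cases hg : g ∈ (maxCompact F : Set PGL(2, F))
    · rw [hind, Set.indicator_of_mem hg, Set.indicator_of_mem (mul_mem hk hg)]
    · rw [hind, Set.indicator_of_notMem hg, Set.indicator_of_notMem]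
      intro h
      exact hg (by simpa using mul_mem (inv_mem hk) h)
  have hindr : ∀ k ∈ maxCompact F, ∀ g, ind (g * k) = ind g := by
    intro k hk g
    by_cases hg : g ∈ (maxCompact F : Set PGL(2, F))
    · rw [hind, Set.indicator_of_mem hg, Set.indicator_of_mem (mul_mem hg hk)]
    · rw [hind, Set.indicator_of_notMem hg, Set.indicator_of_notMem]
      intro h
      exact hg (by simpa using mul_mem h (inv_mem hk))
  have ht : ∀ v : V, IsTestFun fun g => ind g • π g v := fun v =>
    isTestFun_maxCompact.smul (isLocallyConstant_rep hπ.smooth v)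
  -- `P` averages over `K` and acts on spherical vectors as the scalar `vol(K)`, so it suffices that
  -- its image lies in the line of `v`.
  set P : V →ₗ[ℂ] V :=
    { toFun := fun v => testInt μ fun g => ind g • π g v
      map_add' := fun v w => by
        rw [← testInt_add μ (ht v) (ht w)]
        simp only [map_add, smul_add]
      map_smul' := fun c v => by
        rw [RingHom.id_apply, ← testInt_smul μ (ht v)]
        simp only [map_smul, smul_comm c] } with hP
  have hPk : ∀ k ∈ maxCompact F, ∀ v, P (π k v) = P v := by
    intro k hk v
    change testInt μ _ = testInt μ _
    rw [← testInt_mul_right μ (ht v) k]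
    simp only [hindr k hk, rep_mul]
  have hPfix : ∀ v ∈ fixedVectors π (maxCompact F),
      P v = (μ.real (maxCompact F : Set PGL(2, F)) : ℂ) • v := by
    intro v hv
    have e : (fun g => ind g • π g v) = fun g => ind g • v := by
      funext g
      by_cases hg : g ∈ (maxCompact F : Set PGL(2, F))
      · rw [hv g hg]
      · rw [hind, Set.indicator_of_notMem hg, zero_smul, zero_smul]
    refine eq_of_forall_dual fun ℓ => ?_
    change ℓ (testInt μ _) = _
    rw [apply_testInt μ (ht v)]
    simp only [funext_iff] at e
    simp only [e, map_smul, smul_eq_mul]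
    rw [integral_mul_const, hind, integral_indicator_maxCompact]
  have hϖ := ord_uniformizer (F := F)
  set ϖ := uniformizer F
  -- Applying `P ∘ π(ϖⁿ)` to the Hecke equation: the unipotents move left into `K`, are absorbed by
  -- `P`, and the `q` terms coincide.
  have hrec : ∀ n : ℕ, (q F : ℂ) • P (π (torus (ϖ ^ (n + 1))) v) + P (π (torus (ϖ ^ n * ϖ⁻¹)) v) =
      lam • P (π (torus (ϖ ^ n)) v) := by
    intro n
    have h := map_heckeT_of_const (P ∘ₗ π (torus (ϖ ^ n))) ϖ v
      (w := P (π (torus (ϖ ^ (n + 1))) v)) fun u => by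
        rw [LinearMap.comp_apply, ← rep_mul, ← mul_assoc, torus_mul_unip, mul_assoc, ← torus_mul,
          rep_mul, hPk _ (unip_mem_maxCompact (mul_mem ?_ (lift F u).2)), pow_succ]
        rw [units_mem_integer_iff, ord_pow_units, hϖ]
        omega
    rw [hv.heckeT_eq ϖ hϖ, LinearMap.comp_apply, map_smul, map_smul, LinearMap.comp_apply,
      ← rep_mul, ← torus_mul] at h
    exact h.symm
  have hA : ∀ n : ℕ, P (π (torus (ϖ ^ n)) v) ∈ Submodule.span ℂ {v} := by
    have h0 : P (π (torus (ϖ ^ 0)) v) ∈ Submodule.span ℂ {v} := by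
      rw [pow_zero, torus_one, rep_one, hPfix v hv.mem]
      exact Submodule.smul_mem _ _ (Submodule.mem_span_singleton_self v)
    refine recurrence_mem _ (lam := lam) (q_ne_zero (F := F)) h0 ?_ fun n => ?_
    -- The Weyl element identifies the terms at `ϖ` and `ϖ⁻¹`, so the relation reads `(q + 1) P(π(ϖ)
    -- v) = lam P(v)`.
    · have h1 := hrec 0
      rw [pow_zero, one_mul, zero_add, pow_one, ← weyl_torus_weyl,
        rep_mul_fixed hv.mem _ weyl_mem_maxCompact, rep_mul, hPk _ weyl_mem_maxCompact] at h1
      nth_rw 2 [← one_smul ℂ (P (π (torus ϖ) v))] at h1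
      rw [← add_smul] at h1
      have hq1 : (q F : ℂ) + 1 ≠ 0 := by exact_mod_cast Nat.succ_ne_zero (q F)
      rw [pow_one, eq_inv_smul_iff₀ hq1 |>.2 h1]
      exact Submodule.smul_mem _ _ (Submodule.smul_mem _ _ (by simpa using h0))
    · have h1 := hrec (n + 1)
      rwa [pow_succ ϖ n, mul_inv_cancel_right, ← pow_succ] at h1
  have hG : ∀ g, P (π g v) ∈ Submodule.span ℂ {v} := by
    intro g
    obtain ⟨k, hk, n, k', hk', rfl⟩ := exists_cartan hϖ g
    rw [rep_mul_fixed hv.mem _ hk', rep_mul, hPk k hk, ← torus_pow]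
    exact hA n
  have hall : ∀ w, P w ∈ Submodule.span ℂ {v} := by
    have : (⊤ : Submodule ℂ V) ≤ (Submodule.span ℂ {v}).comap P := by
      rw [← span_translates hπ.irreducible hv.ne_zero, Submodule.span_le]
      rintro _ ⟨g, rfl⟩
      exact hG g
    exact fun w => this Submodule.mem_top
  obtain ⟨c, hc⟩ := Submodule.mem_span_singleton.1 (hall w)
  rw [hPfix w hw] at hc
  refine ⟨(μ.real (maxCompact F : Set PGL(2, F)) : ℂ)⁻¹ * c, ?_⟩
  rw [mul_smul, hc, inv_smul_smul₀ (measureReal_maxCompact_ne_zero μ)]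

end Hecke

end LocalSpherical

namespace LocalSpherical

/-! ### Rigidity of Hecke eigenfunctions on the Borel subgroup -/

section Kernel

variable {F : Type*} [Field F] [ValuativeRel F] [TopologicalSpace F] [IsNonarchimedeanLocalField F]

lemma exists_eq_pow_mul {ϖ : Fˣ} (hϖ : ord (ϖ : F) = 1) {y : Fˣ} (hy : 0 ≤ ord (y : F)) :
    ∃ (n : ℕ) (u : Fˣ), ord (u : F) = 0 ∧ y = ϖ ^ n * u := by
  obtain ⟨n, hn⟩ := Int.eq_ofNat_of_zero_le hy
  refine ⟨n, (ϖ ^ n)⁻¹ * y, ?_, by rw [mul_inv_cancel_left]⟩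
  rw [ord_mul_units, ord_inv_units, ord_pow_units, hϖ, hn]
  ring

/-- A function on the Borel subgroup that is bi-invariant under the integral points, hermitian on
the torus, and an eigenfunction of the Hecke operator, vanishes if it vanishes at the identity. -/
lemma borelKernel_eq_zero [Fintype 𝓀[F]] {e : F → Fˣ → ℂ} {lam : ℂ}
    (h1 : ∀ x y, ∀ u : Fˣ, ord (u : F) = 0 → e (u * x) (u * y) = e x y)
    (h1' : ∀ x y, ∀ z ∈ 𝒪[F], e (z + x) y = e x y)
    (h2 : ∀ x (y : Fˣ), ∀ z ∈ 𝒪[F], e (x + y * z) y = e x y)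
    (h3 : ∀ x y, ∀ u : Fˣ, ord (u : F) = 0 → e x (y * u) = e x y)
    (h4 : ∀ y, e 0 y⁻¹ = starRingEnd ℂ (e 0 y))
    (h5 : ∀ ϖ : Fˣ, ord (ϖ : F) = 1 → ∀ x (y : Fˣ),
      ∑ u : 𝓀[F], e (x + y * lift F u) (y * ϖ) + e x (y * ϖ⁻¹) = lam * e x y)
    (h0 : e 0 1 = 0) (x : F) (y : Fˣ) : e x y = 0 := by
  classical
  obtain ⟨ϖ, hϖ⟩ := exists_ord_eq (F := F) 1
  have hcard : (Fintype.card 𝓀[F] : ℂ) = q F := by rw [q, Nat.card_eq_fintype_card]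
  have hpow : ∀ n : ℕ, ((ϖ ^ n : Fˣ) : F) ∈ 𝒪[F] := fun n => by
    rw [units_mem_integer_iff, ord_pow_units, hϖ]
    omega
  have hA : ∀ n : ℕ, e 0 (ϖ ^ n) = 0 := by
    have hrec : ∀ n : ℕ, (q F : ℂ) * e 0 (ϖ ^ (n + 1)) + e 0 (ϖ ^ n * ϖ⁻¹) =
        lam * e 0 (ϖ ^ n) := by
      intro n
      rw [← h5 ϖ hϖ, ← hcard, ← nsmul_eq_mul, ← Finset.card_univ, ← Finset.sum_const, pow_succ]
      congr 1
      refine Finset.sum_congr rfl fun u _ => ?_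
      rw [zero_add, ← add_zero (((ϖ ^ n : Fˣ) : F) * lift F u),
        h1' _ _ _ (mul_mem (hpow n) (lift F u).2)]
    intro n
    refine (Submodule.mem_bot ℂ).1 (recurrence_mem (lam := lam) (A := fun n => e 0 (ϖ ^ n)) ⊥
      (q_ne_zero (F := F)) ?_ ?_ (fun n => ?_) n)
    · rw [pow_zero, h0]
      exact zero_mem _
    · have h6 := hrec 0
      rw [pow_zero, one_mul, zero_add, h0, mul_zero, h4, pow_one] at h6
      -- Hermitian symmetry replaces the value at `ϖ⁻¹`; comparing norms forces `e 0 ϖ = 0` because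
      -- `q > 1`.
      have h7 : (q F : ℂ) * e 0 ϖ = -starRingEnd ℂ (e 0 ϖ) := by linear_combination h6
      have h8 := congrArg norm h7
      rw [norm_mul, norm_neg, RCLike.norm_conj, Complex.norm_natCast] at h8
      have h9 : (1 : ℝ) < q F := by exact_mod_cast one_lt_q (F := F)
      rw [pow_one, Submodule.mem_bot, ← norm_eq_zero]
      nlinarith [norm_nonneg (e 0 ϖ)]
    · have h6 := hrec (n + 1)
      rwa [pow_succ ϖ n, mul_inv_cancel_right, ← pow_succ] at h6
  have hT : ∀ y, e 0 y = 0 := by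
    intro y
    rcases le_total 0 (ord (y : F)) with hy | hy
    · obtain ⟨n, u, hu, rfl⟩ := exists_eq_pow_mul hϖ hy
      rw [h3 _ _ _ hu, hA]
    · obtain ⟨n, u, hu, h⟩ := exists_eq_pow_mul hϖ (y := y⁻¹) (by rw [ord_inv_units]; omega)
      rw [← inv_inv y, h4, h, h3 _ _ _ hu, hA, map_zero]
  have hT' : ∀ (y : Fˣ), ∀ z ∈ 𝒪[F], e (y * z) y = 0 := fun y z hz => by
    rw [← zero_add ((y : F) * z), h2 _ _ _ hz, hT]
  rcases eq_or_ne x 0 with rfl | hx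
  · exact hT y
  lift x to Fˣ using hx.isUnit
  rcases le_total (ord (y : F)) (ord (x : F)) with hxy | hxy
  · have h6 := hT' y ((y⁻¹ * x : Fˣ) : F) (by
      rw [units_mem_integer_iff, ord_mul_units, ord_inv_units]
      omega)
    rwa [← Units.val_mul, mul_inv_cancel_left] at h6
  have hunit : ∀ (y v : Fˣ), ord (v : F) = 0 → e ((v : F) * x) y = e x y := fun y v hv => by
    rw [← h3 _ y _ hv, mul_comm y, h1 _ _ _ hv]
  have hB : ∀ n : ℕ, e x (x * ϖ ^ n) = 0 := by
    intro n
    refine (Submodule.mem_bot ℂ).1 (recurrence_mem (lam := lam) (A := fun n => e x (x * ϖ ^ n)) ⊥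
      (q_ne_zero (F := F)) ?_ ?_ (fun n => ?_) n)
    · have h6 := hT' x 1 (one_mem _)
      rw [Submodule.mem_bot, pow_zero, mul_one]
      rwa [mul_one] at h6
    -- The Hecke relation at `(0, x)` starts the recurrence: the zero class contributes nothing, and
    -- the other `q - 1` terms all equal `e x (x * ϖ)`.
    · have h6 := h5 ϖ hϖ 0 x
      rw [hT, hT, mul_zero, add_zero, ← Finset.add_sum_erase _ _ (Finset.mem_univ 0)] at h6
      have hl0 : (lift F 0 : F) = ϖ * ((lift F 0 : F) / ϖ) := by
        rw [mul_div_cancel₀ _ ϖ.ne_zero]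
      have h7 : e (0 + x * lift F 0) (x * ϖ) = 0 := by
        rw [zero_add, hl0, ← mul_assoc, ← Units.val_mul]
        exact hT' _ _ (div_mem_of_red_eq_zero (lift F 0).2 (red_lift 0) hϖ)
      have h8 : ∀ u ∈ Finset.univ.erase (0 : 𝓀[F]),
          e (0 + x * lift F u) (x * ϖ) = e x (x * ϖ) := by
        intro u hu
        have hu' := Finset.ne_of_mem_erase hu
        rw [zero_add, mul_comm]
        exact hunit _ (liftUnit F (Units.mk0 u hu')) (ord_liftUnit _)
      rw [h7, zero_add, Finset.sum_congr rfl h8, Finset.sum_const, nsmul_eq_mul,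
        Finset.card_erase_of_mem (Finset.mem_univ _), Finset.card_univ] at h6
      have h9 : ((Fintype.card 𝓀[F] - 1 : ℕ) : ℂ) ≠ 0 := by
        rw [Nat.cast_ne_zero, ← Nat.card_eq_fintype_card]
        have := one_lt_q (F := F)
        rw [q] at this
        omega
      rw [pow_one]
      exact (mul_eq_zero.1 h6).resolve_left h9
    · have h6 := h5 ϖ hϖ x (x * ϖ ^ (n + 1))
      -- The first argument is `x` times a unit of the form `1 + ϖ^(n+1) u`, so all `q` terms agree.
      have h7 : ∀ u : 𝓀[F], e (x + (x * ϖ ^ (n + 1) : Fˣ) * lift F u) (x * ϖ ^ (n + 1) * ϖ) =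
          e x (x * ϖ ^ (n + 2)) := by
        intro u
        have hm : ((ϖ ^ (n + 1) : Fˣ) : F) * lift F u ∈ 𝒪[F] := mul_mem (hpow _) (lift F u).2
        have h8 := ord_one_add hm (by
          rw [red_mul (hpow _) (lift F u).2, red_eq_zero_of_ord_pos, zero_mul]
          rw [ord_pow_units, hϖ]
          push_cast
          omega)
        have h9 := hunit (x * ϖ ^ (n + 1) * ϖ) (Units.mk0 _ h8.1) h8.2
        have h10 : x * ϖ ^ (n + 2) = x * ϖ ^ (n + 1) * ϖ := by rw [pow_succ ϖ (n + 1), mul_assoc]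
        rw [h10, ← h9]
        congr 1
        rw [Units.val_mk0, Units.val_mul]
        ring
      rw [Finset.sum_congr rfl fun u _ => h7 u, Finset.sum_const, Finset.card_univ, nsmul_eq_mul,
        hcard, pow_succ ϖ n, ← mul_assoc, mul_inv_cancel_right, mul_assoc, ← pow_succ] at h6
      exact h6
  obtain ⟨n, u, hu, h⟩ := exists_eq_pow_mul hϖ (y := x⁻¹ * y) (by
    rw [ord_mul_units, ord_inv_units]
    omega)
  rw [inv_mul_eq_iff_eq_mul, ← mul_assoc] at h
  rw [h, h3 _ _ _ hu, hB]

end Kernel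

/-! ### Hermitian forms invariant under the Borel subgroup -/

section Form

variable {F : Type*} [Field F] [ValuativeRel F] [TopologicalSpace F] [IsNonarchimedeanLocalField F]
  {V : Type*} [AddCommGroup V] [Module ℂ V] {π : Representation ℂ PGL(2, F) V}

/-- Hermitian forms, linear in the second variable, that are invariant under the Borel subgroup. -/
structure IsBorelForm (π : Representation ℂ PGL(2, F) V) (D : V → V →ₗ[ℂ] ℂ) : Prop where
  conj_symm : ∀ v w, starRingEnd ℂ (D v w) = D w v
  unip : ∀ (x : F) v w, D (π (unip x) v) (π (unip x) w) = D v w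
  torus : ∀ (y : Fˣ) v w, D (π (torus y) v) (π (torus y) w) = D v w

lemma IsBorelForm.sub_smul {D D' : V → V →ₗ[ℂ] ℂ} (hD : IsBorelForm π D) (hD' : IsBorelForm π D')
    (r : ℝ) : IsBorelForm π fun v => D v - (r : ℂ) • D' v where
  conj_symm v w := by simp [hD.conj_symm, hD'.conj_symm]
  unip x v w := by simp [hD.unip, hD'.unip]
  torus y v w := by simp [hD.torus, hD'.torus]

/-- A hermitian form invariant under the Borel subgroup vanishes if it vanishes on a spherical
vector. -/
theorem IsBorelForm.eq_zero {D : V → V →ₗ[ℂ] ℂ} (hD : IsBorelForm π D) (hπ : π.IsIrreducible)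
    {lam : ℂ} {v : V} (hv : IsHeckeEigenvector π lam v) (h : D v v = 0) (w w' : V) :
    D w w' = 0 := by
  have : Fintype 𝓀[F] := Fintype.ofFinite _
  have hunip : ∀ z ∈ 𝒪[F], ∀ w, D v (π (LocalSpherical.unip z) w) = D v w := fun z hz w => by
    rw [← hD.unip z v w, hv.mem _ (unip_mem_maxCompact hz)]
  have htorus : ∀ u : Fˣ, ord (u : F) = 0 → ∀ w, D v (π (LocalSpherical.torus u) w) = D v w :=
    fun u hu w => by rw [← hD.torus u v w, hv.mem _ (torus_mem_maxCompact hu)]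
  -- The coefficient of `v` against its Borel translates satisfies the hypotheses of
  -- `borelKernel_eq_zero`. Since these translates span `V` by the Iwasawa decomposition, this is
  -- enough.
  have key : ∀ x y, D v (π (LocalSpherical.unip x * LocalSpherical.torus y) v) = 0 := by
    refine borelKernel_eq_zero (lam := lam) (fun x y u hu => ?_) (fun x y z hz => ?_)
      (fun x y z hz => ?_) (fun x y u hu => ?_) (fun y => ?_) (fun ϖ hϖ x y => ?_) ?_
    · rw [torus_mul, ← mul_assoc, ← torus_mul_unip, mul_assoc, rep_mul, htorus u hu]
    · rw [unip_add, mul_assoc, rep_mul, hunip z hz]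
    · rw [unip_add, mul_assoc, ← torus_mul_unip, ← mul_assoc,
        rep_mul_fixed hv.mem _ (unip_mem_maxCompact hz)]
    · rw [torus_mul, ← mul_assoc, rep_mul_fixed hv.mem _ (torus_mem_maxCompact hu)]
    · rw [unip_zero, one_mul, one_mul, hD.conj_symm, ← hD.torus y v, ← rep_mul, ← torus_mul,
        mul_inv_cancel, torus_one, rep_one]
    · have h1 := congrArg (D v ∘ₗ π (LocalSpherical.unip x * LocalSpherical.torus y))
        (hv.heckeT_eq ϖ hϖ)
      rw [heckeT_eq, map_add, map_sum, map_smul, smul_eq_mul] at h1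
      simp only [LinearMap.comp_apply, ← rep_mul, borel_mul] at h1
      rw [mul_assoc, ← torus_mul] at h1
      exact h1
    · rw [unip_zero, torus_one, one_mul, rep_one, h]
  have h1 : ∀ x y, D (π (LocalSpherical.unip x * LocalSpherical.torus y) v) = 0 := by
    intro x y
    refine LinearMap.ext_on_range (span_borel hπ hv.mem hv.ne_zero) fun p => ?_
    have h2 : LocalSpherical.unip x * (LocalSpherical.torus y *
        (LocalSpherical.torus y⁻¹ * LocalSpherical.unip (-x))) = 1 := by
      rw [torus_inv, mul_inv_cancel_left, ← unip_add, add_neg_cancel, unip_zero]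
    have h3 : ∀ w', D (π (LocalSpherical.unip x * LocalSpherical.torus y) v) w' =
        D v (π (LocalSpherical.torus y⁻¹ * LocalSpherical.unip (-x)) w') := by
      intro w'
      rw [← hD.torus y v, ← hD.unip x (π (LocalSpherical.torus y) v), ← rep_mul, ← rep_mul,
        ← rep_mul, mul_assoc, h2, rep_one]
    rw [h3, ← rep_mul, torus_mul_unip, borel_mul, key, LinearMap.zero_apply]
  have h2 : D w = 0 := by
    refine LinearMap.ext_on_range (span_borel hπ hv.mem hv.ne_zero) fun p => ?_
    rw [← hD.conj_symm, h1, LinearMap.zero_apply, LinearMap.zero_apply, map_zero]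
  rw [h2, LinearMap.zero_apply]

/-- The invariant form of a unitary representation. -/
lemma exists_invariant_form (h : IsUnitary π) : ∃ D : V → V →ₗ[ℂ] ℂ,
    (∀ v w, starRingEnd ℂ (D v w) = D w v) ∧ (∀ v, v ≠ 0 → 0 < (D v v).re) ∧
      ∀ g v w, D (π g v) (π g w) = D v w := by
  obtain ⟨c, hc⟩ := h
  refine ⟨fun v =>
    { toFun := fun w => c.inner v w
      map_add' := fun a b => ?_
      map_smul' := fun r a => ?_ }, fun v w => c.conj_inner_symm w v, fun v hv => ?_, hc⟩
  · rw [← c.conj_inner_symm, c.add_left, map_add, c.conj_inner_symm, c.conj_inner_symm]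
  · rw [← c.conj_inner_symm, c.smul_left, map_mul, c.conj_inner_symm, Complex.conj_conj]
    rfl
  · refine lt_of_le_of_ne (c.re_inner_nonneg v) fun h => hv (c.definite v ?_)
    have h1 : starRingEnd ℂ (c.inner v v) = c.inner v v := c.conj_inner_symm v v
    exact Complex.ext h.symm (Complex.conj_eq_iff_im.1 h1)

end Form

/-! ### Spherical Whittaker functions and the bound on the Hecke eigenvalue -/

section Whittaker

variable {F : Type*} [Field F] [ValuativeRel F] [TopologicalSpace F] [IsNonarchimedeanLocalField F]
  {V : Type*} [AddCommGroup V] [Module ℂ V] {π : Representation ℂ PGL(2, F) V}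
  {ψ : AddChar F Circle} {κ : V →ₗ[ℂ] (PGL(2, F) → ℂ)} {lam : ℂ} {v : V}

/-- An embedding of `π` into the space of Whittaker functions. -/
structure IsWhittakerMap (π : Representation ℂ PGL(2, F) V) (ψ : AddChar F Circle)
    (κ : V →ₗ[ℂ] (PGL(2, F) → ℂ)) : Prop where
  rep_apply : ∀ g v h, κ (π g v) h = κ v (h * g)
  unip_mul : ∀ v x g, κ v (unip x * g) = (ψ x : ℂ) * κ v g
  injective : Function.Injective κ

lemma addChar_eq_one (hψ : IsUnramifiedAddChar ψ) {x : F} (hx : x ∈ 𝒪[F]) : ψ x = 1 := by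
  simpa using (hψ 1).2 (one_mem _) x hx

lemma exists_addChar_ne_one (hψ : IsUnramifiedAddChar ψ) {a : F} (ha : a ∉ 𝒪[F]) :
    ∃ x ∈ 𝒪[F], ψ (a * x) ≠ 1 := by
  by_contra! h
  exact ha ((hψ a).1 h)

lemma IsWhittakerMap.torus_unip (hκ : IsWhittakerMap π ψ κ) (w : V) (a : Fˣ) (x : F) :
    κ w (torus a * unip x) = (ψ (a * x) : ℂ) * κ w (torus a) := by
  rw [torus_mul_unip, hκ.unip_mul]

lemma IsWhittakerMap.rep_borel (hκ : IsWhittakerMap π ψ κ) (w : V) (a y : Fˣ) (x : F) :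
    κ (π (unip x * torus y) w) (torus a) = (ψ (a * x) : ℂ) * κ w (torus (a * y)) := by
  rw [hκ.rep_apply, ← mul_assoc, torus_mul_unip, mul_assoc, ← torus_mul, hκ.unip_mul]

lemma IsWhittakerMap.mul_fixed (hκ : IsWhittakerMap π ψ κ)
    (hv : v ∈ fixedVectors π (maxCompact F)) (g : PGL(2, F)) {k : PGL(2, F)}
    (hk : k ∈ maxCompact F) : κ v (g * k) = κ v g := by
  rw [← hκ.rep_apply, hv k hk]

lemma IsWhittakerMap.torus_eq_of_ord (hκ : IsWhittakerMap π ψ κ)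
    (hv : v ∈ fixedVectors π (maxCompact F)) {a b : Fˣ} (h : ord (a : F) = ord (b : F)) :
    κ v (torus a) = κ v (torus b) := by
  rw [← mul_inv_cancel_left a b, torus_mul, hκ.mul_fixed hv]
  refine torus_mem_maxCompact ?_
  rw [ord_mul_units, ord_inv_units]
  omega

/-- Some integral `x` has `ψ(a x) ≠ 1`, while invariance under `unip x` gives `W(a) = ψ(a x) W(a)`.
-/
lemma IsWhittakerMap.torus_eq_zero (hκ : IsWhittakerMap π ψ κ) (hψ : IsUnramifiedAddChar ψ)
    (hv : v ∈ fixedVectors π (maxCompact F)) {a : Fˣ} (ha : ord (a : F) < 0) :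
    κ v (torus a) = 0 := by
  obtain ⟨x, hx, h⟩ := exists_addChar_ne_one hψ
    (a := (a : F)) (by rw [units_mem_integer_iff]; omega)
  have h1 := hκ.torus_unip v a x
  rw [hκ.mul_fixed hv _ (unip_mem_maxCompact hx)] at h1
  by_contra h0
  refine h (Circle.ext ?_)
  rw [Circle.coe_one]
  exact mul_right_cancel₀ h0 (by rw [← h1, one_mul])

/-- The Hecke equation evaluated on the torus: for integral `a` the character `ψ` is trivial on all
`q` unipotent terms. -/
lemma IsWhittakerMap.torus_recurrence (hκ : IsWhittakerMap π ψ κ) (hψ : IsUnramifiedAddChar ψ)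
    (hv : IsHeckeEigenvector π lam v) {ϖ a : Fˣ} (hϖ : ord (ϖ : F) = 1) (ha : 0 ≤ ord (a : F)) :
    (q F : ℂ) * κ v (torus (a * ϖ)) + κ v (torus (a * ϖ⁻¹)) = lam * κ v (torus a) := by
  have h := map_heckeT_of_const (LinearMap.proj (torus a) ∘ₗ κ) ϖ v (w := κ v (torus (a * ϖ)))
    fun u => by
      rw [LinearMap.comp_apply, LinearMap.proj_apply, hκ.rep_borel, addChar_eq_one hψ,
        Circle.coe_one, one_mul]
      exact mul_mem ((units_mem_integer_iff a).2 ha) (lift F u).2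
  rw [hv.heckeT_eq ϖ hϖ, map_smul, LinearMap.comp_apply, LinearMap.comp_apply,
    LinearMap.proj_apply, LinearMap.proj_apply, hκ.rep_apply, ← torus_mul] at h
  exact h.symm

/-- If `W(1)` were zero, the recurrence would make `W` vanish on the torus, hence everywhere by the
Iwasawa decomposition, against injectivity of the model. -/
lemma IsWhittakerMap.one_ne_zero (hκ : IsWhittakerMap π ψ κ) (hψ : IsUnramifiedAddChar ψ)
    (hv : IsHeckeEigenvector π lam v) : κ v 1 ≠ 0 := by
  intro h
  obtain ⟨ϖ, hϖ⟩ := exists_ord_eq (F := F) 1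
  have h1 : ∀ n : ℕ, κ v (torus (ϖ ^ n)) = 0 := by
    intro n
    refine (Submodule.mem_bot ℂ).1 (recurrence_mem (lam := lam)
      (A := fun n => κ v (torus (ϖ ^ n))) ⊥ (q_ne_zero (F := F)) ?_ ?_ (fun n => ?_) n)
    · rw [pow_zero, torus_one, h]
      exact zero_mem _
    · have h2 := hκ.torus_recurrence hψ hv hϖ (a := 1) (by simp)
      rw [one_mul, one_mul, torus_one, h, hκ.torus_eq_zero hψ hv.mem (a := ϖ⁻¹)
        (by rw [ord_inv_units]; omega), mul_zero, add_zero] at h2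
      rw [pow_one, Submodule.mem_bot]
      exact (mul_eq_zero.1 h2).resolve_left q_ne_zero
    · have h2 := hκ.torus_recurrence hψ hv hϖ (a := ϖ ^ (n + 1))
        (by rw [ord_pow_units, hϖ]; omega)
      rwa [pow_succ ϖ n, mul_inv_cancel_right, ← pow_succ, ← pow_succ] at h2
  refine hv.ne_zero (hκ.injective ?_)
  rw [map_zero]
  funext g
  obtain ⟨x, y, k, hk, rfl⟩ := exists_iwasawa g
  rw [hκ.mul_fixed hv.mem _ hk, hκ.unip_mul, Pi.zero_apply]
  rcases lt_or_ge (ord (y : F)) 0 with hy | hy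
  · rw [hκ.torus_eq_zero hψ hv.mem hy, mul_zero]
  · obtain ⟨n, u, hu, rfl⟩ := exists_eq_pow_mul hϖ hy
    rw [torus_mul, hκ.mul_fixed hv.mem _ (torus_mem_maxCompact hu), h1, mul_zero]

/-- The Hecke eigenvalue of a unitary generic unramified representation is real and smaller than
`q + 1`. -/
lemma IsWhittakerMap.eigenvalue_bound (hκ : IsWhittakerMap π ψ κ) (hψ : IsUnramifiedAddChar ψ)
    (hv : IsHeckeEigenvector π lam v) (hunit : IsUnitary π) :
    starRingEnd ℂ lam = lam ∧ ‖lam‖ < q F + 1 := by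
  obtain ⟨D, hD, hpos, hinv⟩ := exists_invariant_form hunit
  obtain ⟨ϖ, hϖ⟩ := exists_ord_eq (F := F) 1
  set N := D v v with hN
  set m := D v (π (torus ϖ) v) with hm
  have hm1 : D v (π (torus ϖ⁻¹) v) = m := by
    rw [← weyl_torus_weyl, rep_mul_fixed hv.mem _ weyl_mem_maxCompact, rep_mul,
      ← hinv (weyl F), hm]
    nth_rw 1 [hv.mem _ weyl_mem_maxCompact]
    rw [← rep_mul, weyl_mul_weyl, rep_one]
  have hm2 : D (π (torus ϖ) v) v = m := by
    rw [← hm1, ← hinv (torus ϖ) v, ← rep_mul, ← torus_mul, mul_inv_cancel, torus_one, rep_one]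
  have hmr : starRingEnd ℂ m = m := by rw [hm, hD, hm2]
  have hNr : starRingEnd ℂ N = N := hD v v
  -- Pairing the Hecke equation with `v`; each of the `q + 1` terms contributes the same `m`.
  have hlam : lam * N = (q F + 1) * m := by
    have h := map_heckeT_of_const (π := π) (D v) ϖ v (w := m) fun u => by
      rw [rep_mul, hm, ← hinv (unip (lift F u : F)) v (π (torus ϖ) v),
        hv.mem _ (unip_mem_maxCompact (lift F u).2)]
    rw [hv.heckeT_eq ϖ hϖ, map_smul, hm1, smul_eq_mul, smul_eq_mul] at h
    rw [h]
    ring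
  obtain ⟨n, hn⟩ := Complex.conj_eq_iff_real.1 hNr
  obtain ⟨r, hr⟩ := Complex.conj_eq_iff_real.1 hmr
  have hn0 : 0 < n := by
    have := hpos v hv.ne_zero
    rwa [← hN, hn, Complex.ofReal_re] at this
  -- Genericity enters here: at `diag(ϖ⁻¹, 1)` the left side gives `W(1) ≠ 0` and the right side
  -- gives zero.
  have hne : ∀ ε : ℂ, π (torus ϖ) v ≠ ε • v := by
    intro ε h
    have h1 := congrFun (congrArg κ h) (torus ϖ⁻¹)
    rw [hκ.rep_apply, ← torus_mul, inv_mul_cancel, torus_one, map_smul, Pi.smul_apply,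
      hκ.torus_eq_zero hψ hv.mem (a := ϖ⁻¹) (by rw [ord_inv_units]; omega), smul_zero] at h1
    exact hκ.one_ne_zero hψ hv h1
  have hexp : ∀ ε : ℝ, D (π (torus ϖ) v - (ε : ℂ) • v) (π (torus ϖ) v - (ε : ℂ) • v) =
      ((1 + ε ^ 2) * n - 2 * ε * r : ℝ) := by
    intro ε
    have h1 : ∀ w, D (π (torus ϖ) v - (ε : ℂ) • v) w = D (π (torus ϖ) v) w - ε * D v w := by
      intro w
      rw [← hD, map_sub, map_smul, map_sub, smul_eq_mul, map_mul, hD, hD, Complex.conj_ofReal]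
    rw [h1, map_sub, map_sub, map_smul, map_smul, hinv, ← hN, ← hm, hm2, hn, hr, smul_eq_mul,
      smul_eq_mul]
    push_cast
    ring
  -- At `ε = ±1` this is the strict Cauchy-Schwarz inequality `|r| < n`.
  have hlt : ∀ ε : ℝ, 0 < (1 + ε ^ 2) * n - 2 * ε * r := by
    intro ε
    have := hpos _ (sub_ne_zero.2 (hne ε))
    rwa [hexp, Complex.ofReal_re] at this
  have h1 := hlt 1
  have h2 := hlt (-1)
  have hlam' : lam = (((q F + 1) * r / n : ℝ) : ℂ) := by
    have hn' : (n : ℂ) ≠ 0 := by exact_mod_cast hn0.ne'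
    rw [hn, hr] at hlam
    push_cast
    rw [eq_div_iff hn', hlam]
  have hq : (0 : ℝ) < q F + 1 := by positivity
  refine ⟨by rw [hlam', Complex.conj_ofReal], ?_⟩
  rw [hlam', Complex.norm_real, Real.norm_eq_abs, abs_div, abs_mul, abs_of_pos hq, abs_of_pos hn0,
    div_lt_iff₀ hn0]
  have : |r| < n := abs_lt.2 ⟨by linarith, by linarith⟩
  exact mul_lt_mul_of_pos_left this hq

end Whittaker

end LocalSpherical

namespace LocalSpherical

/-! ### Unramified zeta integrals and invariance of `θ♮` -/

section Spherical

variable {F : Type*} [Field F] [ValuativeRel F] [TopologicalSpace F] [IsNonarchimedeanLocalField F]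
  {V : Type*} [AddCommGroup V] [Module ℂ V] {π : Representation ℂ PGL(2, F) V}
  {ψ : AddChar F Circle} {κ : V →ₗ[ℂ] (PGL(2, F) → ℂ)} {v : V}

/-- The normalized spherical vector of a unitary unramified representation with a Whittaker
model. -/
structure IsSphericalWhittaker (π : Representation ℂ PGL(2, F) V) (ψ : AddChar F Circle)
    (κ : V →ₗ[ℂ] (PGL(2, F) → ℂ)) (v : V) : Prop where
  admissible : IsIrreducibleAdmissible π
  unitary : IsUnitary π
  addChar : IsUnramifiedAddChar ψ
  map : IsWhittakerMap π ψ κ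
  satake_ne_zero : satake π ≠ 0
  hecke : IsHeckeEigenvector π ((Real.sqrt (q F) : ℂ) * (satake π + (satake π)⁻¹)) v
  normalized : κ v 1 = 1

lemma exists_isSphericalWhittaker (hπ : IsIrreducibleAdmissible π) (hunit : IsUnitary π)
    (hunr : IsUnramified π) (hψ : IsUnramifiedAddChar ψ) (hκ : IsWhittakerMap π ψ κ) :
    ∃ v, IsSphericalWhittaker π ψ κ v := by
  obtain ⟨h0, v, hv, hv0, hT⟩ := isSatakeParameter_satake hπ hunr
  have hE : IsHeckeEigenvector π _ v := ⟨hv, hv0, hT⟩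
  have h1 := hκ.one_ne_zero hψ hE
  refine ⟨(κ v 1)⁻¹ • v, hπ, hunit, hψ, hκ, h0, ⟨Submodule.smul_mem _ _ hv,
    smul_ne_zero (inv_ne_zero h1) hv0, fun ϖ hϖ => ?_⟩, ?_⟩
  · rw [heckeT_smul, hT ϖ hϖ, smul_comm]
  · rw [map_smul, Pi.smul_apply, smul_eq_mul, inv_mul_cancel₀ h1]

lemma sqrt_q_mul_self : (Real.sqrt (q F) : ℂ) * Real.sqrt (q F) = q F := by
  rw [← Complex.ofReal_mul, Real.mul_self_sqrt (Nat.cast_nonneg _), Complex.ofReal_natCast]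

lemma sqrt_q_ne_zero : (Real.sqrt (q F) : ℂ) ≠ 0 := by
  exact_mod_cast (sqrt_q_pos (F := F)).ne'

lemma one_lt_sqrt_q : 1 < Real.sqrt (q F) := by
  rw [Real.lt_sqrt zero_le_one, one_pow]
  exact_mod_cast one_lt_q (F := F)

/-- The value of a spherical Whittaker function at an element of the torus of valuation `n`. -/
noncomputable def torusValue (κ : V →ₗ[ℂ] (PGL(2, F) → ℂ)) (v : V) (n : ℤ) : ℂ :=
  κ v (torus (uniformizer F ^ n))

namespace IsSphericalWhittaker

variable (h : IsSphericalWhittaker π ψ κ v)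
include h

lemma apply_torus (a : Fˣ) : κ v (torus a) = torusValue κ v (ord (a : F)) :=
  h.map.torus_eq_of_ord h.hecke.mem (by rw [ord_zpow_units, ord_uniformizer, mul_one])

lemma torusValue_neg {n : ℤ} (hn : n < 0) : torusValue κ v n = 0 :=
  h.map.torus_eq_zero h.addChar h.hecke.mem
    (by rw [ord_zpow_units, ord_uniformizer, mul_one]; exact hn)

lemma torusValue_zero : torusValue κ v 0 = 1 := by
  rw [torusValue, zpow_zero, torus_one, h.normalized]

lemma torusValue_recurrence {n : ℤ} (hn : 0 ≤ n) :
    (q F : ℂ) * torusValue κ v (n + 1) + torusValue κ v (n - 1) =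
      ((Real.sqrt (q F) : ℂ) * (satake π + (satake π)⁻¹)) * torusValue κ v n := by
  have h1 := h.map.torus_recurrence h.addChar h.hecke ord_uniformizer
    (a := uniformizer F ^ n) (by rw [ord_zpow_units, ord_uniformizer, mul_one]; exact hn)
  rw [torusValue, torusValue, torusValue, zpow_add_one, zpow_sub_one]
  exact h1

lemma satake_bound : starRingEnd ℂ (satake π + (satake π)⁻¹) = satake π + (satake π)⁻¹ ∧
    ‖satake π‖ < Real.sqrt (q F) ∧ ‖(satake π)⁻¹‖ < Real.sqrt (q F) := by
  obtain ⟨h1, h2⟩ := h.map.eigenvalue_bound h.addChar h.hecke h.unitary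
  have hreal : starRingEnd ℂ (satake π + (satake π)⁻¹) = satake π + (satake π)⁻¹ := by
    rw [map_mul, Complex.conj_ofReal] at h1
    exact mul_left_cancel₀ sqrt_q_ne_zero h1
  refine ⟨hreal, norm_lt_of_add_inv h.satake_ne_zero one_lt_sqrt_q hreal ?_⟩
  have hs := sqrt_q_pos (F := F)
  rw [norm_mul, Complex.norm_real, Real.norm_of_nonneg hs.le] at h2
  rw [← mul_lt_mul_iff_right₀ hs, mul_add, mul_inv_cancel₀ hs.ne',
    Real.mul_self_sqrt (Nat.cast_nonneg _)]
  exact h2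

lemma conj_torusValue (n : ℤ) : starRingEnd ℂ (torusValue κ v n) = torusValue κ v n := by
  rcases lt_or_ge n 0 with hn | hn
  · rw [h.torusValue_neg hn, map_zero]
  have hl : starRingEnd ℂ ((Real.sqrt (q F) : ℂ) * (satake π + (satake π)⁻¹)) =
      (Real.sqrt (q F) : ℂ) * (satake π + (satake π)⁻¹) := by
    rw [map_mul, Complex.conj_ofReal, h.satake_bound.1]
  have hstep : ∀ n : ℤ, 0 ≤ n → starRingEnd ℂ (torusValue κ v n) = torusValue κ v n →
      starRingEnd ℂ (torusValue κ v (n - 1)) = torusValue κ v (n - 1) →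
      starRingEnd ℂ (torusValue κ v (n + 1)) = torusValue κ v (n + 1) := by
    intro n hn h1 h2
    have h3 := h.torusValue_recurrence hn
    have h4 := congrArg (starRingEnd ℂ) h3
    rw [map_add, map_mul, map_mul, hl, h1, h2, map_natCast, ← h3] at h4
    exact mul_left_cancel₀ q_ne_zero (add_right_cancel h4)
  have key : ∀ n : ℕ, starRingEnd ℂ (torusValue κ v n) = torusValue κ v n ∧
      starRingEnd ℂ (torusValue κ v ((n : ℤ) - 1)) = torusValue κ v ((n : ℤ) - 1) := by
    intro n
    induction n with
    | zero =>
      rw [Nat.cast_zero, h.torusValue_zero, map_one, h.torusValue_neg (by omega), map_zero]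
      exact ⟨rfl, rfl⟩
    | succ n ih =>
      rw [Nat.cast_succ, add_sub_cancel_right]
      exact ⟨hstep n (by omega) ih.1 ih.2, ih.1⟩
  obtain ⟨m, rfl⟩ := Int.eq_ofNat_of_zero_le hn
  exact (key m).1

/-- Multiplying by `q ^ (n / 2)` removes `q` from the Hecke recurrence, leaving the one solved by
characters of `SL₂` at `diag(α, α⁻¹)`. -/
lemma scaled_recurrence :
    (Real.sqrt (q F) : ℂ) ^ 0 * torusValue κ v (0 : ℕ) = 1 ∧
    (Real.sqrt (q F) : ℂ) ^ 1 * torusValue κ v (1 : ℕ) = satake π + (satake π)⁻¹ ∧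
    ∀ n : ℕ, (Real.sqrt (q F) : ℂ) ^ (n + 2) * torusValue κ v (n + 2 : ℕ) =
      (satake π + (satake π)⁻¹) * ((Real.sqrt (q F) : ℂ) ^ (n + 1) * torusValue κ v (n + 1 : ℕ)) -
        (Real.sqrt (q F) : ℂ) ^ n * torusValue κ v n := by
  refine ⟨by rw [pow_zero, one_mul, Nat.cast_zero, h.torusValue_zero], ?_, fun n => ?_⟩
  · have h1 := h.torusValue_recurrence le_rfl
    rw [h.torusValue_neg (n := 0 - 1) (by omega), h.torusValue_zero, zero_add, mul_one, add_zero,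
      ← sqrt_q_mul_self, mul_assoc] at h1
    rw [pow_one, Nat.cast_one]
    exact mul_left_cancel₀ sqrt_q_ne_zero h1
  · have h1 := h.torusValue_recurrence (n := n + 1) (by omega)
    rw [add_sub_cancel_right, ← sqrt_q_mul_self, add_assoc, one_add_one_eq_two] at h1
    push_cast
    linear_combination (Real.sqrt (q F) : ℂ) ^ n * h1

/-- The boundary case `‖Y‖ √q = 1` is allowed because the Satake bounds are strict. -/
lemma genFun {Y : ℂ} (hY : ‖Y‖ * Real.sqrt (q F) ≤ 1) :
    (1 - satake π * Y) * (1 - (satake π)⁻¹ * Y) ≠ 0 ∧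
      HasSum (fun n : ℤ => torusValue κ v n * ((Real.sqrt (q F) : ℂ) * Y) ^ n)
        ((1 - satake π * Y) * (1 - (satake π)⁻¹ * Y))⁻¹ := by
  obtain ⟨-, hb, hb'⟩ := h.satake_bound
  obtain ⟨h0, h1, h2⟩ := h.scaled_recurrence
  have hY1 : max ‖satake π‖ ‖(satake π)⁻¹‖ * ‖Y‖ < 1 := by
    rcases eq_or_ne Y 0 with rfl | hY0
    · simp
    · refine lt_of_lt_of_le ?_ hY
      rw [mul_comm]
      exact mul_lt_mul_of_pos_left (max_lt hb hb') (norm_pos_iff.2 hY0)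
  obtain ⟨hs, ht⟩ := recurrence_genFun (x := fun n : ℕ => (Real.sqrt (q F) : ℂ) ^ n *
    torusValue κ v n) h0 h1 h2 h.satake_ne_zero rfl (le_max_left _ _) (le_max_right _ _) hY1
  have hs' := hs.hasSum
  refine ⟨right_ne_zero_of_mul_eq_one ht, ?_⟩
  rw [eq_inv_of_mul_eq_one_left ht] at hs'
  rw [← Function.Injective.hasSum_iff Nat.cast_injective (fun n hn => ?_)]
  · refine hasSum_of_forall_eq hs' fun n => ?_
    rw [Function.comp_apply, zpow_natCast, mul_pow]
    ring
  · rw [h.torusValue_neg, zero_mul]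
    by_contra! h3
    obtain ⟨m, rfl⟩ := Int.eq_ofNat_of_zero_le h3
    exact hn ⟨m, rfl⟩

lemma hasSum_sq : ∃ A : ℂ, HasSum (fun n : ℤ => torusValue κ v n * torusValue κ v n) A ∧
    ((1 - (q F : ℂ)⁻¹) ^ 2 * (1 - satake π ^ 2 * (q F : ℂ)⁻¹) *
      (1 - (satake π)⁻¹ ^ 2 * (q F : ℂ)⁻¹)) * A = 1 - (q F : ℂ)⁻¹ ^ 2 := by
  obtain ⟨-, hb, hb'⟩ := h.satake_bound
  obtain ⟨h0, h1, h2⟩ := h.scaled_recurrence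
  have hq : (0 : ℝ) < q F := by exact_mod_cast q_pos
  have hX : max ‖satake π‖ ‖(satake π)⁻¹‖ ^ 2 * ‖(q F : ℂ)⁻¹‖ < 1 := by
    have hn : ‖(q F : ℂ)⁻¹‖ = (q F : ℝ)⁻¹ := by rw [norm_inv, Complex.norm_natCast]
    rw [hn, mul_inv_lt_iff₀ hq, one_mul, ← Real.sq_sqrt hq.le]
    exact pow_lt_pow_left₀ (max_lt hb hb') (le_max_of_le_left (norm_nonneg _)) two_ne_zero
  obtain ⟨hs, ht⟩ := recurrence_sq_sum (x := fun n : ℕ => (Real.sqrt (q F) : ℂ) ^ n *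
    torusValue κ v n) h0 h1 h2 h.satake_ne_zero rfl (le_max_left _ _) (le_max_right _ _) hX
  refine ⟨_, ?_, ht⟩
  rw [← Function.Injective.hasSum_iff Nat.cast_injective (fun n hn => ?_)]
  · refine hasSum_of_forall_eq hs.hasSum fun n => ?_
    rw [Function.comp_apply, mul_pow, ← pow_mul, mul_comm n 2, pow_mul, sq (Real.sqrt (q F) : ℂ),
      sqrt_q_mul_self, inv_pow]
    have : (q F : ℂ) ^ n ≠ 0 := pow_ne_zero _ q_ne_zero
    field_simp
  · rw [h.torusValue_neg, zero_mul]
    by_contra! h3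
    obtain ⟨m, rfl⟩ := Int.eq_ofNat_of_zero_le h3
    exact hn ⟨m, rfl⟩

lemma continuous_apply_torus (w : V) : Continuous fun a : Fˣ => κ w (torus a) := by
  have h1 : IsLocallyConstant (κ w) :=
    isLocallyConstant_of_mul_right (h.admissible.smooth w) (rep_one w) fun g u hu => by
      rw [← h.map.rep_apply, show π u w = w from hu]
  exact h1.continuous.comp continuous_torus

variable [MeasurableSpace F] [BorelSpace F] {ν : Measure Fˣ} [ν.IsHaarMeasure]

/-- Borel translates of `v` span `V`. On the torus such a translate has the absolute value of a
shift of `W`, so square summability of `W` suffices. -/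
lemma memLp_torus (hν : ν {a : Fˣ | ord (a : F) = 0} = 1) (w : V) :
    MemLp (fun a : Fˣ => κ w (torus a)) 2 ν := by
  have hw : w ∈ Submodule.span ℂ (Set.range fun p : F × Fˣ => π (unip p.1 * torus p.2) v) := by
    rw [span_borel h.admissible.irreducible h.hecke.mem h.hecke.ne_zero]
    trivial
  induction hw using Submodule.span_induction with
  | mem w hw =>
    obtain ⟨⟨x, y⟩, rfl⟩ := hw
    rw [memLp_two_iff_integrable_sq_norm (h.continuous_apply_torus _).aestronglyMeasurable]
    obtain ⟨A, hA, -⟩ := h.hasSum_sq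
    have h1 := ((integrable_ord_iff hν).2 hA.summable).norm.comp_mul_right y
    refine h1.congr (Filter.Eventually.of_forall fun a => ?_)
    simp only [h.map.rep_borel, h.apply_torus, norm_mul, Circle.norm_coe, one_mul, sq]
  | zero =>
    simp only [map_zero, Pi.zero_apply]
    exact MemLp.zero'
  | add w w' _ _ hw hw' =>
    simp only [map_add, Pi.add_apply]
    exact hw.add hw'
  | smul c w _ hw =>
    simp only [map_smul, Pi.smul_apply]
    exact hw.const_smul c

lemma integrable_theta (hν : ν {a : Fˣ | ord (a : F) = 0} = 1) (w w' : V) :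
    Integrable (fun a : Fˣ => κ w (torus a) * starRingEnd ℂ (κ w' (torus a))) ν :=
  (h.memLp_torus hν w).integrable_mul (h.memLp_torus hν w').star

/-- The factor depends on `α` only through `α + α⁻¹`, which is real. -/
lemma conj_lFactor : starRingEnd ℂ (lFactorRankinSelberg π 1) = lFactorRankinSelberg π 1 := by
  have hα := mul_inv_cancel₀ h.satake_ne_zero
  have e : lFactorRankinSelberg π 1 = ((1 - (q F : ℂ)⁻¹) ^ 2 * ((1 + (q F : ℂ)⁻¹) ^ 2 -
      (satake π + (satake π)⁻¹) ^ 2 * (q F : ℂ)⁻¹))⁻¹ := by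
    rw [lFactorRankinSelberg, Complex.cpow_neg_one, mul_assoc]
    congr 2
    linear_combination (2 * (q F : ℂ)⁻¹ + (q F : ℂ)⁻¹ ^ 2 * (satake π * (satake π)⁻¹ + 1)) * hα
  rw [e]
  simp only [map_inv₀, map_mul, map_pow, map_sub, map_one, map_add, map_natCast]
  rw [← map_inv₀, ← map_add, h.satake_bound.1]

/-- The normalizing `L`-factor cancels everything in the sum of squares except `1 - q⁻²`, whose
inverse is `ζ(2)`. -/
lemma thetaNat_self (hν : ν {a : Fˣ | ord (a : F) = 0} = 1) :
    thetaNat ν π (κ v) (κ v) = 1 - (q F : ℂ)⁻¹ ^ 2 := by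
  obtain ⟨A, hA, hA'⟩ := h.hasSum_sq
  have h1 := integral_ord hν hA.summable
  rw [thetaNat, lFactorRankinSelberg, inv_inv, Complex.cpow_neg_one, ← hA', ← hA.tsum_eq, ← h1]
  simp only [h.apply_torus, h.conj_torusValue]

/-- The inner product `θ♮` is invariant and definite. -/
theorem exists_thetaForm (hν : ν {a : Fˣ | ord (a : F) = 0} = 1) : ∃ Θ : V → V →ₗ[ℂ] ℂ,
    (∀ w w', Θ w w' = thetaNat ν π (κ w') (κ w)) ∧
    (∀ w w', starRingEnd ℂ (Θ w w') = Θ w' w) ∧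
    (∀ g w w', Θ (π g w) (π g w') = Θ w w') ∧ (∀ w, w ≠ 0 → Θ w w ≠ 0) := by
  set Θ : V → V →ₗ[ℂ] ℂ := fun w =>
    { toFun := fun w' => thetaNat ν π (κ w') (κ w)
      map_add' := fun a b => by
        rw [thetaNat, thetaNat, thetaNat, ← mul_add, ← integral_add (h.integrable_theta hν a w)
          (h.integrable_theta hν b w)]
        simp only [map_add, Pi.add_apply, add_mul]
      map_smul' := fun c a => by
        rw [thetaNat, thetaNat, RingHom.id_apply, smul_eq_mul, mul_left_comm]
        congr 1
        rw [← integral_const_mul]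
        simp only [map_smul, Pi.smul_apply, smul_eq_mul, mul_assoc] } with hΘ
  have hΘ' : ∀ w w', Θ w w' = thetaNat ν π (κ w') (κ w) := fun w w' => rfl
  have hsymm : ∀ w w', starRingEnd ℂ (Θ w w') = Θ w' w := fun w w' => by
    rw [hΘ', hΘ', thetaNat, thetaNat, map_mul, map_inv₀, h.conj_lFactor, ← integral_conj]
    congr 2
    funext a
    rw [map_mul, Complex.conj_conj, mul_comm]
  -- The torus integral shows only Borel invariance: `ψ` has absolute value one and `ν` is
  -- translation invariant.
  have hB : IsBorelForm π Θ := by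
    refine ⟨hsymm, fun x w w' => ?_, fun y w w' => ?_⟩
    · rw [hΘ', hΘ', thetaNat, thetaNat]
      congr 2
      funext a
      rw [h.map.rep_apply, h.map.rep_apply, h.map.torus_unip, h.map.torus_unip,
        map_mul (starRingEnd ℂ), mul_mul_mul_comm, Complex.mul_conj, Circle.normSq_coe, Complex.ofReal_one, one_mul]
    · rw [hΘ', hΘ', thetaNat, thetaNat]
      congr 1
      have := integral_mul_right_eq_self (μ := ν)
        (fun a : Fˣ => κ w' (torus a) * starRingEnd ℂ (κ w (torus a))) y
      simp only [torus_mul] at this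
      simp only [h.map.rep_apply]
      exact this
  obtain ⟨D, hD, hpos, hinv⟩ := exists_invariant_form h.unitary
  have hDB : IsBorelForm π D := ⟨hD, fun x => hinv _, fun y => hinv _⟩
  obtain ⟨N, hN⟩ := Complex.conj_eq_iff_real.1 (hD v v)
  have hN0 : 0 < N := by
    have := hpos v h.hecke.ne_zero
    rwa [hN, Complex.ofReal_re] at this
  have hN0' : (N : ℂ) ≠ 0 := by exact_mod_cast hN0.ne'
  set t : ℝ := 1 - (q F : ℝ)⁻¹ ^ 2 with ht
  have htv : Θ v v = t := by
    rw [hΘ', h.thetaNat_self hν, ht]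
    push_cast
    rfl
  have ht0 : t ≠ 0 := by
    have h1 : (1 : ℝ) < q F := by exact_mod_cast one_lt_q (F := F)
    have h2 : (q F : ℝ)⁻¹ < 1 := inv_lt_one_of_one_lt₀ h1
    have h3 : 0 < (q F : ℝ)⁻¹ := by positivity
    rw [ht]
    nlinarith
  -- The multiple `t / N` matches the two forms at `v`. Rigidity then makes `Θ` proportional to the
  -- unitary form, hence invariant under the whole group and definite.
  have hz : ∀ w w', Θ w w' = (t / N : ℝ) * D w w' := by
    intro w w'
    have := (hB.sub_smul hDB (t / N)).eq_zero h.admissible.irreducible h.hecke (by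
      rw [LinearMap.sub_apply, LinearMap.smul_apply, htv, hN, smul_eq_mul]
      push_cast
      field_simp
      ring) w w'
    rw [LinearMap.sub_apply, LinearMap.smul_apply, sub_eq_zero] at this
    exact this
  refine ⟨Θ, hΘ', hsymm, fun g w w' => by rw [hz, hz, hinv], fun w hw h1 => ?_⟩
  rw [hz, mul_eq_zero] at h1
  rcases h1 with h1 | h1
  · rw [Complex.ofReal_eq_zero] at h1
    exact (div_ne_zero ht0 hN0.ne') h1
  · have := hpos w hw
    rw [h1] at this
    exact lt_irrefl _ this

end IsSphericalWhittaker

end Spherical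

end LocalSpherical

namespace LocalSpherical

/-! ### The functionals `λ♮` and their continuation -/

section Lambda

variable {F : Type*} [Field F] [ValuativeRel F] [TopologicalSpace F] [IsNonarchimedeanLocalField F]
  {V : Type*} [AddCommGroup V] [Module ℂ V] {π : Representation ℂ PGL(2, F) V}
  {ψ : AddChar F Circle} {κ : V →ₗ[ℂ] (PGL(2, F) → ℂ)} {v : V}

lemma continuous_absF_cpow (s : ℂ) : Continuous fun a : Fˣ => (absF a : ℂ) ^ s := by
  simp only [absF_cpow]
  exact (continuous_of_discreteTopology (f := fun n : ℤ => ((q F : ℂ) ^ (-s)) ^ n)).comp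
    continuous_ord

lemma absF_unit_mul {u : Fˣ} (hu : ord (u : F) = 0) (a : Fˣ) : absF (u * a) = absF a := by
  rw [absF_eq, absF_eq, ord_mul_units, hu, zero_add]

lemma norm_q_cpow_le_one {s : ℂ} (hs : 0 < s.re) : ‖(q F : ℂ) ^ (-s)‖ ≤ 1 := by
  rw [Complex.norm_natCast_cpow_of_pos q_pos, Complex.neg_re]
  exact Real.rpow_le_one_of_one_le_of_nonpos (by exact_mod_cast q_pos) (by linarith)

lemma sqrt_q_eq_cpow : (Real.sqrt (q F) : ℂ) = (q F : ℂ) ^ (1 / 2 : ℂ) := by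
  rw [Real.sqrt_eq_rpow, Complex.ofReal_cpow (Nat.cast_nonneg _)]
  push_cast
  rfl

variable [MeasurableSpace F]

/-- The identity theorem: two entire functions agreeing on a right half plane coincide. -/
lemma IsLambdaNat.unique {ν : Measure Fˣ} {W : PGL(2, F) → ℂ} {χ : Fˣ → ℂ} {Λ Λ' : ℂ → ℂ}
    (h : IsLambdaNat ν π W χ Λ) (h' : IsLambdaNat ν π W χ Λ') : Λ = Λ' := by
  obtain ⟨hd, σ, hσ⟩ := h
  obtain ⟨hd', σ', hσ'⟩ := h'
  have ho : IsOpen {s : ℂ | max σ σ' < s.re} := isOpen_lt continuous_const Complex.continuous_re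
  refine AnalyticOnNhd.eq_of_eventuallyEq (z₀ := ((max σ σ' + 1 : ℝ) : ℂ))
    (fun z _ => hd.analyticAt z) (fun z _ => hd'.analyticAt z) ?_
  filter_upwards [ho.mem_nhds (by
    rw [Set.mem_ofPred_eq, Complex.ofReal_re]
    exact lt_add_one _)] with s hs
  have hs' := max_lt_iff.1 hs
  rw [(hσ s hs'.1).2, (hσ' s hs'.2).2]

lemma lambdaNat_eq {ν : Measure Fˣ} {W : PGL(2, F) → ℂ} {χ : Fˣ → ℂ} {Λ : ℂ → ℂ}
    (h : IsLambdaNat ν π W χ Λ) (s : ℂ) : lambdaNat ν π W χ s = Λ s := by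
  have := Classical.epsilon_spec (p := IsLambdaNat ν π W χ) ⟨Λ, h⟩
  rw [lambdaNat, this.unique h]

lemma IsLambdaNat.add {ν : Measure Fˣ} {W W' : PGL(2, F) → ℂ} {χ : Fˣ → ℂ} {Λ Λ' : ℂ → ℂ}
    (h : IsLambdaNat ν π W χ Λ) (h' : IsLambdaNat ν π W' χ Λ') :
    IsLambdaNat ν π (fun g => W g + W' g) χ fun s => Λ s + Λ' s := by
  obtain ⟨hd, σ, hσ⟩ := h
  obtain ⟨hd', σ', hσ'⟩ := h'
  refine ⟨hd.add hd', max σ σ', fun s hs => ?_⟩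
  have hs' := max_lt_iff.1 hs
  obtain ⟨hi, he⟩ := hσ s hs'.1
  obtain ⟨hi', he'⟩ := hσ' s hs'.2
  simp only [add_mul]
  exact ⟨hi.add hi', by rw [integral_add hi hi', mul_add, he, he']⟩

lemma IsLambdaNat.const_mul {ν : Measure Fˣ} {W : PGL(2, F) → ℂ} {χ : Fˣ → ℂ} {Λ : ℂ → ℂ}
    (h : IsLambdaNat ν π W χ Λ) (c : ℂ) :
    IsLambdaNat ν π (fun g => c * W g) χ fun s => c * Λ s := by
  obtain ⟨hd, σ, hσ⟩ := h
  refine ⟨hd.const_mul c, σ, fun s hs => ?_⟩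
  obtain ⟨hi, he⟩ := hσ s hs
  simp only [mul_assoc] at hi he ⊢
  exact ⟨hi.const_mul c, by rw [integral_const_mul, he]; ring⟩

variable [BorelSpace F] {ν : Measure Fˣ} [ν.IsHaarMeasure]

/-- A zeta integral whose integrand is supported in bounded below valuations and odd under a unit in
large valuations is a finite sum. -/
lemma isLambdaNat_of_shells {W : PGL(2, F) → ℂ} {χ : Fˣ → ℂ} (hχ : ¬ IsUnramifiedChar χ)
    (hint : ∀ s : ℂ, 0 < s.re →
      Integrable (fun a : Fˣ => W (torus a) * χ a * (absF a : ℂ) ^ s) ν) {M N : ℤ}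
    (hM : ∀ a : Fˣ, ord (a : F) < M → W (torus a) = 0) {u : Fˣ} (hu : ord (u : F) = 0)
    (hN : ∀ a : Fˣ, N ≤ ord (a : F) → W (torus (u * a)) * χ (u * a) = -(W (torus a) * χ a)) :
    IsLambdaNat ν π W χ fun s => ∑ n ∈ Finset.Ico M N,
      (∫ a : Fˣ, {a : Fˣ | ord (a : F) = n}.indicator (fun a => W (torus a) * χ a) a ∂ν) *
        ((q F : ℂ) ^ (-s)) ^ n := by
  have hpow : ∀ (n : ℤ) (s : ℂ), ((q F : ℂ) ^ (-s)) ^ n = (q F : ℂ) ^ (-s * n) :=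
    fun n s => (Complex.cpow_mul_int _ _ _).symm
  have hmeas : ∀ n : ℤ, MeasurableSet {a : Fˣ | ord (a : F) = n} := fun n =>
    (isOpen_ord_eq n).measurableSet
  have hmeas' : MeasurableSet {a : Fˣ | N ≤ ord (a : F)} :=
    continuous_ord.measurable measurableSet_Ici
  refine ⟨Differentiable.fun_sum fun n _ => ?_, 0, fun s hs => ⟨hint s hs, ?_⟩⟩
  · simp only [hpow]
    refine Differentiable.const_mul (fun s => ?_) _
    exact ((differentiableAt_id.neg).mul_const _).const_cpow (Or.inl q_ne_zero)
  have hsplit : (fun a : Fˣ => W (torus a) * χ a * (absF a : ℂ) ^ s) = fun a =>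
      ∑ n ∈ Finset.Ico M N, {a : Fˣ | ord (a : F) = n}.indicator
        (fun a => W (torus a) * χ a * (absF a : ℂ) ^ s) a +
      {a : Fˣ | N ≤ ord (a : F)}.indicator (fun a => W (torus a) * χ a * (absF a : ℂ) ^ s) a := by
    funext a
    by_cases h1 : ord (a : F) ∈ Finset.Ico M N
    · rw [Finset.sum_eq_single_of_mem _ h1 fun n _ hn => Set.indicator_of_notMem (fun h => hn h.symm) _,
        Set.indicator_of_mem (show a ∈ {b : Fˣ | ord (b : F) = ord (a : F)} from rfl),
        Set.indicator_of_notMem (fun h => ?_), add_zero]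
      rw [Finset.mem_Ico] at h1
      exact absurd h1.2 (not_lt.2 h)
    · rw [Finset.sum_eq_zero fun n hn => Set.indicator_of_notMem (fun h => h1 ?_) _, zero_add]
      · by_cases h2 : N ≤ ord (a : F)
        · rw [Set.indicator_of_mem (show a ∈ {b : Fˣ | N ≤ ord (b : F)} from h2)]
        · rw [Set.indicator_of_notMem (show a ∉ {b : Fˣ | N ≤ ord (b : F)} from h2), hM a, zero_mul, zero_mul]
          rw [Finset.mem_Ico] at h1
          omega
      · rw [show ord (a : F) = n from h]
        exact hn
  rw [lFactor, if_neg hχ, inv_one, one_mul, hsplit, integral_add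
    (integrable_finsetSum _ fun n _ => (hint s hs).indicator (hmeas n))
    ((hint s hs).indicator hmeas'), integral_finsetSum _
    fun n _ => (hint s hs).indicator (hmeas n), integral_eq_zero_of_twist u fun a => ?_, add_zero]
  · refine Finset.sum_congr rfl fun n _ => ?_
    rw [← integral_mul_const]
    congr 1
    funext a
    by_cases h1 : ord (a : F) = n
    · rw [Set.indicator_of_mem (show a ∈ {b : Fˣ | ord (b : F) = n} from h1),
        Set.indicator_of_mem (show a ∈ {b : Fˣ | ord (b : F) = n} from h1), absF_cpow, h1]
    · rw [Set.indicator_of_notMem (show a ∉ {b : Fˣ | ord (b : F) = n} from h1),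
        Set.indicator_of_notMem (show a ∉ {b : Fˣ | ord (b : F) = n} from h1), zero_mul]
  · have e : ord ((u * a : Fˣ) : F) = ord (a : F) := by rw [ord_mul_units, hu, zero_add]
    by_cases h1 : N ≤ ord (a : F)
    · rw [Set.indicator_of_mem (show a ∈ {b : Fˣ | N ≤ ord (b : F)} from h1),
        Set.indicator_of_mem (show u * a ∈ {b : Fˣ | N ≤ ord (b : F)} from by
          rw [Set.mem_ofPred_eq, e]; exact h1), hN a h1,
        absF_unit_mul hu, neg_mul]
    · rw [Set.indicator_of_notMem (show a ∉ {b : Fˣ | N ≤ ord (b : F)} from h1),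
        Set.indicator_of_notMem (show u * a ∉ {b : Fˣ | N ≤ ord (b : F)} from by
          rw [Set.mem_ofPred_eq, e]; exact h1), neg_zero]

namespace IsSphericalWhittaker

variable (h : IsSphericalWhittaker π ψ κ v)
include h

/-- It suffices to treat Borel translates of `v`, where the integrand is dominated by a shift of the
series in `genFun` at `Y = q⁻ˢ / √q`. -/
lemma integrable_mellin (hν : ν {a : Fˣ | ord (a : F) = 0} = 1) {χ : Fˣ → ℂ} (hχ : Continuous χ)
    (hχ1 : ∀ a, ‖χ a‖ = 1) (w : V) {s : ℂ} (hs : 0 < s.re) :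
    Integrable (fun a : Fˣ => κ w (torus a) * χ a * (absF a : ℂ) ^ s) ν := by
  have hw : w ∈ Submodule.span ℂ (Set.range fun p : F × Fˣ => π (unip p.1 * torus p.2) v) := by
    rw [span_borel h.admissible.irreducible h.hecke.mem h.hecke.ne_zero]
    trivial
  induction hw using Submodule.span_induction with
  | mem w hw =>
    obtain ⟨⟨x, y⟩, rfl⟩ := hw
    set z : ℂ := (q F : ℂ) ^ (-s) with hz
    have hz0 : z ≠ 0 := by
      rw [hz, Complex.cpow_def_of_ne_zero q_ne_zero]
      exact Complex.exp_ne_zero _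
    have hY : ‖z / Real.sqrt (q F)‖ * Real.sqrt (q F) ≤ 1 := by
      rw [norm_div, Complex.norm_real, Real.norm_of_nonneg (Real.sqrt_nonneg _),
        div_mul_cancel₀ _ sqrt_q_pos.ne']
      exact norm_q_cpow_le_one hs
    have h1 := (h.genFun hY).2.summable
    rw [mul_div_cancel₀ _ sqrt_q_ne_zero] at h1
    have h2 : Summable fun n : ℤ => torusValue κ v (n + ord (y : F)) * z ^ n := by
      have h3 := (h1.comp_injective (add_left_injective (ord (y : F)))).mul_right
        (z ^ (ord (y : F)))⁻¹
      refine h3.congr fun n => ?_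
      rw [Function.comp_apply, zpow_add₀ hz0, mul_assoc, mul_assoc,
        mul_inv_cancel₀ (zpow_ne_zero _ hz0), mul_one]
    refine ((integrable_ord_iff hν).2 h2).mono
      (((h.continuous_apply_torus _).mul hχ).mul
        (continuous_absF_cpow s)).aestronglyMeasurable (Filter.Eventually.of_forall fun a => ?_)
    rw [h.map.rep_borel, h.apply_torus, norm_mul, norm_mul, norm_mul, Circle.norm_coe, one_mul, hχ1,
      mul_one, absF_cpow, ord_mul_units, ← norm_mul]
  | zero => simp
  | add w w' _ _ hw hw' =>
    simp only [map_add, Pi.add_apply, add_mul]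
    exact hw.add hw'
  | smul c w _ hw =>
    simp only [map_smul, Pi.smul_apply, smul_eq_mul, mul_assoc] at hw ⊢
    exact hw.const_mul c

lemma integrable_mellin_conj (hν : ν {a : Fˣ | ord (a : F) = 0} = 1) {χ : Fˣ → ℂ}
    (hχ : Continuous χ) (hχ1 : ∀ a, ‖χ a‖ = 1) (w : V) {s : ℂ} (hs : 0 < s.re) :
    Integrable (fun a : Fˣ => starRingEnd ℂ (κ w (torus a)) * χ a * (absF a : ℂ) ^ s) ν := by
  refine (h.integrable_mellin hν hχ hχ1 w hs).mono
    ((((Complex.continuous_conj.comp (h.continuous_apply_torus w))).mul hχ).mul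
      (continuous_absF_cpow s)).aestronglyMeasurable (Filter.Eventually.of_forall fun a => ?_)
  simp only [norm_mul, RCLike.norm_conj, le_refl]

/-- The functional `λ♮(·, 1, s)` takes the value `1` on the normalized spherical vector and vanishes
on vectors that are odd under a unit of the torus. -/
lemma lambdaNat_one (hν : ν {a : Fˣ | ord (a : F) = 0} = 1) (c : ℂ) {w : V} {u : Fˣ}
    (hu : ord (u : F) = 0) (hw : π (torus u) w = -w) (s : ℂ) :
    lambdaNat ν π (κ (c • v + w)) (fun _ => 1) s = c := by
  refine lambdaNat_eq (Λ := fun _ => c) ⟨differentiable_const c, 0, fun s hs => ?_⟩ s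
  have hi := fun w => h.integrable_mellin hν (χ := fun _ => 1) continuous_const
    (fun _ => norm_one) w hs
  refine ⟨hi _, ?_⟩
  -- With this `Y` the zeta integral of `v` is exactly `L(π, s + 1/2)`, so the normalized value is
  -- one.
  set Y : ℂ := (q F : ℂ) ^ (-(s + 1 / 2)) with hYdef
  have hsY : (Real.sqrt (q F) : ℂ) * Y = (q F : ℂ) ^ (-s) := by
    rw [sqrt_q_eq_cpow, hYdef, ← Complex.cpow_add _ _ q_ne_zero]
    congr 1
    ring
  have hY : ‖Y‖ * Real.sqrt (q F) ≤ 1 := by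
    have h1 := norm_q_cpow_le_one (F := F) hs
    rwa [← hsY, norm_mul, Complex.norm_real, Real.norm_of_nonneg (Real.sqrt_nonneg _),
      mul_comm] at h1
  obtain ⟨hne, hsum⟩ := h.genFun hY
  have h1 : ∫ a : Fˣ, κ v (torus a) * 1 * (absF a : ℂ) ^ s ∂ν =
      ((1 - satake π * Y) * (1 - (satake π)⁻¹ * Y))⁻¹ := by
    rw [← hsum.tsum_eq, ← integral_ord hν hsum.summable]
    simp only [h.apply_torus, mul_one, absF_cpow, hsY]
  have h2 : ∫ a : Fˣ, κ w (torus a) * 1 * (absF a : ℂ) ^ s ∂ν = 0 := by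
    refine integral_eq_zero_of_twist u fun a => ?_
    rw [absF_unit_mul hu, mul_comm u, torus_mul, ← h.map.rep_apply, hw, map_neg, Pi.neg_apply]
    ring
  have h3 : ∫ a : Fˣ, κ (c • v + w) (torus a) * 1 * (absF a : ℂ) ^ s ∂ν =
      c * ((1 - satake π * Y) * (1 - (satake π)⁻¹ * Y))⁻¹ := by
    rw [← h1, ← add_zero (c * _), ← h2, ← integral_const_mul, ← integral_add
      ((hi v).const_mul c) (hi w)]
    congr 1
    funext a
    rw [map_add, map_smul, Pi.add_apply, Pi.smul_apply, smul_eq_mul]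
    ring
  rw [h3, lFactor, if_pos (show IsUnramifiedChar (F := F) fun _ => 1 from fun _ _ => rfl)]
  simp only [mul_one]
  rw [← hYdef, inv_inv, mul_left_comm, mul_inv_cancel₀ hne, mul_one]

end IsSphericalWhittaker

/-- Ramified quadratic characters (in odd residue characteristic). -/
structure IsRamifiedQuadraticChar (η : Fˣ → ℂ) : Prop where
  map_one : η 1 = 1
  mul_unit : ∀ a u : Fˣ, ord (u : F) = 0 → η (a * u) = η a * etaBar (red (u : F))
  eq_or : ∀ a, η a = 1 ∨ η a = -1

namespace IsRamifiedQuadraticChar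

omit [MeasurableSpace F] [BorelSpace F]

variable {η : Fˣ → ℂ} (hη : IsRamifiedQuadraticChar η)
include hη

lemma norm_eq_one (a : Fˣ) : ‖η a‖ = 1 := by
  rcases hη.eq_or a with h | h <;> simp [h]

lemma continuous : Continuous η := by
  refine (isLocallyConstant_of_mul_left isOpen_red_eq_one (by simp) fun a u hu => ?_).continuous
  rw [mul_comm, hη.mul_unit a u hu.1, hu.2, etaBar_one, mul_one]

lemma not_isUnramifiedChar (hodd : ringChar 𝓀[F] ≠ 2) : ¬ IsUnramifiedChar η := by
  intro h
  obtain ⟨u, hu⟩ := exists_etaBar_eq_neg_one hodd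
  have h1 := hη.mul_unit 1 (liftUnit F u) (ord_liftUnit u)
  rw [red_liftUnit, hu, one_mul, h _ (ord_liftUnit u), h 1 (by simp)] at h1
  norm_num at h1

end IsRamifiedQuadraticChar

namespace IsSphericalWhittaker

variable (h : IsSphericalWhittaker π ψ κ v)
include h

omit [MeasurableSpace F] [BorelSpace F] in
/-- Whittaker functions vanish in small valuations and are constant on large shells. -/
lemma exists_shells {u : Fˣ} (hu : ord (u : F) = 0) (w : V) : ∃ M N : ℤ,
    (∀ a : Fˣ, ord (a : F) < M → κ w (torus a) = 0) ∧
      ∀ a : Fˣ, N ≤ ord (a : F) → κ w (torus (u * a)) = κ w (torus a) := by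
  have hw : w ∈ Submodule.span ℂ (Set.range fun p : F × Fˣ => π (unip p.1 * torus p.2) v) := by
    rw [span_borel h.admissible.irreducible h.hecke.mem h.hecke.ne_zero]
    trivial
  induction hw using Submodule.span_induction with
  | mem w hw =>
    obtain ⟨⟨x, y⟩, rfl⟩ := hw
    obtain ⟨N, hN⟩ : ∃ N : ℤ, ∀ a : Fˣ, N ≤ ord (a : F) → ψ (a * x) = 1 := by
      rcases eq_or_ne x 0 with rfl | hx
      · exact ⟨0, fun a _ => by rw [mul_zero, AddChar.map_zero_eq_one]⟩
      · lift x to Fˣ using hx.isUnit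
        refine ⟨-ord (x : F), fun a ha => addChar_eq_one h.addChar ?_⟩
        rw [← Units.val_mul, units_mem_integer_iff, ord_mul_units]
        omega
    refine ⟨-ord (y : F), N, fun a ha => ?_, fun a ha => ?_⟩
    · have h1 : ord (a : F) + ord (y : F) < 0 := by omega
      rw [h.map.rep_borel, h.apply_torus, ord_mul_units, h.torusValue_neg h1, mul_zero]
    · rw [h.map.rep_borel, h.map.rep_borel, hN a ha, hN (u * a) (by
        rw [ord_mul_units, hu, zero_add]; exact ha), h.apply_torus, h.apply_torus, mul_assoc,
        ord_mul_units, hu, zero_add]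
  | zero => exact ⟨0, 0, fun _ _ => by simp, fun _ _ => by simp⟩
  | add w w' _ _ hw hw' =>
    obtain ⟨M, N, h1, h2⟩ := hw
    obtain ⟨M', N', h1', h2'⟩ := hw'
    refine ⟨min M M', max N N', fun a ha => ?_, fun a ha => ?_⟩
    · rw [map_add, Pi.add_apply, h1 a (lt_of_lt_of_le ha (min_le_left _ _)),
        h1' a (lt_of_lt_of_le ha (min_le_right _ _)), add_zero]
    · rw [map_add, Pi.add_apply, Pi.add_apply, h2 a ((le_max_left _ _).trans ha),
        h2' a ((le_max_right _ _).trans ha)]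
  | smul c w _ hw =>
    obtain ⟨M, N, h1, h2⟩ := hw
    refine ⟨M, N, fun a ha => ?_, fun a ha => ?_⟩
    · rw [map_smul, Pi.smul_apply, h1 a ha, smul_zero]
    · rw [map_smul, Pi.smul_apply, Pi.smul_apply, h2 a ha]

variable {η : Fˣ → ℂ}

/-- From `N` on, invariance of `W` under `u` meets `η(u) = -1`, so those valuations contribute zero
and the zeta integral is a Laurent polynomial in `q⁻ˢ`. -/
lemma isLambdaNat_conj (hν : ν {a : Fˣ | ord (a : F) = 0} = 1) (hodd : ringChar 𝓀[F] ≠ 2)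
    (hη : IsRamifiedQuadraticChar η) {w : V} {M N : ℤ} {u : Fˣ} (hu : ord (u : F) = 0)
    (hu' : etaBar (red (u : F)) = -1) (hM : ∀ a : Fˣ, ord (a : F) < M → κ w (torus a) = 0)
    (hN : ∀ a : Fˣ, N ≤ ord (a : F) → κ w (torus (u * a)) = κ w (torus a)) :
    IsLambdaNat ν π (fun g => starRingEnd ℂ (κ w g)) η fun s => ∑ n ∈ Finset.Ico M N,
      (∫ a : Fˣ, {a : Fˣ | ord (a : F) = n}.indicator
        (fun a => starRingEnd ℂ (κ w (torus a)) * η a) a ∂ν) * ((q F : ℂ) ^ (-s)) ^ n :=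
  isLambdaNat_of_shells (W := fun g => starRingEnd ℂ (κ w g)) (χ := η) (M := M) (N := N)
    (hη.not_isUnramifiedChar hodd)
    (fun s hs => h.integrable_mellin_conj hν hη.continuous hη.norm_eq_one w (s := s) hs)
    (fun a ha => by rw [hM a ha, map_zero]) hu
    (fun a ha => by rw [hN a ha, mul_comm u, hη.mul_unit a u hu, hu']; ring)

/-- The conjugate linear functional `w ↦ λ♮(w̄, η, s)`. -/
lemma exists_conjLambda (hν : ν {a : Fˣ | ord (a : F) = 0} = 1) (hodd : ringChar 𝓀[F] ≠ 2)
    (hη : IsRamifiedQuadraticChar η) (s : ℂ) : ∃ L : V →ₛₗ[starRingEnd ℂ] ℂ,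
      ∀ w, L w = lambdaNat ν π (fun g => starRingEnd ℂ (κ w g)) η s := by
  obtain ⟨u, hu⟩ := exists_etaBar_eq_neg_one hodd
  have key : ∀ w, ∃ Λ, IsLambdaNat ν π (fun g => starRingEnd ℂ (κ w g)) η Λ := by
    intro w
    obtain ⟨M, N, hM, hN⟩ := h.exists_shells (ord_liftUnit u) w
    exact ⟨_, h.isLambdaNat_conj hν hodd hη (ord_liftUnit u) (by rw [red_liftUnit, hu]) hM hN⟩
  choose Λ hΛ using key
  refine ⟨{ toFun := fun w => lambdaNat ν π (fun g => starRingEnd ℂ (κ w g)) η s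
            map_add' := fun w w' => ?_
            map_smul' := fun c w => ?_ }, fun w => rfl⟩
  · have h1 := (hΛ w).add (hΛ w')
    rw [lambdaNat_eq (hΛ w), lambdaNat_eq (hΛ w'), ← lambdaNat_eq h1]
    simp only [map_add, Pi.add_apply]
  · have h1 := (hΛ w).const_mul (starRingEnd ℂ c)
    rw [lambdaNat_eq (hΛ w), smul_eq_mul, ← lambdaNat_eq h1]
    simp only [map_smul, Pi.smul_apply, smul_eq_mul, map_mul]

end IsSphericalWhittaker

end Lambda

end LocalSpherical

namespace LocalSpherical

/-! ### Gauss sums and collapse of the sum over the basis -/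

section Final

variable {F : Type*} [Field F] [ValuativeRel F] [TopologicalSpace F] [IsNonarchimedeanLocalField F]
  {V : Type*} [AddCommGroup V] [Module ℂ V] {π : Representation ℂ PGL(2, F) V}
  {ψ : AddChar F Circle} {κ : V →ₗ[ℂ] (PGL(2, F) → ℂ)} {v : V}

/-- The Gauss sum `∑ η(a u) ψ(a u)` over the residue field. -/
noncomputable def gaussSumAt [Fintype 𝓀[F]] (η : Fˣ → ℂ) (ψ : AddChar F Circle) (a : Fˣ) : ℂ :=
  ∑ u : 𝓀[F], η a * etaBar u * (ψ (a * lift F u) : ℂ)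

section Gauss

variable [Fintype 𝓀[F]] {η : Fˣ → ℂ} (hη : IsRamifiedQuadraticChar η)
  (hψ : IsUnramifiedAddChar ψ)
include hη hψ

/-- The substitution `u ↦ t u` absorbs `η̄(t)`. Different lifts of a class differ by a multiple of a
uniformizer, on which `ψ(a ·)` is trivial since `ord a = -1`. -/
lemma gaussSumAt_mul_unit {a t : Fˣ} (ha : ord (a : F) = -1) (ht : ord (t : F) = 0) :
    gaussSumAt η ψ (a * t) = gaussSumAt η ψ a := by
  have htm := units_mem_of_ord_eq_zero ht
  have ht0 := (red_units_ne_zero_iff t htm).2 ht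
  refine Fintype.sum_equiv (Equiv.mulLeft₀ _ ht0) _ _ fun u => ?_
  rw [Equiv.mulLeft₀_apply, hη.mul_unit a t ht, etaBar_mul, ← mul_assoc]
  congr 2
  have hm : (t : F) * lift F u - lift F (red (t : F) * u) ∈ 𝒪[F] :=
    sub_mem (mul_mem htm (lift F u).2) (lift F _).2
  have hr : red ((t : F) * lift F u - lift F (red (t : F) * u)) = 0 := by
    rw [red_sub (mul_mem htm (lift F u).2) (lift F _).2, red_mul htm (lift F u).2, red_lift,
      red_lift, sub_self]
  have hz := div_mem_of_red_eq_zero hm hr (ϖ := a⁻¹) (by rw [ord_inv_units, ha]; rfl)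
  have e : ((a * t : Fˣ) : F) * lift F u = a * lift F (red (t : F) * u) +
      ((t : F) * lift F u - lift F (red (t : F) * u)) / (a⁻¹ : Fˣ) := by
    push_cast
    rw [div_inv_eq_mul]
    ring
  rw [e, AddChar.map_add_eq_mul, addChar_eq_one hψ hz, mul_one]

lemma gaussSumAt_eq {a a' : Fˣ} (ha : ord (a : F) = -1) (ha' : ord (a' : F) = -1) :
    gaussSumAt η ψ a = gaussSumAt η ψ a' := by
  rw [← gaussSumAt_mul_unit hη hψ ha' (t := a'⁻¹ * a)
    (by rw [ord_mul_units, ord_inv_units, ha, ha']; rfl), mul_inv_cancel_left]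

omit hψ in
lemma conj_gaussSumAt (a : Fˣ) : starRingEnd ℂ (gaussSumAt η ψ a) =
    ∑ u : 𝓀[F], η a * etaBar u * (ψ (-(a * lift F u)) : ℂ) := by
  have h1 : starRingEnd ℂ (η a) = η a := by
    rcases hη.eq_or a with h | h <;> simp [h]
  rw [gaussSumAt, map_sum]
  refine Finset.sum_congr rfl fun u _ => ?_
  rw [map_mul, map_mul, h1, conj_etaBar, AddChar.map_neg_eq_inv, Circle.coe_inv_eq_conj]

/-- Conjugation turns `ψ(x)` into `ψ(-x)`, which amounts to replacing `a` by `-a` at the cost of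
`η(-1)`. -/
lemma gaussSumAt_eq_conj {a : Fˣ} (ha : ord (a : F) = -1) :
    η (-1) * starRingEnd ℂ (gaussSumAt η ψ a) = gaussSumAt η ψ a := by
  have h1 : ord ((-1 : Fˣ) : F) = 0 := by rw [Units.val_neg, ord_neg, Units.val_one, ord_one]
  have h2 := hη.mul_unit 1 (-1) h1
  rw [one_mul, hη.map_one, one_mul] at h2
  conv_rhs => rw [← gaussSumAt_mul_unit hη hψ ha h1]
  rw [conj_gaussSumAt hη, gaussSumAt, Finset.mul_sum, hη.mul_unit a (-1) h1, h2]
  refine Finset.sum_congr rfl fun u _ => ?_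
  rw [mul_neg_one, Units.val_neg a, neg_mul]
  ring

-- Including the class `u = 0` is harmless because `η̄(0) = 0`.
omit hψ in
lemma epsilonFactor_eq (a : Fˣ) : epsilonFactor η ψ a =
    (((q F : ℝ) ^ (-(1 / 2) : ℝ) : ℝ) : ℂ) * gaussSumAt η ψ a := by
  classical
  rw [epsilonFactor, finsum_eq_sum_of_fintype, gaussSumAt]
  congr 1
  refine Finset.sum_of_injOn (fun u : 𝓀[F]ˣ => (u : 𝓀[F])) (fun u _ w _ h => Units.ext h)
    (fun _ _ => Finset.mem_coe.2 (Finset.mem_univ _)) (fun u _ hu => ?_) (fun u _ => ?_)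
  · have hu0 : u = 0 := by
      by_contra h0
      exact hu ⟨Units.mk0 u h0, by simp, rfl⟩
    rw [hu0, etaBar_zero, mul_zero, zero_mul]
  · rw [hη.mul_unit a _ (ord_liftUnit u), red_liftUnit]
    rfl

end Gauss

/-- Expansion of a conjugate linear functional in an orthogonal basis. -/
lemma finsum_orthogonal_basis {ι : Type*} (B : Module.Basis ι ℂ V) {Θ : V → V →ₗ[ℂ] ℂ}
    (hsymm : ∀ w w', starRingEnd ℂ (Θ w w') = Θ w' w) (hne : ∀ w, w ≠ 0 → Θ w w ≠ 0)
    (hB : Pairwise fun i j => Θ (B j) (B i) = 0) (L : V →ₛₗ[starRingEnd ℂ] ℂ) (X : V) :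
    ∑ᶠ i, Θ X (B i) * L (B i) / Θ (B i) (B i) = L X := by
  classical
  have h1 : ∀ j, Θ (B j) X = B.repr X j * Θ (B j) (B j) := by
    intro j
    conv_lhs => rw [← B.linearCombination_repr X, Finsupp.linearCombination_apply, Finsupp.sum,
      map_sum]
    simp only [map_smul, smul_eq_mul]
    by_cases hj : j ∈ (B.repr X).support
    · rw [Finset.sum_eq_single_of_mem j hj fun i _ hij => by rw [hB hij, mul_zero]]
    · rw [Finsupp.notMem_support_iff.1 hj, zero_mul]
      refine Finset.sum_eq_zero fun i hi => ?_
      have hij : i ≠ j := fun h => hj (h ▸ hi)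
      rw [hB hij, mul_zero]
  -- Each term is a conjugated coordinate of `X` times `L (B j)`, matching conjugate linearity of
  -- `L`; in particular only finitely many are nonzero.
  have h2 : ∀ j, Θ X (B j) * L (B j) / Θ (B j) (B j) =
      starRingEnd ℂ (B.repr X j) * L (B j) := by
    intro j
    rw [← hsymm, h1, map_mul, hsymm, mul_right_comm, mul_div_cancel_right₀ _ (hne _ (B.ne_zero j))]
  simp only [h2]
  rw [finsum_eq_sum_of_support_subset (s := (B.repr X).support)]
  · conv_rhs => rw [← B.linearCombination_repr X, Finsupp.linearCombination_apply, Finsupp.sum,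
      map_sum]
    simp only [LinearMap.map_smulₛₗ, smul_eq_mul]
  · intro i hi
    rw [Finset.mem_coe, Finsupp.mem_support_iff]
    intro h0
    exact hi (by simp [h0])

variable (μ : Measure PGL(2, F)) [μ.IsHaarMeasure]

lemma IsWhittakerMap.heckeAction_eq (hκ : IsWhittakerMap π ψ κ)
    (hπ : ∀ v : V, IsOpen {g : PGL(2, F) | π g v = v}) {f : PGL(2, F) → ℂ} (hf : IsTestFun f)
    (w : V) : heckeAction μ f (κ w) = κ (testInt μ fun g => f g • π g w) := by
  funext x
  have h1 := apply_testInt μ (hf.smul (isLocallyConstant_rep hπ w)) (LinearMap.proj x ∘ₗ κ)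
  rw [LinearMap.comp_apply, LinearMap.proj_apply] at h1
  rw [h1, heckeAction]
  simp only [LinearMap.comp_apply, LinearMap.proj_apply, map_smul, smul_eq_mul,
    hκ.rep_apply]

/-- A bi-equivariant averaging operator that is left invariant under the maximal compact subgroup
maps every vector to a multiple of the spherical vector. -/
lemma testInt_eq_smul [Fintype 𝓀[F]] (hπ : IsIrreducibleAdmissible π) {lam : ℂ}
    (hv : IsHeckeEigenvector π lam v) {Θ : V → V →ₗ[ℂ] ℂ}
    (hsymm : ∀ w w', starRingEnd ℂ (Θ w w') = Θ w' w)
    (hinv : ∀ g w w', Θ (π g w) (π g w') = Θ w w') (hne : Θ v v ≠ 0) {ϖ : Fˣ}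
    (hϖ : ord (ϖ : F) = 1) {φ : PGL(2, F) → ℂ} (hφ : IsTestFun φ)
    (hφl : ∀ k ∈ maxCompact F, ∀ g, φ (k * g) = φ g) (hφ0 : ∀ g ∉ detOneSet F, φ g = 0) (w : V) :
    testInt μ (fun g => φ g • π g w) = ((μ.real (maxCompact F : Set PGL(2, F)) : ℂ) / Θ v v *
      Θ (∑ i, starRingEnd ℂ (φ (cosetRep ϖ i)) • π (cosetRep ϖ i)⁻¹ v) w) • v := by
  have ht := hφ.smul (isLocallyConstant_rep hπ.smooth w)
  obtain ⟨c, hc⟩ := fixedVectors_eq_span hπ hv (w := testInt μ fun g => φ g • π g w) fun k hk => by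
    rw [testInt_map μ ht, ← testInt_mul_left μ ht k]
    congr 1
    funext g
    rw [hφl k hk, map_smul, rep_mul]
  -- The scalar is found by pairing with `v` and moving `g` to the other side. The integrand is then
  -- left `K`-invariant, and the integral is a sum over coset representatives.
  have h1 := apply_testInt μ ht (Θ v)
  have h2 : ∀ g, Θ v (φ g • π g w) = φ g * Θ (π g⁻¹ v) w := fun g => by
    rw [map_smul, smul_eq_mul, ← hinv g⁻¹ v, ← rep_mul, inv_mul_cancel, rep_one]
  simp only [h2] at h1
  rw [integral_eq_sum_rightCosets μ (c := cosetRep ϖ) (fun i j h => cosetRep_injective hϖ h)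
    (fun k hk g => by
      rw [hφl k hk, _root_.mul_inv_rev, rep_mul_fixed hv.mem _ (inv_mem hk)])
    (fun g hg => by
      rw [hφ0 g fun h => ?_, zero_mul]
      obtain ⟨i, hi⟩ := exists_mul_cosetRep_inv_mem hϖ h
      exact hg i hi), hc, map_smul, smul_eq_mul] at h1
  have h3 : Θ (∑ i, starRingEnd ℂ (φ (cosetRep ϖ i)) • π (cosetRep ϖ i)⁻¹ v) w =
      ∑ i, φ (cosetRep ϖ i) * Θ (π (cosetRep ϖ i)⁻¹ v) w := by
    rw [← hsymm, map_sum, map_sum]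
    simp only [map_smul, smul_eq_mul, map_mul, Complex.conj_conj, hsymm]
  rw [hc, h3, div_mul_eq_mul_div, ← h1, mul_div_cancel_right₀ _ hne]

variable [MeasurableSpace F] [BorelSpace F] {ν : Measure Fˣ} [ν.IsHaarMeasure] {η : Fˣ → ℂ}

namespace IsSphericalWhittaker

variable (h : IsSphericalWhittaker π ψ κ v)
include h

/-- The vector that represents the test function `f^□`. -/
lemma sum_fSquare [Fintype 𝓀[F]] (hν : ν {a : Fˣ | ord (a : F) = 0} = 1) {ϖ : Fˣ}
    (hϖ : ord (ϖ : F) = 1) (a : Fˣ) :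
    κ (∑ i, starRingEnd ℂ (fSquare ν (cosetRep ϖ i)) • π (cosetRep ϖ i)⁻¹ v) (torus a) =
      (∑ u : 𝓀[F], etaBar u * (ψ (-(a * lift F u)) : ℂ)) * torusValue κ v (ord (a : F) + 1) := by
  rw [map_sum, Finset.sum_apply, Fintype.sum_option, fSquare_cosetRep_none hν hϖ, map_zero,
    zero_smul, map_zero, Pi.zero_apply, zero_add, Finset.sum_mul]
  refine Finset.sum_congr rfl fun u _ => ?_
  rw [fSquare_cosetRep_some hν hϖ, conj_etaBar, map_smul, Pi.smul_apply, cosetRep_some_inv,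
    h.map.rep_borel, h.apply_torus, ord_mul_units, hϖ, smul_eq_mul, mul_neg, mul_assoc]

/-- `W` is unit-invariant on the torus while `η` is ramified, so every shell integrates to zero;
with both bounds `0` the range of shells is empty. -/
lemma lambdaNat_conj_self (hν : ν {a : Fˣ | ord (a : F) = 0} = 1) (hodd : ringChar 𝓀[F] ≠ 2)
    (hη : IsRamifiedQuadraticChar η) (s : ℂ) :
    lambdaNat ν π (fun g => starRingEnd ℂ (κ v g)) η s = 0 := by
  obtain ⟨u, hu⟩ := exists_etaBar_eq_neg_one hodd
  have h1 := h.isLambdaNat_conj (w := v) (M := 0) (N := 0) hν hodd hη (ord_liftUnit u)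
    (by rw [red_liftUnit, hu]) (fun a ha => by rw [h.apply_torus, h.torusValue_neg ha])
    (fun a _ => by rw [h.apply_torus, h.apply_torus, ord_mul_units, ord_liftUnit, zero_add])
  rw [lambdaNat_eq h1, Finset.Ico_self, Finset.sum_empty]

/-- On `ord a ≥ 0` the character `ψ` is trivial and `η̄` sums to zero; below `-1` the factor `W(a
ϖ)` vanishes. On the shell `-1` that factor is `1`, and what remains is the Gauss sum. -/
lemma lambdaNat_conj_sum [Fintype 𝓀[F]] (hν : ν {a : Fˣ | ord (a : F) = 0} = 1)
    (hodd : ringChar 𝓀[F] ≠ 2) (hη : IsRamifiedQuadraticChar η) {ϖ : Fˣ} (hϖ : ord (ϖ : F) = 1)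
    {a' : Fˣ} (ha' : ord (a' : F) = -1) (s : ℂ) :
    lambdaNat ν π (fun g => starRingEnd ℂ (κ (∑ i, starRingEnd ℂ (fSquare ν (cosetRep ϖ i)) •
      π (cosetRep ϖ i)⁻¹ v) g)) η s = gaussSumAt η ψ a' * (q F : ℂ) ^ s := by
  obtain ⟨u, hu⟩ := exists_etaBar_eq_neg_one hodd
  set X := ∑ i, starRingEnd ℂ (fSquare ν (cosetRep ϖ i)) • π (cosetRep ϖ i)⁻¹ v with hX
  have hval : ∀ a : Fˣ, κ X (torus a) = (∑ u : 𝓀[F], etaBar u * (ψ (-(a * lift F u)) : ℂ)) *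
      torusValue κ v (ord (a : F) + 1) := h.sum_fSquare hν hϖ
  have hpos : ∀ a : Fˣ, 0 ≤ ord (a : F) → κ X (torus a) = 0 := by
    intro a ha
    have h1 : ∀ u : 𝓀[F], (ψ (-(a * lift F u)) : ℂ) = 1 := fun u => by
      rw [addChar_eq_one h.addChar (neg_mem (mul_mem ((units_mem_integer_iff a).2 ha)
        (lift F u).2)), Circle.coe_one]
    rw [hval]
    simp only [h1, mul_one]
    rw [sum_etaBar hodd, zero_mul]
  have h1 := h.isLambdaNat_conj (w := X) (M := -1) (N := 0) hν hodd hη (ord_liftUnit u)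
    (by rw [red_liftUnit, hu])
    (fun a ha => by rw [hval, h.torusValue_neg (by omega), mul_zero])
    (fun a ha => by
      rw [hpos a ha, hpos]
      rw [ord_mul_units, ord_liftUnit, zero_add]
      exact ha)
  have hIco : Finset.Ico (-1 : ℤ) 0 = {-1} := rfl
  rw [lambdaNat_eq h1, hIco, Finset.sum_singleton, zpow_neg_one, ← Complex.cpow_neg, neg_neg]
  congr 1
  have h2 : {a : Fˣ | ord (a : F) = -1}.indicator
      (fun a => starRingEnd ℂ (κ X (torus a)) * η a) =
      {a : Fˣ | ord (a : F) = -1}.indicator fun _ => gaussSumAt η ψ a' := by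
    refine Set.indicator_congr fun a ha => ?_
    have ha1 : ord (a : F) = -1 := ha
    rw [hval, ha1, neg_add_cancel, h.torusValue_zero, mul_one, ← gaussSumAt_eq hη h.addChar ha1 ha',
      map_sum, Finset.sum_mul, gaussSumAt]
    refine Finset.sum_congr rfl fun u _ => ?_
    rw [map_mul, conj_etaBar, AddChar.map_neg_eq_inv, Circle.coe_inv_eq_conj, Complex.conj_conj]
    ring
  rw [h2, integral_indicator_const _ (isOpen_ord_eq (-1)).measurableSet, Measure.real,
    measure_ord_eq ν hν, ENNReal.toReal_one, one_smul]

/-- The spherical character as a value of the functional `λ♮(·, η, s)`. -/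
lemma sphericalCharacter_eq {𝒲 : Submodule ℂ (PGL(2, F) → ℂ)} {ι : Type*}
    (b : Module.Basis ι ℂ 𝒲) (hb : IsOrthogonalBasis ν π b) {B : Module.Basis ι ℂ V}
    (hB : ∀ i, κ (B i) = b i) {Θ : V → V →ₗ[ℂ] ℂ}
    (hΘ : ∀ w w', Θ w w' = thetaNat ν π (κ w') (κ w))
    (hsymm : ∀ w w', starRingEnd ℂ (Θ w w') = Θ w' w) (hne : ∀ w, w ≠ 0 → Θ w w ≠ 0)
    {s₁ s₂ : ℂ} {L : V →ₛₗ[starRingEnd ℂ] ℂ}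
    (hL : ∀ w, L w = lambdaNat ν π (fun g => starRingEnd ℂ (κ w g)) η (s₁ - s₂))
    {f : PGL(2, F) → ℂ} {t : ℂ} {X : V}
    (hf : ∀ w, lambdaNat ν π (heckeAction μ f (κ w)) (fun _ => 1) (s₁ + s₂) = t * Θ X w) :
    sphericalCharacter μ ν π η b f s₁ s₂ = t * L X := by
  rw [← finsum_orthogonal_basis B hsymm hne (fun i j hij => by
    change Θ (B j) (B i) = 0
    rw [hΘ, hB, hB]
    exact hb hij) L X,
    sphericalCharacter, ← smul_eq_mul, smul_finsum]
  refine finsum_congr fun i => ?_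
  rw [← hB, hf, hL, hΘ (B i) (B i), smul_eq_mul]
  ring

end IsSphericalWhittaker

end Final

end LocalSpherical

namespace LocalSpherical

/-! ### Comparison of the two spherical characters -/

section Main

variable {F : Type*} [Field F] [ValuativeRel F] [TopologicalSpace F] [IsNonarchimedeanLocalField F]
  {V : Type*} [AddCommGroup V] [Module ℂ V] {π : Representation ℂ PGL(2, F) V}
  {ψ : AddChar F Circle} {κ : V →ₗ[ℂ] (PGL(2, F) → ℂ)} {v : V}

lemma isRamifiedQuadraticChar_eta (hodd : ringChar 𝓀[F] ≠ 2) {L : Type*} [Field L] [Algebra F L]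
    (hL : Module.finrank F L = 2) (hram : IsRamifiedExtension F L) :
    IsRamifiedQuadraticChar (eta F L) where
  map_one := by rw [eta_eq hodd hL hram (by simp), Units.val_one, red_one, etaBar_one]
  mul_unit a _ hu := eta_mul_unit hodd hL hram a hu
  eq_or := eta_eq_or

variable (μ : Measure PGL(2, F)) [μ.IsHaarMeasure] [MeasurableSpace F] [BorelSpace F]
  {ν : Measure Fˣ} [ν.IsHaarMeasure]

/-- The part of `h^□` that is odd under the torus. -/
lemma testInt_odd_part (hπ : ∀ v : V, IsOpen {g : PGL(2, F) | π g v = v})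
    (hν : ν {a : Fˣ | ord (a : F) = 0} = 1) {u : Fˣ} (hu : ord (u : F) = 0)
    (hu' : etaBar (red (u : F)) = -1) (w : V) :
    π (torus u) (testInt μ fun g => (fCol ν g * (1 + fSquare ν g)) • π g w) =
      -testInt μ fun g => (fCol ν g * (1 + fSquare ν g)) • π g w := by
  have hr : IsTestFun fun g : PGL(2, F) => fCol ν g * (1 + fSquare ν g) :=
    (isTestFun_fCol hν).mul ((isTestFun_fSquare hν).isLocallyConstant.comp (1 + ·))
  have ht := hr.smul (isLocallyConstant_rep hπ w)
  -- Translation by `torus u` multiplies `fCol` by `η̄(u) = -1` and fixes `fSquare`.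
  conv_rhs => rw [← testInt_mul_left μ ht (torus u)]
  rw [testInt_map μ ht, ← neg_one_smul ℂ (testInt μ _), ← testInt_smul μ (ht.mul_left (torus u))]
  congr 1
  funext g
  rw [fCol_torus_mul hν hu, fSquare_mul_left hν (torus_mem_maxCompact hu), hu', map_smul, rep_mul,
    smul_smul]
  congr 1
  ring

lemma testInt_hSquare (hπ : ∀ v : V, IsOpen {g : PGL(2, F) | π g v = v})
    (hodd : ringChar 𝓀[F] ≠ 2) (hν : ν {a : Fˣ | ord (a : F) = 0} = 1) (w : V) :
    testInt μ (fun g => hSquare ν g • π g w) = testInt μ (fun g => detOneInd g • π g w) +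
      testInt μ (fun g => fSquare ν g • π g w) +
        testInt μ fun g => (fCol ν g * (1 + fSquare ν g)) • π g w := by
  have hr : IsTestFun fun g : PGL(2, F) => fCol ν g * (1 + fSquare ν g) :=
    (isTestFun_fCol hν).mul ((isTestFun_fSquare hν).isLocallyConstant.comp (1 + ·))
  have hw := isLocallyConstant_rep hπ w
  rw [← testInt_add μ (isTestFun_detOneInd.smul hw) ((isTestFun_fSquare hν).smul hw),
    ← testInt_add μ ((isTestFun_detOneInd.smul hw).add ((isTestFun_fSquare hν).smul hw))
      (hr.smul hw)]
  simp only [hSquare_eq hodd hν, add_smul]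

lemma isTestFun_hSquare (hodd : ringChar 𝓀[F] ≠ 2) (hν : ν {a : Fˣ | ord (a : F) = 0} = 1) :
    IsTestFun (hSquare ν : PGL(2, F) → ℂ) := by
  have hr : IsTestFun fun g : PGL(2, F) => fCol ν g * (1 + fSquare ν g) :=
    (isTestFun_fCol hν).mul ((isTestFun_fSquare hν).isLocallyConstant.comp (1 + ·))
  have := (isTestFun_detOneInd.add (isTestFun_fSquare hν)).add hr
  rwa [← funext (hSquare_eq hodd hν)] at this

/-- Both spherical characters are given by the functional `λ♮(·, η, s₁ - s₂)` at the same vector. -/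
lemma IsSphericalWhittaker.sphericalCharacter_fSquare_hSquare [Fintype 𝓀[F]]
    (h : IsSphericalWhittaker π ψ κ v)
    (hodd : ringChar 𝓀[F] ≠ 2) (hν : ν {a : Fˣ | ord (a : F) = 0} = 1) {η : Fˣ → ℂ}
    (hη : IsRamifiedQuadraticChar η) {𝒲 : Submodule ℂ (PGL(2, F) → ℂ)} {ι : Type*}
    (b : Module.Basis ι ℂ 𝒲) (hb : IsOrthogonalBasis ν π b) {B : Module.Basis ι ℂ V}
    (hB : ∀ i, κ (B i) = b i) {a' : Fˣ} (ha' : ord (a' : F) = -1) (s₁ s₂ : ℂ) :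
    sphericalCharacter μ ν π η b (hSquare ν) s₁ s₂ =
      (μ.real (maxCompact F : Set PGL(2, F)) : ℂ) / (1 - (q F : ℂ)⁻¹ ^ 2) *
        (gaussSumAt η ψ a' * (q F : ℂ) ^ (s₁ - s₂)) ∧
    sphericalCharacter μ ν π η b (fSquare ν) s₁ s₂ =
      (μ.real (maxCompact F : Set PGL(2, F)) : ℂ) / (1 - (q F : ℂ)⁻¹ ^ 2) *
        (gaussSumAt η ψ a' * (q F : ℂ) ^ (s₁ - s₂)) := by
  obtain ⟨Θ, hΘ, hsymm, hinv, hne⟩ := h.exists_thetaForm hν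
  obtain ⟨L, hL⟩ := h.exists_conjLambda hν hodd hη (s₁ - s₂)
  obtain ⟨u, hu⟩ := exists_etaBar_eq_neg_one hodd
  have hϖ := ord_uniformizer (F := F)
  have hπ := h.admissible.smooth
  set X := ∑ i, starRingEnd ℂ (fSquare ν (cosetRep (uniformizer F) i)) •
    π (cosetRep (uniformizer F) i)⁻¹ v with hX
  have hΘv : Θ v v = 1 - (q F : ℂ)⁻¹ ^ 2 := by rw [hΘ, h.thetaNat_self hν]
  have hLX : L X = gaussSumAt η ψ a' * (q F : ℂ) ^ (s₁ - s₂) := by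
    rw [hL, hX, h.lambdaNat_conj_sum hν hodd hη hϖ ha']
  have hLv : L v = 0 := by rw [hL, h.lambdaNat_conj_self hν hodd hη]
  have hf := fun w => testInt_eq_smul μ h.admissible h.hecke hsymm hinv (hne v h.hecke.ne_zero) hϖ
    (isTestFun_fSquare hν) (fun k hk g => fSquare_mul_left hν hk g) (fun g hg => fSquare_eq_zero hg)
    w
  have h1 := fun w => testInt_eq_smul μ h.admissible h.hecke hsymm hinv (hne v h.hecke.ne_zero) hϖ
    isTestFun_detOneInd (fun k hk g => detOneInd_mul_left hk g) (fun g hg => if_neg hg) w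
  have hsum : ∑ i, starRingEnd ℂ (detOneInd (cosetRep (uniformizer F) i)) •
      π (cosetRep (uniformizer F) i)⁻¹ v = heckeT π (uniformizer F) v := by
    rw [heckeT_eq_sum_cosetRep hϖ h.hecke.mem]
    refine Finset.sum_congr rfl fun i _ => ?_
    rw [detOneInd, if_pos (cosetRep_mem hϖ i), map_one, one_smul]
  rw [hsum, h.hecke.heckeT_eq _ hϖ] at h1
  have hadd : ∀ x y w, Θ (x + y) w = Θ x w + Θ y w := fun x y w => by
    rw [← hsymm, map_add, map_add, hsymm, hsymm]
  rw [← hΘv, ← hLX]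
  constructor
  -- The indicator part of `h^□` adds the Hecke eigenvalue times `v` to `X`, which `L` does not see
  -- because `L v = 0`.
  · have hL' : L X = L (((Real.sqrt (q F) : ℂ) * (satake π + (satake π)⁻¹)) • v + X) := by
      rw [map_add, LinearMap.map_smulₛₗ, hLv, smul_zero, zero_add]
    rw [hL']
    refine h.sphericalCharacter_eq μ b hb hB hΘ hsymm hne hL fun w => ?_
    rw [h.map.heckeAction_eq μ hπ (isTestFun_hSquare hodd hν), testInt_hSquare μ hπ hodd hν, hf, h1,
      ← add_smul, h.lambdaNat_one hν _ (ord_liftUnit u)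
        (testInt_odd_part μ hπ hν (ord_liftUnit u) (by rw [red_liftUnit, hu]) w), ← mul_add,
      hadd]
  · refine h.sphericalCharacter_eq μ b hb hB hΘ hsymm hne hL fun w => ?_
    -- There is no odd part here; the zero vector serves as one, with `u = 1`.
    rw [h.map.heckeAction_eq μ hπ (isTestFun_fSquare hν), hf, ← add_zero (_ • v),
      h.lambdaNat_one hν _ (u := 1) (w := 0) (by simp) (by simp)]

end Main

end LocalSpherical

open LocalSpherical in
theorem mainTheorem9
    {F : Type*} [Field F] [ValuativeRel F] [TopologicalSpace F] [IsNonarchimedeanLocalField F]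
    [MeasurableSpace F] [BorelSpace F] (hodd : ringChar 𝓀[F] ≠ 2)
    {L : Type*} [Field L] [Algebra F L] (hL : Module.finrank F L = 2)
    (hram : LocalSpherical.IsRamifiedExtension F L)
    (ψ : AddChar F Circle) (hψ : LocalSpherical.IsUnramifiedAddChar ψ)
    (μ : Measure PGL(2, F)) [μ.IsHaarMeasure]
    (ν : Measure Fˣ) [ν.IsHaarMeasure] (hν : ν {a : Fˣ | LocalSpherical.ord (a : F) = 0} = 1)
    {V : Type*} [AddCommGroup V] [Module ℂ V] (π : Representation ℂ PGL(2, F) V)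
    (hπ : LocalSpherical.IsIrreducibleAdmissible π) (hunit : LocalSpherical.IsUnitary π)
    (hunr : LocalSpherical.IsUnramified π)
    (𝒲 : Submodule ℂ (PGL(2, F) → ℂ)) (h𝒲 : LocalSpherical.IsWhittakerModel π ψ 𝒲)
    {ι : Type*} (b : Module.Basis ι ℂ 𝒲) (hb : LocalSpherical.IsOrthogonalBasis ν π b)
    (a' : Fˣ) (ha' : LocalSpherical.ord (a' : F) = -1) (s₁ s₂ : ℂ) :
    LocalSpherical.sphericalCharacter μ ν π (LocalSpherical.eta F L) b
        (LocalSpherical.hSquare ν) s₁ s₂ =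
      LocalSpherical.sphericalCharacter μ ν π (LocalSpherical.eta F L) b
        (LocalSpherical.fSquare ν) s₁ s₂ ∧
    LocalSpherical.sphericalCharacter μ ν π (LocalSpherical.eta F L) b
        (LocalSpherical.fSquare ν) s₁ s₂ =
      (μ.real (LocalSpherical.maxCompact F : Set PGL(2, F)) : ℂ) *
        (1 - (LocalSpherical.q F : ℂ) ^ (-2 : ℤ))⁻¹ *
        (LocalSpherical.eta F L (-1) *
          starRingEnd ℂ (LocalSpherical.epsilonFactor (LocalSpherical.eta F L) ψ a')) *
        (LocalSpherical.q F : ℂ) ^ (s₁ - s₂ + 1 / 2) := by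
  have : Fintype 𝓀[F] := Fintype.ofFinite _
  obtain ⟨e, he⟩ := h𝒲.iso
  set κ : V →ₗ[ℂ] (PGL(2, F) → ℂ) := 𝒲.subtype ∘ₗ (e : V →ₗ[ℂ] 𝒲) with hκdef
  have hκ : IsWhittakerMap π ψ κ := ⟨he, fun v x g => h𝒲.whittaker _ (e v).2 x g,
    Subtype.val_injective.comp e.injective⟩
  obtain ⟨v, h⟩ := exists_isSphericalWhittaker hπ hunit hunr hψ hκ
  have hη := isRamifiedQuadraticChar_eta hodd hL hram
  have hB : ∀ i, κ ((b.map e.symm) i) = b i := fun i => by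
    rw [Module.Basis.map_apply, hκdef, LinearMap.comp_apply, LinearEquiv.coe_coe,
      LinearEquiv.apply_symm_apply]
    rfl
  obtain ⟨h1, h2⟩ := h.sphericalCharacter_fSquare_hSquare μ hodd hν hη b hb hB ha' s₁ s₂
  refine ⟨h1.trans h2.symm, h2.trans ?_⟩
  -- The `1/2` in the exponent compensates the `q ^ (-1/2)` in the epsilon factor.
  have hε : (((q F : ℝ) ^ (-(1 / 2) : ℝ) : ℝ) : ℂ) * (q F : ℂ) ^ (s₁ - s₂ + 1 / 2) =
      (q F : ℂ) ^ (s₁ - s₂) := by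
    rw [Complex.ofReal_cpow (Nat.cast_nonneg _), Complex.ofReal_natCast,
      ← Complex.cpow_add _ _ q_ne_zero]
    congr 1
    push_cast
    ring
  rw [epsilonFactor_eq hη, map_mul, Complex.conj_ofReal, ← hε]
  nth_rw 1 [← gaussSumAt_eq_conj hη hψ ha']
  rw [zpow_neg, zpow_ofNat, inv_pow]
  ring
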